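/- Let $k$ be an algebraically closed field. An *aggregate* over $k$ is a $k$-linear category $\mathcal A$ (composition is bilinear) with finite-dimensional morphism spaces, finite direct sums, and in which every idempotent endomorphism has a kernel. A *spectroid* of such a category is a choice $\mathcal J$ of exactly one representative of each isomorphism class of indecomposable objects; $\mathcal R(a,b)\subseteq\mathcal A(a,b)$ denotes the radical, which for $a,b\in\mathcal J$ consists of the non-invertible morphisms. A *module* $M$ over $\mathcal A$ is a $k$-linear functor from $\mathcal A$ to finite-dimensional $k$-vector spaces; it is *faithful* if $M(f)\neq 0$ for every $f\ne 0$. We write $fm=M(f)(m)$. A *space* on $M$ is a triple $(V,h,X)$ with $V$ a finite-dimensional $k$-vector space, $X\in\mathcal A$ and $h\colon V\to M(X)$ linear; a morphism $(V,h,X)\to(V',h',X')$ is a pair $(\varphi,\xi)$ with $\varphi\colon V\to V'$ linear, $\xi\in\mathcal A(X,X')$ and $h'\varphi=M(\xi)h$. The module $M$ is *finitely spaced* if the category $M^k$ of spaces on $M$ has only finitely many isomorphism classes of indecomposable objects. A *basis* of $(M,\mathcal A)$ consists of bases $m^a_1,m^a_2,\dots$ of the spaces $M(a)$, $a\in\mathcal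 J$, and bases $f^{ba}_1,f^{ba}_2,\dots$ of the spaces $\mathcal R(a,b)$, $a,b\in\mathcal J$. Its *rank* is the maximal rank of the linear maps $M(f^{ba}_l)$. The basis is *scalarly multiplicative* if (a) each $f=f^{ba}_l$ is *thin*: whenever $f=g+h$ with $g,h\in\mathcal A(a,b)$, then $\operatorname{rank}M(f)\le\operatorname{rank}M(g)$ or $\operatorname{rank}M(f)\le\operatorname{rank}M(h)$; (b) each product $f^{ba}_lm^a_i$ has the form $\lambda m^b_p$ with $\lambda\in k$; (c) if $f^{ba}_lm^a_i=\lambda m^b_p$ and $f^{ba}_lm^a_j=\mu m^b_p$ with $\lambda,\mu\in k\setminus\{0\}$, then $i=j$. It is *multiplicative* if it is scalarly multiplicative and each nonzero product $f^{ba}_lm^a_i$ is a basis vector $m^b_p$. **Theorem.** Let $M$ be a faithful finitely spaced module over an aggregate $\mathcal A$ over $k$, and let $\mathcal J$ be a spectroid of $\mathcal A$. Then $(M,\mathcal A)$ admits a multiplicative basis of rank $\le 2$. -/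

import Mathlib

open CategoryTheory CategoryTheory.Limits

universe u v w

namespace Aggregate

attribute [instance] hasBinaryBiproducts_of_finite_biproducts

/-- A spectroid of `D`, given by its set of objects: chosen representatives of the isomorphism
classes of indecomposable objects. -/
structure IsSpectroid {D : Type w} [Category.{v} D] [Preadditive D] [HasFiniteBiproducts D]
    (J : Set D) : Prop where
  indecomposable : ∀ a ∈ J, Indecomposable a
  eq_of_iso : ∀ a ∈ J, ∀ b ∈ J, Nonempty (a ≅ b) → a = b
  exists_iso : ∀ X : D, Indecomposable X → ∃ a ∈ J, Nonempty (X ≅ a)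

/-- The (Jacobson) radical of a `k`-linear category: `f : X ⟶ Y` is in the radical if and only if
`𝟙 X - f ≫ g` is invertible for each `g : Y ⟶ X`. In an aggregate, the radical morphisms between
indecomposables are precisely the non-invertible ones. -/
def radical (k : Type u) [Field k] {C : Type w} [Category.{v} C] [Preadditive C] [Linear k C]
    (X Y : C) : Submodule k (X ⟶ Y) where
  carrier := {f | ∀ g : Y ⟶ X, IsIso (𝟙 X - f ≫ g)}
  zero_mem' g := by
    simp only [zero_comp, sub_zero]
    infer_instance
  add_mem' {f₁ f₂} h₁ h₂ g := by
    have := h₁ g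
    have := h₂ (g ≫ inv (𝟙 X - f₁ ≫ g))
    have e : 𝟙 X - (f₁ + f₂) ≫ g =
        (𝟙 X - f₂ ≫ g ≫ inv (𝟙 X - f₁ ≫ g)) ≫ (𝟙 X - f₁ ≫ g) := by
      rw [Preadditive.sub_comp, Category.assoc, Category.assoc, IsIso.inv_hom_id,
        Category.comp_id, Category.id_comp, Preadditive.add_comp]
      abel
    rw [e]
    infer_instance
  smul_mem' c f h g := by
    have e : (c • f) ≫ g = f ≫ (c • g) := by simp
    rw [e]
    exact h (c • g)

section Module

variable {k : Type u} [Field k] {C : Type w} [Category.{v} C] [Preadditive C] [Linear k C]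

/-- The category `M^k` of spaces on a module `M`. An object is a triple `(V, X, h)` with `V` a
finite-dimensional vector space, `X` an object of `C` and `h : V ⟶ M.obj X` linear; a morphism to
`(V', X', h')` is a pair `φ : V ⟶ V'`, `ξ : X ⟶ X'` with `φ ≫ h' = h ≫ M.map ξ`. -/
abbrev Spaces (M : C ⥤ FGModuleCat.{u} k) := Comma (𝟭 (FGModuleCat.{u} k)) M

instance (M : C ⥤ FGModuleCat.{u} k) [M.Additive] [HasFiniteBiproducts C] :
    HasFiniteBiproducts (Spaces M) :=
  have : HasFiniteCoproducts (Spaces M) := ⟨fun _ => inferInstance⟩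
  HasFiniteBiproducts.of_hasFiniteCoproducts

/-- `M` is finitely spaced if `M^k` has a finite spectroid. -/
def FinitelySpaced (M : C ⥤ FGModuleCat.{u} k) [M.Additive] [HasFiniteBiproducts C] : Prop :=
  ∃ S : Set (Spaces M), IsSpectroid S ∧ S.Finite

/-- The linear map `m ↦ fm` from `M(a)` to `M(b)`. -/
def act (M : C ⥤ FGModuleCat.{u} k) {a b : C} (f : a ⟶ b) : M.obj a →ₗ[k] M.obj b :=
  (M.map f).hom.hom

/-- The rank of `M(f)`. -/
noncomputable def rk (M : C ⥤ FGModuleCat.{u} k) {a b : C} (f : a ⟶ b) : ℕ :=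
  Module.finrank k (LinearMap.range (act M f))

/-- `f` is thin if it is not a sum of two morphisms both acting with smaller rank. -/
def IsThin (M : C ⥤ FGModuleCat.{u} k) {a b : C} (f : a ⟶ b) : Prop :=
  ∀ g h : a ⟶ b, f = g + h → rk M f ≤ rk M g ∨ rk M f ≤ rk M h

/-- A basis of `(M, C)` with respect to the spectroid with set of objects `J`: bases of the spaces
`M(a)` and of the spaces of radical morphisms from `a` to `b`, for `a`, `b` in `J`. -/
structure PairBasis (M : C ⥤ FGModuleCat.{u} k) (J : Set C) where
  m (a : J) : Module.Basis (Fin (Module.finrank k (M.obj a.1))) k (M.obj a.1)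
  f (a b : J) : Module.Basis (Fin (Module.finrank k (radical k a.1 b.1))) k (radical k a.1 b.1)

namespace PairBasis

variable {M : C ⥤ FGModuleCat.{u} k} {J : Set C}

/-- The product of a basis morphism and a basis vector. -/
noncomputable def prod (B : PairBasis M J) {a b : J}
    (l : Fin (Module.finrank k (radical k a.1 b.1))) (i : Fin (Module.finrank k (M.obj a.1))) :
    M.obj b.1 :=
  act M (B.f a b l : a.1 ⟶ b.1) (B.m a i)

structure IsScalarlyMultiplicative (B : PairBasis M J) : Prop where
  thin : ∀ (a b : J) l, IsThin M (B.f a b l : a.1 ⟶ b.1)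
  prod_eq_smul : ∀ (a b : J) l i, ∃ (c : k) (p : _), B.prod (a := a) (b := b) l i = c • B.m b p
  inj : ∀ (a b : J) l i j p (c d : k), c ≠ 0 → d ≠ 0 →
    B.prod (a := a) (b := b) l i = c • B.m b p → B.prod (a := a) (b := b) l j = d • B.m b p → i = j

structure IsMultiplicative (B : PairBasis M J) : Prop extends IsScalarlyMultiplicative B where
  prod_eq : ∀ (a b : J) l i, B.prod (a := a) (b := b) l i ≠ 0 →
    ∃ p, B.prod (a := a) (b := b) l i = B.m b p

/-- The rank of the basis is at most `n`. -/
def RankLE (B : PairBasis M J) (n : ℕ) : Prop :=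
  ∀ (a b : J) l, rk M (B.f a b l : a.1 ⟶ b.1) ≤ n

end PairBasis

end Module

end Aggregate

set_option linter.unusedSectionVars false
set_option linter.unusedTactic false
set_option linter.unreachableTactic false

/-! Finiteness bounds dimensions. If `M^k` has finitely many indecomposables, then for fixed
dimensions the linear maps into `M(X)` fall into finitely many orbits under `Aut X` and the column
operations. A count of parameters on an associated graded problem, where the scalars act trivially,
then shows that a Tits form is positive (`HasFiniteOrbits.tits`). All combinatorial restrictions
come from exhibiting dimension vectors on which this form would vanish, together with one variant in
which a radical diagonal contributes a single parameter (`HasFiniteOrbits.not_diagonal_line`).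

Consequences: each `M(a)`, `a ∈ J`, has dimension at most 3 and a basis permuted by a nilpotent
shift coming from the radical. Morphisms thus become `3 × 3` matrices, collected in `RadicalModel`.
The relation "some radical morphism takes basis vector `s` to a vector involving `t`" is a strict
partial order, and two vectors of different three-dimensional objects are comparable.

Since each `R(a,b)` is stable under both shifts, it behaves like an ideal of `k[x,y]/(x³,y³)`, and
`single_mem_of_lt` shows that it contains every matrix unit strictly beyond its support. What
remains are the tied positions, which form a strictly increasing chain. They carry either one
combination `E + cE'` of two matrix units, or, in the generic case, a plane of diagonal matrices. So
`R(a,b)` is spanned by matrix units and such links. A link is not a sum of two radical matrices of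
rank one, whence thinness and rank at most 2.

To make the basis multiplicative the constants `c` must be absorbed by rescaling the basis vectors.
A link joins two pairs of vectors and prescribes a ratio of scalars. Links with a common target or
source compose, so it suffices to treat the nearest source of each target, and in the generic case
one of three links may be dropped. The resulting monomial equations have exponent vectors that are
linearly independent over `ℤ` (`eq_zero_of_relation`, a flow argument on the poset). As the unit
group of an algebraically closed field is divisible, they are solvable. -/

namespace Aggregate

/-! ### Dimension count for actions with finitely many orbits. -/

/-- Finitely many polynomial images of an affine space of smaller dimension do not cover a
principal open subset of affine space. -/
theorem exists_notMem_range_polynomialMap {k : Type u} [Field k] [Infinite k] {T D N : Type*}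
    [Finite T] [Fintype D] [Fintype N] (hDN : Fintype.card D < Fintype.card N)
    (f : T → N → MvPolynomial D k) (Δ : MvPolynomial N k) (hΔ : Δ ≠ 0) :
    ∃ z : N → k, MvPolynomial.eval z Δ ≠ 0 ∧
      ∀ t (y : D → k), z ≠ fun n => MvPolynomial.eval y (f t n) := by
  classical
  have := Fintype.ofFinite T
  have h1 : ∀ t, ∃ P : MvPolynomial N k, P ≠ 0 ∧ MvPolynomial.aeval (f t) P = 0 := by
    intro t
    -- Without a relation, `card N` algebraically independent elements would live in a ring of
    -- transcendence degree `card D`.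
    by_contra! hcon
    have hai : AlgebraicIndependent k (f t) := by
      rw [AlgebraicIndependent, injective_iff_map_eq_zero]
      intro P hP
      by_contra hne
      exact hcon P hne hP
    have := hai.lift_cardinalMk_le_trdeg
    rw [MvPolynomial.trdeg_of_isDomain] at this
    simp only [Cardinal.mk_fintype, Cardinal.lift_natCast, Nat.cast_le] at this
    omega
  choose P hP0 hP using h1
  have hne : Δ * ∏ t, P t ≠ 0 := mul_ne_zero hΔ (Finset.prod_ne_zero_iff.2 fun t _ => hP0 t)
  obtain ⟨z, hz⟩ : ∃ z : N → k, MvPolynomial.eval z (Δ * ∏ t, P t) ≠ 0 := by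
    by_contra! hcon
    exact hne (MvPolynomial.funext fun z => by simpa using hcon z)
  rw [map_mul, map_prod] at hz
  refine ⟨z, left_ne_zero_of_mul hz, fun t y hzy => ?_⟩
  have h2 := Finset.prod_ne_zero_iff.1 (right_ne_zero_of_mul hz) t (Finset.mem_univ _)
  apply h2
  have h3 := congrArg (MvPolynomial.eval y) (hP t)
  rw [map_zero] at h3
  rw [hzy, ← h3]
  have : MvPolynomial.eval (fun n => MvPolynomial.eval y (f t n)) =
      ((MvPolynomial.eval y).comp (MvPolynomial.aeval (R := k) (f t)).toRingHom) := by
    apply MvPolynomial.ringHom_ext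
    · intro r; simp
    · intro n; simp
  rw [this]; rfl

section Graded

variable {k : Type u} [Field k] {Row C : Type*} (lev : Row → ℕ) (κ : C → ℕ)

/-- The matrix supported on the pairs of equal level with the given entries there. -/
def gradedMatrix (z : {p : C × Row // lev p.2 = κ p.1} → k) : Matrix Row C k :=
  fun ρ c => if h : lev ρ = κ c then z ⟨(c, ρ), h⟩ else 0

/-- The columns of each level are linearly independent. -/
def LevelInjective [Fintype C] (H : Matrix Row C k) : Prop :=
  ∀ (l : ℕ) (y : C → k), (∀ ρ, lev ρ = l → ∑ c, (if κ c = l then H ρ c * y c else 0) = 0) →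
    ∀ c, κ c = l → y c = 0

/-- In a row of level `κ c'` the product `H * φ` only sees the entries `φ c'' c` with `c''` of that
level. The same entry of `Ξ * H'` vanishes, because `Ξ` reaches only rows of level at most `κ c'`
while column `c` of `H'` lives in the higher level `κ c`. Independence of the columns of level `κ
c'` concludes. -/
theorem blockTriangular_of_levelInjective [Fintype Row] [Fintype C] {H H' : Matrix Row C k}
    {Ξ : Matrix Row Row k} {φ : Matrix C C k} (hH : ∀ ρ c, H ρ c ≠ 0 → lev ρ = κ c)
    (hH' : ∀ ρ c, H' ρ c ≠ 0 → lev ρ = κ c) (hinj : LevelInjective lev κ H)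
    (hΞ : ∀ ρ σ, lev ρ ∈ Set.range κ → Ξ ρ σ ≠ 0 → lev σ ≤ lev ρ) (h : H * φ = Ξ * H')
    (c' c : C) (hc : κ c' < κ c) : φ c' c = 0 := by
  refine hinj (κ c') (fun c'' => φ c'' c) (fun ρ hρ => ?_) c' rfl
  have h1 : (H * φ) ρ c = 0 := by
    rw [h, Matrix.mul_apply]
    refine Finset.sum_eq_zero fun σ _ => ?_
    by_contra hne
    have h2 := hΞ ρ σ ⟨c', hρ.symm⟩ (left_ne_zero_of_mul hne)
    have h3 := hH' σ c (right_ne_zero_of_mul hne)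
    omega
  rw [Matrix.mul_apply] at h1
  refine Eq.trans ?_ h1
  refine Finset.sum_congr rfl fun c'' _ => ?_
  split_ifs with hl
  · rfl
  · have : H ρ c'' = 0 := by
      by_contra hne
      exact hl ((hH ρ c'' hne).symm.trans hρ)
    rw [this, zero_mul]

/-- If a group acts with finitely many orbits on the matrices of maps into a filtered space, then
its dimension, computed on the associated graded, exceeds that of the space of graded maps. -/
theorem not_card_le_of_finite_orbits [Infinite k] {D T : Type*} [Fintype Row] [DecidableEq Row]
    [Fintype C] [DecidableEq C] [Fintype D] [Finite T] (ε : D → Row → Row → k)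
    (𝒢 : Set (Matrix Row Row k))
    (h𝒢 : ∀ Ξ ∈ 𝒢, ∀ ρ σ, lev ρ ∈ Set.range κ → Ξ ρ σ ≠ 0 → lev σ ≤ lev ρ)
    (hε : ∀ Ξ ∈ 𝒢, ∃ ξ : D → k, ∀ ρ σ, lev ρ ∈ Set.range κ → lev σ = lev ρ →
      Ξ ρ σ = ∑ δ, ξ δ * ε δ ρ σ)
    (cls : Matrix Row C k → T)
    (hcls : ∀ H H', cls H = cls H' → ∃ Ξ ∈ 𝒢, ∃ Ξ' ∈ 𝒢, ∃ φ ψ : Matrix C C k,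
      φ * ψ = 1 ∧ ψ * φ = 1 ∧ H * φ = Ξ * H' ∧ H' * ψ = Ξ' * H)
    (σ : C → Row) (hσ : ∀ c, lev (σ c) = κ c) (hσi : Function.Injective σ) [Nonempty C]
    (hcard : Fintype.card D + Fintype.card {p : C × C // κ p.1 = κ p.2} ≤
      Fintype.card {p : C × Row // lev p.2 = κ p.1}) : False := by
  classical
  set N := {p : C × Row // lev p.2 = κ p.1}
  set SL := {p : C × C // κ p.1 = κ p.2}
  have hcard' : Fintype.card D + Fintype.card SL ≤ Fintype.card N := hcard
  -- A block diagonal minor, taken in the rows `σ c`. Where its determinant is nonzero the columns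
  -- of each level are independent; it is not the zero polynomial, since the indicator of the graph
  -- of `σ` gives the identity matrix.
  let Mp : Matrix C C (MvPolynomial N k) := Matrix.of fun c' c =>
    if h : κ c' = κ c then MvPolynomial.X ⟨(c, σ c'), (hσ c').trans h⟩ else 0
  have hMp : ∀ z : N → k, MvPolynomial.eval z Mp.det =
      (Matrix.of fun c' c => if κ c' = κ c then gradedMatrix lev κ z (σ c') c else 0).det := by
    intro z
    rw [RingHom.map_det]
    congr 1
    ext c' c
    simp only [RingHom.mapMatrix_apply, Matrix.map_apply, Matrix.of_apply, Mp, gradedMatrix]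
    split_ifs with h1 h2
    · simp
    · exact absurd ((hσ c').trans h1) h2
    · simp
  have hΔ : Mp.det ≠ 0 := by
    intro h0
    have := hMp fun n => if n.1.2 = σ n.1.1 then 1 else 0
    rw [h0, map_zero] at this
    have hone : (Matrix.of fun c' c => if κ c' = κ c then gradedMatrix lev κ
        (fun n => if n.1.2 = σ n.1.1 then (1 : k) else 0) (σ c') c else 0) = 1 := by
      ext c' c
      simp only [Matrix.of_apply, gradedMatrix, Matrix.one_apply]
      by_cases h : c' = c
      · subst h; simp [hσ]
      · have : σ c' ≠ σ c := fun h' => h (hσi h')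
        simp [h, this]
    rw [hone, Matrix.det_one] at this
    exact one_ne_zero this.symm
  have hgr : ∀ (z : N → k) ρ c, gradedMatrix lev κ z ρ c ≠ 0 → lev ρ = κ c := by
    intro z ρ c h
    by_contra hne
    exact h (by simp [gradedMatrix, hne])
  have hinj : ∀ z : N → k, MvPolynomial.eval z Mp.det ≠ 0 →
      LevelInjective lev κ (gradedMatrix lev κ z) := by
    intro z hz l y hy c hc
    rw [hMp] at hz
    have h1 := Matrix.eq_zero_of_mulVec_eq_zero hz (v := fun c => if κ c = l then y c else 0) (by
      ext c'
      simp only [Matrix.mulVec, dotProduct, Matrix.of_apply, Pi.zero_apply]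
      by_cases h : κ c' = l
      · refine Eq.trans ?_ (hy (σ c') ((hσ c').trans h))
        refine Finset.sum_congr rfl fun c'' _ => ?_
        by_cases h2 : κ c'' = l
        · simp [h, h2]
        · simp [h2]
      · refine Finset.sum_eq_zero fun c'' _ => ?_
        by_cases h2 : κ c'' = l
        · have : κ c' ≠ κ c'' := by omega
          simp [this]
        · simp [h2])
    have := congrFun h1 c
    simpa [hc] using this
  -- representatives of the classes meeting the good locus
  let rep : T → N → k := fun t =>
    if h : ∃ z : N → k, MvPolynomial.eval z Mp.det ≠ 0 ∧ cls (gradedMatrix lev κ z) = t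
    then h.choose else 0
  have hrep : ∀ z : N → k, MvPolynomial.eval z Mp.det ≠ 0 →
      MvPolynomial.eval (rep (cls (gradedMatrix lev κ z))) Mp.det ≠ 0 ∧
      cls (gradedMatrix lev κ (rep (cls (gradedMatrix lev κ z)))) =
        cls (gradedMatrix lev κ z) := by
    intro z hz
    have h : ∃ z' : N → k, MvPolynomial.eval z' Mp.det ≠ 0 ∧
      cls (gradedMatrix lev κ z') = cls (gradedMatrix lev κ z) := ⟨z, hz, rfl⟩
    simp only [rep, dif_pos h]
    exact h.choose_spec
  -- parametrisation with one coefficient normalised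
  let E : D → Type _ := fun δ₀ => {x : D ⊕ SL // x ≠ Sum.inl δ₀}
  let var : (δ₀ : D) → D ⊕ SL → MvPolynomial (E δ₀) k := fun δ₀ x =>
    if h : x = Sum.inl δ₀ then 1 else MvPolynomial.X ⟨x, h⟩
  let pm : (x : T × D) → N → MvPolynomial (E x.2) k := fun x n =>
    ∑ δ, ∑ ρ : Row, ∑ c : C, if h : κ c = κ n.1.1 then
      if lev ρ = lev n.1.2 then
      var x.2 (Sum.inl δ) * MvPolynomial.C (ε δ n.1.2 ρ * gradedMatrix lev κ (rep x.1) ρ c) *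
        var x.2 (Sum.inr ⟨(c, n.1.1), h⟩) else 0 else 0
  have hE : ∀ δ₀, Fintype.card (E δ₀) < Fintype.card N := by
    intro δ₀
    have : Fintype.card (E δ₀) = Fintype.card (D ⊕ SL) - 1 := by
      simp only [E]
      rw [Fintype.card_subtype_compl, Fintype.card_subtype_eq]
    rw [this, Fintype.card_sum]
    have : 0 < Fintype.card D := Fintype.card_pos_iff.2 ⟨δ₀⟩
    omega
  -- all parameter spaces are identified with a standard one
  have e : ∀ δ₀, E δ₀ ≃ Fin (Fintype.card (D ⊕ SL) - 1) := fun δ₀ => Fintype.equivFinOfCardEq (by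
      simp only [E]
      rw [Fintype.card_subtype_compl, Fintype.card_subtype_eq])
  obtain ⟨z, hz, hzne⟩ : ∃ z : N → k, MvPolynomial.eval z Mp.det ≠ 0 ∧
      ∀ (x : T × D) (y : E x.2 → k), z ≠ fun n => MvPolynomial.eval y (pm x n) := by
    -- If `D` is empty there is nothing to avoid, the parametrisations being indexed by `T × D`.
    rcases isEmpty_or_nonempty D with hD | ⟨⟨δ₀⟩⟩
    · by_contra! hcon
      apply hΔ
      refine MvPolynomial.funext fun z => ?_
      rw [map_zero]
      by_contra hne
      obtain ⟨x, -⟩ := hcon z hne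
      exact hD.elim x.2
    obtain ⟨z, hz, hzne⟩ := exists_notMem_range_polynomialMap
      (D := Fin (Fintype.card (D ⊕ SL) - 1)) (T := T × D)
      (by rw [← Fintype.card_congr (e δ₀)]; exact hE δ₀)
      (fun x n => MvPolynomial.rename (e x.2) (pm x n)) Mp.det hΔ
    refine ⟨z, hz, fun x y hy => hzne x (y ∘ (e x.2).symm) ?_⟩
    rw [hy]
    funext n
    rw [MvPolynomial.eval_rename]
    congr 2
    funext i
    simp
  obtain ⟨hr1, hr2⟩ := hrep z hz
  set z₀ := rep (cls (gradedMatrix lev κ z)) with hz₀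
  obtain ⟨Ξ, hΞ, Ξ', hΞ', φ, ψ, hφψ, hψφ, h1, h2⟩ := hcls _ _ hr2.symm
  have hψ := blockTriangular_of_levelInjective lev κ (hgr z₀) (hgr z) (hinj _ hr1)
    (h𝒢 _ hΞ') h2
  have hzeq : gradedMatrix lev κ z = Ξ * gradedMatrix lev κ z₀ * ψ := by
    rw [← h1, Matrix.mul_assoc, hφψ, Matrix.mul_one]
  obtain ⟨ξ, hξ⟩ := hε Ξ hΞ
  -- Only terms of equal level survive: columns of lower level are killed by the triangularity of
  -- `ψ`, those of higher level by the level condition on `Ξ`.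
  have hval : ∀ n : N, z n = ∑ δ, ∑ ρ : Row, ∑ c : C, if κ c = κ n.1.1 then
      if lev ρ = lev n.1.2 then
      ξ δ * (ε δ n.1.2 ρ * gradedMatrix lev κ z₀ ρ c) * ψ c n.1.1 else 0 else 0 := by
    rintro ⟨⟨c, ρ⟩, hn⟩
    have h3 := congrFun (congrFun hzeq ρ) c
    dsimp only at hn ⊢
    have h4 : gradedMatrix lev κ z ρ c = z ⟨(c, ρ), hn⟩ := by simp [gradedMatrix, hn]
    rw [← h4, h3, Matrix.mul_apply, Finset.sum_comm]
    simp_rw [Matrix.mul_apply, Finset.sum_mul]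
    rw [Finset.sum_comm]
    refine Finset.sum_congr rfl fun σ' _ => ?_
    rw [Finset.sum_comm]
    refine Finset.sum_congr rfl fun c'' _ => ?_
    by_cases hc : κ c'' = κ c
    · by_cases hl : lev σ' = lev ρ
      · simp only [hc, hl, if_true]
        rw [hξ ρ σ' ⟨c, hn.symm⟩ hl, Finset.sum_mul, Finset.sum_mul]
        refine Finset.sum_congr rfl fun δ _ => by ring
      · have : gradedMatrix lev κ z₀ σ' c'' = 0 := by
          by_contra hne
          have := hgr z₀ _ _ hne
          omega
        simp [this]
    · simp only [hc, if_false, Finset.sum_const_zero]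
      rcases lt_or_gt_of_ne hc with hlt | hgt
      · rw [hψ _ _ hlt, mul_zero]
      · by_contra hne
        have h5 := hgr z₀ _ _ (right_ne_zero_of_mul (left_ne_zero_of_mul hne))
        have h6 := h𝒢 Ξ hΞ ρ σ' ⟨c, hn.symm⟩ (left_ne_zero_of_mul (left_ne_zero_of_mul hne))
        omega
  obtain ⟨δ₀, hδ₀⟩ : ∃ δ₀, ξ δ₀ ≠ 0 := by
    by_contra! hcon
    obtain ⟨c⟩ := ‹Nonempty C›
    have hz0 : z = 0 := by
      funext n
      rw [hval n]
      simp [hcon]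
    have := hinj z hz (κ c) (fun _ => 1) (by
      intro ρ _
      refine Finset.sum_eq_zero fun c' _ => ?_
      simp [hz0, gradedMatrix]) c rfl
    exact one_ne_zero this
  refine hzne (cls (gradedMatrix lev κ z), δ₀)
    (fun x => Sum.elim (fun δ => ξ δ * (ξ δ₀)⁻¹) (fun s : SL => ψ s.1.1 s.1.2 * ξ δ₀) x.1) ?_
  have hvar : ∀ x, MvPolynomial.eval (fun x : E δ₀ => Sum.elim (fun δ => ξ δ * (ξ δ₀)⁻¹)
      (fun s : SL => ψ s.1.1 s.1.2 * ξ δ₀) x.1) (var δ₀ x) =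
      Sum.elim (fun δ => ξ δ * (ξ δ₀)⁻¹) (fun s : SL => ψ s.1.1 s.1.2 * ξ δ₀) x := by
    intro x
    simp only [var]
    split_ifs with h
    · subst h; simp [hδ₀]
    · simp
  funext n
  rw [hval n]
  simp only [pm, map_sum, ← hz₀]
  refine Finset.sum_congr rfl fun δ _ => Finset.sum_congr rfl fun ρ _ =>
    Finset.sum_congr rfl fun c _ => ?_
  by_cases h : κ c = κ n.1.1
  · by_cases h' : lev ρ = lev n.1.2
    · simp only [h, h', dif_pos, if_true, map_mul, hvar, MvPolynomial.eval_C, Sum.elim_inl,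
        Sum.elim_inr]
      field_simp
    · simp [h, h']
  · simp [h]

end Graded

end Aggregate

/-! ### The action of morphisms, and finiteness of spaces of bounded dimension. -/

namespace Aggregate

section Act

variable {k : Type u} [Field k] {C : Type w} [Category.{v} C] [Preadditive C]

@[simp]
theorem act_id (M : C ⥤ FGModuleCat.{u} k) (a : C) : act M (𝟙 a) = LinearMap.id := by
  simp [act]

theorem act_comp (M : C ⥤ FGModuleCat.{u} k) {a b c : C} (f : a ⟶ b) (g : b ⟶ c) :
    act M (f ≫ g) = act M g ∘ₗ act M f := by
  simp [act]

theorem act_comp_apply (M : C ⥤ FGModuleCat.{u} k) {a b c : C} (f : a ⟶ b) (g : b ⟶ c)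
    (x : M.obj a) : act M g (act M f x) = act M (f ≫ g) x := by
  rw [act_comp]; rfl

theorem act_zero (M : C ⥤ FGModuleCat.{u} k) [M.Additive] (a b : C) :
    act M (0 : a ⟶ b) = 0 := by
  simp only [act, Functor.map_zero]; rfl

theorem act_add (M : C ⥤ FGModuleCat.{u} k) [M.Additive] {a b : C} (f g : a ⟶ b) :
    act M (f + g) = act M f + act M g := by
  simp only [act, Functor.map_add]; rfl

theorem act_sub (M : C ⥤ FGModuleCat.{u} k) [M.Additive] {a b : C} (f g : a ⟶ b) :
    act M (f - g) = act M f - act M g := by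
  simp only [act, Functor.map_sub]; rfl

theorem act_injective (M : C ⥤ FGModuleCat.{u} k) [M.Faithful] {a b : C} :
    Function.Injective (act M : (a ⟶ b) → _) := by
  intro f g h
  apply M.map_injective
  ext x
  exact LinearMap.congr_fun h x

/-- The dimension of a module on a biproduct. -/
theorem finrank_biprod (M : C ⥤ FGModuleCat.{u} k) [M.Additive] [HasBinaryBiproducts C]
    (a b : C) : Module.finrank k (M.obj (a ⊞ b)) =
      Module.finrank k (M.obj a) + Module.finrank k (M.obj b) := by
  rw [← Module.finrank_prod]
  refine LinearEquiv.finrank_eq (LinearEquiv.ofLinearMap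
    ((act M (biprod.fst : a ⊞ b ⟶ a)).prod (act M (biprod.snd : a ⊞ b ⟶ b)))
    ((act M (biprod.inl : a ⟶ a ⊞ b)).coprod (act M (biprod.inr : b ⟶ a ⊞ b))) ?_ ?_)
  · apply LinearMap.ext
    rintro ⟨x, y⟩
    simp only [LinearMap.comp_apply, LinearMap.coprod_apply, LinearMap.prod_apply, Function.prod,
      map_add, LinearMap.id_apply, act_comp_apply]
    simp [act_zero]
  · apply LinearMap.ext
    intro x
    simp only [LinearMap.comp_apply, LinearMap.coprod_apply, LinearMap.prod_apply, Function.prod,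
      LinearMap.id_apply, act_comp_apply]
    rw [← LinearMap.add_apply, ← act_add, biprod.total, act_id, LinearMap.id_apply]

theorem finrank_eq_of_iso (M : C ⥤ FGModuleCat.{u} k) {a b : C} (e : a ≅ b) :
    Module.finrank k (M.obj a) = Module.finrank k (M.obj b) := by
  refine LinearEquiv.finrank_eq (LinearEquiv.ofLinearMap (act M e.hom) (act M e.inv) ?_ ?_) <;>
  · rw [← act_comp]; simp

theorem isZero_of_finrank_eq_zero (M : C ⥤ FGModuleCat.{u} k) [M.Additive] [M.Faithful] {a : C}
    (h : Module.finrank k (M.obj a) = 0) : IsZero a := by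
  rw [IsZero.iff_id_eq_zero]
  apply act_injective M
  have := Module.finrank_zero_iff.1 h
  apply LinearMap.ext
  intro x
  exact Subsingleton.elim _ _

end Act

section Linear

variable {k : Type u} [Field k] {C : Type w} [Category.{v} C] [Preadditive C] [Linear k C]

theorem act_smul (M : C ⥤ FGModuleCat.{u} k) [M.Additive] [M.Linear k] {a b : C} (c : k)
    (f : a ⟶ b) : act M (c • f) = c • act M f := by
  simp only [act, Functor.map_smul]; rfl

/-- The map on morphisms, as a linear map. -/
def actHom (M : C ⥤ FGModuleCat.{u} k) [M.Additive] [M.Linear k] (a b : C) :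
    (a ⟶ b) →ₗ[k] (M.obj a →ₗ[k] M.obj b) where
  toFun f := act M f
  map_add' := act_add M
  map_smul' := act_smul M

end Linear

section FiniteOrbits

variable {k : Type u} [Field k] {C : Type w} [Category.{v} C] [Preadditive C]
variable (M : C ⥤ FGModuleCat.{u} k) [M.Additive]

/-- The total dimension of a space on `M`. -/
noncomputable def spaceSize (Y : Spaces M) : ℕ :=
  Module.finrank k Y.left + Module.finrank k (M.obj Y.right)

instance : (𝟭 (FGModuleCat.{u} k)).Additive := ⟨rfl⟩

theorem spaceSize_biprod [HasFiniteBiproducts C] (Y Z : Spaces M) :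
    spaceSize M (Y ⊞ Z) = spaceSize M Y + spaceSize M Z := by
  have h1 : Module.finrank k (Y ⊞ Z).left = Module.finrank k Y.left + Module.finrank k Z.left :=
    finrank_biprod (Comma.fst (𝟭 (FGModuleCat.{u} k)) M) Y Z
  have h2 : Module.finrank k (M.obj (Y ⊞ Z).right) =
      Module.finrank k (M.obj Y.right) + Module.finrank k (M.obj Z.right) :=
    finrank_biprod (Comma.snd (𝟭 (FGModuleCat.{u} k)) M ⋙ M) Y Z
  simp only [spaceSize]
  omega

theorem spaceSize_eq_of_iso {Y Z : Spaces M} (e : Y ≅ Z) : spaceSize M Y = spaceSize M Z := by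
  have h1 : Module.finrank k Y.left = Module.finrank k Z.left :=
    finrank_eq_of_iso (Comma.fst (𝟭 (FGModuleCat.{u} k)) M) e
  have h2 : Module.finrank k (M.obj Y.right) = Module.finrank k (M.obj Z.right) :=
    finrank_eq_of_iso (Comma.snd (𝟭 (FGModuleCat.{u} k)) M ⋙ M) e
  simp only [spaceSize]
  omega

theorem isZero_of_spaceSize_eq_zero [M.Faithful] {Y : Spaces M} (h : spaceSize M Y = 0) :
    IsZero Y := by
  have h1 : Module.finrank k Y.left = 0 := by simp only [spaceSize] at h; omega
  have h2 : Module.finrank k (M.obj Y.right) = 0 := by simp only [spaceSize] at h; omega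
  rw [IsZero.iff_id_eq_zero]
  have h3 := Module.finrank_zero_iff.1 h1
  ext x
  · exact Subsingleton.elim (α := Y.left) _ _
  · exact (isZero_of_finrank_eq_zero M h2).eq_of_src _ _

/-- There are finitely many spaces of bounded total dimension up to isomorphism. -/
theorem exists_finite_of_spaceSize_le [HasFiniteBiproducts C] [M.Faithful]
    (hM : FinitelySpaced M) (n : ℕ) :
    ∃ T : Set (Spaces M), T.Finite ∧
      ∀ Y : Spaces M, spaceSize M Y ≤ n → ∃ Z ∈ T, Nonempty (Y ≅ Z) := by
  obtain ⟨S, hS, hSf⟩ := hM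
  obtain ⟨Z, hZ⟩ : ∃ Z : Spaces M, IsZero Z := by
    have : HasZeroObject (Spaces M) := inferInstance
    exact this.zero
  induction n with
  | zero =>
    exact ⟨{Z}, Set.finite_singleton _, fun Y hY => ⟨Z, rfl,
      ⟨(isZero_of_spaceSize_eq_zero M (by omega)).iso hZ⟩⟩⟩
  | succ n ih =>
    obtain ⟨T, hT, hTY⟩ := ih
    refine ⟨{Z} ∪ S ∪ Set.image2 (fun A B => A ⊞ B) T T,
      ((Set.finite_singleton _).union hSf).union (hT.image2 _ hT), fun Y hY => ?_⟩
    by_cases h0 : IsZero Y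
    · exact ⟨Z, Or.inl (Or.inl rfl), ⟨h0.iso hZ⟩⟩
    by_cases hi : Indecomposable Y
    · obtain ⟨W, hW, hYW⟩ := hS.exists_iso Y hi
      exact ⟨W, Or.inl (Or.inr hW), hYW⟩
    simp only [Indecomposable, not_and, not_forall, not_or] at hi
    obtain ⟨A, B, e, hA, hB⟩ := hi h0
    have hs := (spaceSize_eq_of_iso M e).trans (spaceSize_biprod M A B)
    -- Faithfulness makes the size of a nonzero space positive, so both summands are strictly
    -- smaller than `Y`.
    have hA' : spaceSize M A ≠ 0 := fun h => hA (isZero_of_spaceSize_eq_zero M h)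
    have hB' : spaceSize M B ≠ 0 := fun h => hB (isZero_of_spaceSize_eq_zero M h)
    obtain ⟨A', hA'T, ⟨eA⟩⟩ := hTY A (by omega)
    obtain ⟨B', hB'T, ⟨eB⟩⟩ := hTY B (by omega)
    exact ⟨A' ⊞ B', Or.inr ⟨A', hA'T, B', hB'T, rfl⟩, ⟨e ≪≫ biprod.mapIso eA eB⟩⟩

/-- The spaces with underlying `k^I` and `X` all have the same total dimension, so they form
finitely many isomorphism classes. The data `ξ`, `φ` and `ξ'`, `ψ` are the components of an
isomorphism and of its inverse. -/
theorem exists_finite_orbits [HasFiniteBiproducts C] [M.Faithful] (hM : FinitelySpaced M)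
    (X : C) (I : Type) [Fintype I] :
    ∃ (n : ℕ) (cls : ((I → k) →ₗ[k] M.obj X) → Fin n),
      ∀ h h', cls h = cls h' → ∃ (ξ ξ' : X ⟶ X) (φ ψ : (I → k) →ₗ[k] (I → k)),
        φ ∘ₗ ψ = LinearMap.id ∧ ψ ∘ₗ φ = LinearMap.id ∧ h ∘ₗ φ = act M ξ ∘ₗ h' ∧
        h' ∘ₗ ψ = act M ξ' ∘ₗ h := by
  let sp : ((I → k) →ₗ[k] M.obj X) → Spaces M := fun h =>
    { left := FGModuleCat.of k (I → k), right := X, hom := FGModuleCat.ofHom h }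
  obtain ⟨T, hT, hTY⟩ := exists_finite_of_spaceSize_le M hM
    (Module.finrank k (I → k) + Module.finrank k (M.obj X))
  have h1 : ∀ h, ∃ Z : T, Nonempty (sp h ≅ Z) := fun h => by
    obtain ⟨Z, hZ, e⟩ := hTY (sp h) le_rfl
    exact ⟨⟨Z, hZ⟩, e⟩
  choose cls hcls using h1
  have := hT.to_subtype
  obtain ⟨n, ⟨ι⟩⟩ := Finite.exists_equiv_fin T
  refine ⟨n, fun h => ι (cls h), fun h h' hh => ?_⟩
  obtain ⟨e⟩ := hcls h
  obtain ⟨e'⟩ := hcls h'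
  rw [← ι.injective hh] at e'
  let g : sp h' ≅ sp h := e' ≪≫ e.symm
  refine ⟨g.hom.right, g.inv.right, g.hom.left.hom.hom, g.inv.left.hom.hom, ?_, ?_, ?_, ?_⟩
  · have := congrArg CommaMorphism.left g.inv_hom_id
    exact congrArg (fun f => f.hom.hom) this
  · have := congrArg CommaMorphism.left g.hom_inv_id
    exact congrArg (fun f => f.hom.hom) this
  · exact congrArg (fun f => f.hom.hom) g.hom.w
  · exact congrArg (fun f => f.hom.hom) g.inv.w

/-- The assignment of the space `(0, a, 0)` to `a` preserves indecomposability and reflects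
isomorphism, so `J` embeds into a finite spectroid of `M^k`. -/
theorem finite_of_isSpectroid [HasFiniteBiproducts C] [M.Faithful] (hM : FinitelySpaced M)
    {J : Set C} (hJ : IsSpectroid J) : J.Finite := by
  obtain ⟨S, hS, hSf⟩ := hM
  let sp : C → Spaces M := fun a => { left := FGModuleCat.of k PUnit, right := a, hom := 0 }
  have hl : ∀ a, IsZero (sp a).left := fun a => by
    rw [IsZero.iff_id_eq_zero]
    ext x
  have hind : ∀ a ∈ J, Indecomposable (sp a) := by
    intro a ha
    obtain ⟨h0, h1⟩ := hJ.indecomposable a ha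
    refine ⟨fun h => h0 ?_, fun Y Z e => ?_⟩
    · exact (Comma.snd (𝟭 (FGModuleCat.{u} k)) M).map_isZero h
    · have := preservesBinaryBiproducts_of_preservesBiproducts (Comma.snd (𝟭 (FGModuleCat.{u} k)) M)
      have := preservesBinaryBiproducts_of_preservesBiproducts (Comma.fst (𝟭 (FGModuleCat.{u} k)) M)
      have e2 : a ≅ Y.right ⊞ Z.right :=
        (Comma.snd (𝟭 (FGModuleCat.{u} k)) M).mapIso e ≪≫
          (Comma.snd (𝟭 (FGModuleCat.{u} k)) M).mapBiprod Y Z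
      have e1 : (sp a).left ≅ Y.left ⊞ Z.left :=
        (Comma.fst (𝟭 (FGModuleCat.{u} k)) M).mapIso e ≪≫
          (Comma.fst (𝟭 (FGModuleCat.{u} k)) M).mapBiprod Y Z
      have h2 := (biprod_isZero_iff _ _).1 ((hl a).of_iso e1.symm)
      have key : ∀ W : Spaces M, IsZero W.left → IsZero W.right → IsZero W := by
        intro W hW hW'
        rw [IsZero.iff_id_eq_zero]
        ext : 1
        · exact hW.eq_of_src _ _
        · exact hW'.eq_of_src _ _
      exact (h1 _ _ e2).imp (key _ h2.1) (key _ h2.2)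
  choose! f hf hf' using fun a (ha : a ∈ J) => hS.exists_iso (sp a) (hind a ha)
  refine Set.Finite.of_finite_image (f := f) (hSf.subset (Set.image_subset_iff.2 hf)) ?_
  intro a ha b hb hab
  obtain ⟨e⟩ := hf' a ha
  obtain ⟨e'⟩ := hf' b hb
  rw [← hab] at e'
  exact hJ.eq_of_iso a ha b hb
    ⟨(Comma.snd (𝟭 (FGModuleCat.{u} k)) M).mapIso (e ≪≫ e'.symm)⟩

end FiniteOrbits

end Aggregate

/-! ### The Tits form inequality for matrix problems. -/

namespace Aggregate

section Tits

variable {k : Type u} [Field k] {J : Type w} {d : J → ℕ}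

/-- The matrices of the endomorphisms of the direct sum of the objects `o s`, where `R a b`
holds the matrices of the radical morphisms from `a` to `b`. -/
def IsHomMatrix (R : ∀ a b : J, Submodule k (Matrix (Fin (d b)) (Fin (d a)) k)) {I : Type}
    (o : I → J) (Ξ : Matrix (Σ s, Fin (d (o s))) (Σ s, Fin (d (o s))) k) : Prop :=
  ∀ s s', ∃ F ∈ R (o s) (o s'), ∃ c : k, ∀ p i, Ξ ⟨s', p⟩ ⟨s, i⟩ = F p i +
    open Classical in if o s = o s' ∧ (p : ℕ) = i then c else 0

/-- Finiteness of the number of orbits in each matrix problem defined by `R`. -/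
def HasFiniteOrbits (R : ∀ a b : J, Submodule k (Matrix (Fin (d b)) (Fin (d a)) k)) : Prop :=
  ∀ (I : Type) [Fintype I] (o : I → J) (C : Type) [Fintype C] [DecidableEq C],
    ∃ (n : ℕ) (cls : Matrix (Σ s, Fin (d (o s))) C k → Fin n),
      ∀ H H', cls H = cls H' → ∃ Ξ Ξ', IsHomMatrix R o Ξ ∧ IsHomMatrix R o Ξ' ∧
        ∃ φ ψ : Matrix C C k, φ * ψ = 1 ∧ ψ * φ = 1 ∧ H * φ = Ξ * H' ∧ H' * ψ = Ξ' * H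

variable {R : ∀ a b : J, Submodule k (Matrix (Fin (d b)) (Fin (d a)) k)}

theorem HasFiniteOrbits.not_card_le [Infinite k] (hR : HasFiniteOrbits R)
    {I C D : Type} [Fintype I] [DecidableEq I] [Fintype C] [DecidableEq C] [Nonempty C]
    [Fintype D] (o : I → J)
    (lev : (Σ s, Fin (d (o s))) → ℕ) (κ : C → ℕ) (ε : D → (Σ s, Fin (d (o s))) →
      (Σ s, Fin (d (o s))) → k)
    (hG : ∀ Ξ, IsHomMatrix R o Ξ → ∀ ρ σ, lev ρ ∈ Set.range κ → Ξ ρ σ ≠ 0 → lev σ ≤ lev ρ)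
    (hε : ∀ Ξ, IsHomMatrix R o Ξ → ∃ ξ : D → k, ∀ ρ σ, lev ρ ∈ Set.range κ → lev σ = lev ρ →
      Ξ ρ σ = ∑ δ, ξ δ * ε δ ρ σ)
    (σ : C → (Σ s, Fin (d (o s)))) (hσ : ∀ c, lev (σ c) = κ c) (hσi : Function.Injective σ)
    (hcard : Fintype.card D + Fintype.card {p : C × C // κ p.1 = κ p.2} ≤
      Fintype.card {p : C × (Σ s, Fin (d (o s))) // lev p.2 = κ p.1}) : False := by
  obtain ⟨n, cls, hcls⟩ := hR I o C
  refine not_card_le_of_finite_orbits lev κ ε {Ξ | IsHomMatrix R o Ξ} hG hε cls ?_ σ hσ hσi hcard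
  intro H H' h
  obtain ⟨Ξ, Ξ', h1, h2, φ, ψ, h3⟩ := hcls H H' h
  exact ⟨Ξ, h1, Ξ', h2, φ, ψ, h3⟩

/-- The inequality satisfied by the Tits form of a finitely spaced module: `o t` occurs `x t` times,
and there are `v ℓ` columns at level `ℓ`. The rows at level `ℓ` are given by the `pos q`-th basis
vectors of `o (obj q)`, where `g q = ℓ`. -/
theorem HasFiniteOrbits.tits [Infinite k] (hR : HasFiniteOrbits R) {m n r : ℕ}
    (o : Fin m → J) (ho : Function.Injective o)
    (lt : Fin m × ℕ → Fin m × ℕ → Prop) (htrans : ∀ s t u, lt s t → lt t u → lt s u)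
    (hlt : ∀ t t', ∀ F ∈ R (o t) (o t'), ∀ p i, F p i ≠ 0 → lt (t, i) (t', p))
    (obj : Fin n → Fin m) (pos : Fin n → ℕ) (hpos : ∀ q, pos q < d (o (obj q)))
    (g : Fin n → Fin r) (hinj : ∀ q q', obj q = obj q' → pos q = pos q' → q = q')
    (hord : ∀ q q', g q ≤ g q' → ¬ lt (obj q', pos q') (obj q, pos q))
    (x : Fin m → ℕ) (v : Fin r → ℕ) (hv : ∀ ℓ, v ℓ ≤ ∑ q with g q = ℓ, x (obj q))
    (hq : ∑ ℓ, v ℓ ^ 2 + ∑ t, x t ^ 2 ≤ ∑ q, v (g q) * x (obj q)) (hv0 : ∃ ℓ, v ℓ ≠ 0) :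
    False := by
  classical
  let o' : (Σ t, Fin (x t)) → J := fun s => o s.1
  let cell : (Σ s, Fin (d (o' s))) → Fin m × ℕ := fun ρ => (ρ.1.1, ρ.2)
  let mem : Fin n → Fin m × ℕ := fun q => (obj q, pos q)
  have hmem : Function.Injective mem := fun q q' h => hinj q q' (Prod.ext_iff.1 h).1
    (Prod.ext_iff.1 h).2
  -- `A s` is one more than the highest group with a selected vector at or below `s`, and 0 if there
  -- is none. Selected cells receive the even level `2 * A s`; the others receive the odd level `2 *
  -- A s + 1`, which no column has, so they drop out of the count.
  let A : Fin m × ℕ → ℕ := fun s =>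
    Finset.univ.sup fun q => if mem q = s ∨ lt (mem q) s then (g q : ℕ) + 1 else 0
  have hAle : ∀ s q, mem q = s ∨ lt (mem q) s → (g q : ℕ) + 1 ≤ A s := by
    intro s q h
    have := Finset.le_sup (f := fun q => if mem q = s ∨ lt (mem q) s then (g q : ℕ) + 1 else 0)
      (Finset.mem_univ q)
    simpa only [if_pos h] using this
  have hAex : ∀ s, A s = 0 ∨ ∃ q, (mem q = s ∨ lt (mem q) s) ∧ A s = g q + 1 := by
    intro s
    by_cases h0 : A s = 0
    · exact Or.inl h0
    right
    have hne : (Finset.univ : Finset (Fin n)).Nonempty := by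
      by_contra h
      rw [Finset.not_nonempty_iff_eq_empty] at h
      apply h0
      simp only [A, h, Finset.sup_empty]
      rfl
    obtain ⟨q, -, hq'⟩ := Finset.exists_mem_eq_sup Finset.univ hne
      (fun q => if mem q = s ∨ lt (mem q) s then (g q : ℕ) + 1 else 0)
    change A s = _ at hq'
    by_cases h : mem q = s ∨ lt (mem q) s
    · exact ⟨q, h, by rw [hq', if_pos h]⟩
    · rw [if_neg h] at hq'
      exact absurd hq' h0
  have hAmem : ∀ q, A (mem q) = g q + 1 := by
    intro q
    refine le_antisymm ?_ (hAle _ q (Or.inl rfl))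
    rcases hAex (mem q) with h | ⟨q', h, h'⟩
    · omega
    · rw [h']
      rcases h with h | h
      · rw [hmem h]
      · by_contra hc
        exact hord q q' (by rw [Fin.le_def]; omega) h
  let lev0 : Fin m × ℕ → ℕ := fun s => if s ∈ Set.range mem then 2 * A s else 2 * A s + 1
  have hlev0 : ∀ s ℓ, lev0 s = 2 * ((ℓ : Fin r) + 1) ↔ ∃ q, g q = ℓ ∧ mem q = s := by
    intro s ℓ
    by_cases h : s ∈ Set.range mem
    · obtain ⟨q, rfl⟩ := h
      simp only [lev0, Set.mem_range_self, if_true, hAmem]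
      constructor
      · intro h
        exact ⟨q, Fin.ext (by omega), rfl⟩
      · rintro ⟨q', h, h'⟩
        rw [← hmem h', h]
    · simp only [lev0, if_neg h]
      constructor
      · intro h
        omega
      · rintro ⟨q', -, h'⟩
        exact absurd ⟨q', h'⟩ h
  have hAmono : ∀ s t, lt s t → A s ≤ A t := by
    intro s t hst
    rcases hAex s with h | ⟨q, h, h'⟩
    · omega
    · rw [h']
      refine hAle t q (Or.inr ?_)
      rcases h with h | h
      · rwa [h]
      · exact htrans _ _ _ h hst
  have hmono : ∀ s t, lt s t → lev0 s ≤ lev0 t := by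
    intro s t hst
    have h1 := hAmono s t hst
    by_cases hs : s ∈ Set.range mem
    · simp only [lev0, if_pos hs]
      split_ifs <;> omega
    · by_cases ht : t ∈ Set.range mem
      · simp only [lev0, if_neg hs, if_pos ht]
        rcases hAex s with h | ⟨q, h, h'⟩
        · obtain ⟨q, rfl⟩ := ht
          have := hAmem q
          omega
        · obtain ⟨q', rfl⟩ := ht
          have h2 : lt (mem q) s := h.resolve_left fun h => hs ⟨q, h⟩
          have h3 : ¬ g q' ≤ g q := fun hle => hord q' q hle (htrans _ _ _ h2 hst)
          have := hAmem q'
          rw [Fin.le_def] at h3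
          omega
      · simp only [lev0, if_neg hs, if_neg ht]
        omega
  have hstrict : ∀ s t, lt s t → t ∈ Set.range mem → lev0 s ≠ lev0 t := by
    rintro s t hst ⟨q, rfl⟩ h
    have h2 := (hlev0 (mem q) (g q)).2 ⟨q, rfl, rfl⟩
    rw [← h, hlev0] at h2
    obtain ⟨q', h3, rfl⟩ := h2
    exact hord q q' h3.ge hst
  let lev : (Σ s, Fin (d (o' s))) → ℕ := fun ρ => lev0 (cell ρ)
  let κ : (Σ ℓ, Fin (v ℓ)) → ℕ := fun c => 2 * ((c.1 : ℕ) + 1)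
  have hκ : ∀ c c', κ c = κ c' ↔ c.1 = c'.1 := by
    intro c c'
    simp only [κ, Fin.ext_iff]
    omega
  have hlevκ : ∀ ρ c, lev ρ = κ c ↔ ∃ q, g q = c.1 ∧ mem q = cell ρ := fun ρ c => hlev0 _ _
  have hcell : ∀ ρ, lev ρ ∈ Set.range κ → cell ρ ∈ Set.range mem := by
    rintro ρ ⟨c, hc⟩
    obtain ⟨q, -, h⟩ := (hlevκ ρ c).1 hc.symm
    exact ⟨q, h⟩
  -- rows at a given level
  let row : ∀ ℓ : Fin r, (Σ q : {q // g q = ℓ}, Fin (x (obj q))) →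
      {ρ : Σ s, Fin (d (o' s)) // lev ρ = 2 * ((ℓ : ℕ) + 1)} := fun ℓ z =>
    ⟨⟨⟨obj z.1, z.2⟩, ⟨pos z.1, hpos z.1⟩⟩, (hlev0 _ ℓ).2 ⟨z.1, z.1.2, rfl⟩⟩
  have hrow : ∀ ℓ, Function.Bijective (row ℓ) := by
    intro ℓ
    constructor
    · rintro ⟨⟨q, h⟩, y⟩ ⟨⟨q', h'⟩, y'⟩ he
      have he' := congrArg (fun ρ => cell ρ.1) he
      have hqq : q = q' := hmem he'
      subst hqq
      have := congrArg (fun ρ => ρ.1.1) he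
      simp only [row, Sigma.mk.injEq, heq_eq_eq, true_and] at this
      rw [this]
    · rintro ⟨⟨⟨t, y⟩, i⟩, hρ⟩
      obtain ⟨q, hq1, hq2⟩ := (hlev0 _ ℓ).1 hρ
      simp only [mem, cell, Prod.mk.injEq] at hq2
      obtain ⟨h1, h2⟩ := hq2
      subst h1
      refine ⟨⟨⟨q, hq1⟩, y⟩, ?_⟩
      simp only [row, Subtype.mk.injEq, Sigma.mk.injEq, heq_eq_eq, true_and]
      exact Fin.ext h2
  have hrowcard : ∀ ℓ : Fin r, Fintype.card {ρ : Σ s, Fin (d (o' s)) // lev ρ = 2 * ((ℓ : ℕ) + 1)} =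
      ∑ q with g q = ℓ, x (obj q) := by
    intro ℓ
    rw [← Fintype.card_of_bijective (hrow ℓ), Fintype.card_sigma]
    simp only [Fintype.card_fin]
    rw [Finset.sum_subtype (p := fun q => g q = ℓ)]
    intro q; simp
  have hemb : ∀ ℓ : Fin r, Nonempty (Fin (v ℓ) ↪
      {ρ : Σ s, Fin (d (o' s)) // lev ρ = 2 * ((ℓ : ℕ) + 1)}) := by
    intro ℓ
    apply Function.Embedding.nonempty_of_card_le
    rw [hrowcard, Fintype.card_fin]
    exact hv ℓ
  let emb := fun ℓ => (hemb ℓ).some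
  obtain ⟨ℓ0, hℓ0⟩ := hv0
  have : Nonempty (Σ ℓ, Fin (v ℓ)) := ⟨⟨ℓ0, ⟨0, Nat.pos_of_ne_zero hℓ0⟩⟩⟩
  -- In a selected row a radical entry strictly changes the level, so the degree zero part of an
  -- endomorphism consists of the scalars between copies of one object. There are `∑ x t ^ 2` of
  -- them.
  refine hR.not_card_le (C := Σ ℓ, Fin (v ℓ))
    (D := {p : (Σ t, Fin (x t)) × (Σ t, Fin (x t)) // p.1.1 = p.2.1}) o' lev κ
    (fun δ ρ σ => if σ.1 = δ.1.1 ∧ ρ.1 = δ.1.2 ∧ (ρ.2 : ℕ) = σ.2 then 1 else 0)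
    ?_ ?_ (fun c => (emb c.1 c.2).1) (fun c => (emb c.1 c.2).2) ?_ ?_
  · rintro Ξ hΞ ⟨s', p⟩ ⟨s, i⟩ hlev hne
    obtain ⟨F, hF, c, h⟩ := hΞ s s'
    rw [h] at hne
    by_cases hFp : F p i = 0
    · rw [hFp, zero_add] at hne
      split_ifs at hne with h1
      · have : s.1 = s'.1 := ho h1.1
        have hc : cell ⟨s', p⟩ = cell ⟨s, i⟩ := by
          simp only [cell, this, h1.2]
        simp only [lev, hc, le_refl]
      · exact absurd rfl hne
    · exact hmono _ _ (hlt _ _ F hF p i hFp)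
  · intro Ξ hΞ
    choose F hF c h using hΞ
    refine ⟨fun δ => c δ.1.1 δ.1.2, ?_⟩
    rintro ⟨s', p⟩ ⟨s, i⟩ hlev heq
    rw [h]
    have h0 : F s s' p i = 0 := by
      by_contra hne
      exact hstrict _ _ (hlt _ _ _ (hF s s') p i hne) (hcell _ hlev) heq
    rw [h0, zero_add]
    by_cases hs : s.1 = s'.1
    · rw [Finset.sum_eq_single ⟨(s, s'), hs⟩]
      · simp only [o', hs, true_and, mul_ite, mul_one, mul_zero]
      · rintro ⟨⟨t, t'⟩, ht⟩ - hne
        simp only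
        rw [if_neg, mul_zero]
        rintro ⟨rfl, rfl, -⟩
        exact hne rfl
      · intro h
        exact absurd (Finset.mem_univ _) h
    · rw [if_neg (fun h => hs (ho h.1)), eq_comm]
      apply Finset.sum_eq_zero
      rintro ⟨⟨t, t'⟩, ht⟩ -
      simp only
      rw [if_neg, mul_zero]
      rintro ⟨rfl, rfl, -⟩
      exact hs ht
  · rintro ⟨ℓ, y⟩ ⟨ℓ', y'⟩ h
    have h1 := (emb ℓ y).2
    have h2 := (emb ℓ' y').2
    simp only at h
    rw [h, h2] at h1
    have : ℓ' = ℓ := Fin.ext (by omega)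
    subst this
    rw [(emb ℓ').injective (Subtype.ext h)]
  · have e1 : Fintype.card {p : (Σ t, Fin (x t)) × (Σ t, Fin (x t)) // p.1.1 = p.2.1} =
        ∑ t, x t ^ 2 := by
      have : {p : (Σ t, Fin (x t)) × (Σ t, Fin (x t)) // p.1.1 = p.2.1} ≃
          Σ t, Fin (x t) × Fin (x t) :=
        { toFun := fun p => ⟨p.1.1.1, p.1.1.2, p.2 ▸ p.1.2.2⟩
          invFun := fun z => ⟨(⟨z.1, z.2.1⟩, ⟨z.1, z.2.2⟩), rfl⟩
          left_inv := by
            rintro ⟨⟨⟨t, y⟩, ⟨t', y'⟩⟩, h⟩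
            simp only at h
            subst h
            rfl
          right_inv := by rintro ⟨t, y, y'⟩; rfl }
      rw [Fintype.card_congr this, Fintype.card_sigma]
      simp [sq]
    have e2 : Fintype.card {p : (Σ ℓ, Fin (v ℓ)) × (Σ ℓ, Fin (v ℓ)) // κ p.1 = κ p.2} =
        ∑ ℓ, v ℓ ^ 2 := by
      have : {p : (Σ ℓ, Fin (v ℓ)) × (Σ ℓ, Fin (v ℓ)) // κ p.1 = κ p.2} ≃
          Σ t, Fin (v t) × Fin (v t) :=
        { toFun := fun p => ⟨p.1.1.1, p.1.1.2, ((hκ _ _).1 p.2) ▸ p.1.2.2⟩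
          invFun := fun z => ⟨(⟨z.1, z.2.1⟩, ⟨z.1, z.2.2⟩), rfl⟩
          left_inv := by
            rintro ⟨⟨⟨t, y⟩, ⟨t', y'⟩⟩, h⟩
            have h' := (hκ _ _).1 h
            simp only at h'
            subst h'
            rfl
          right_inv := by rintro ⟨t, y, y'⟩; rfl }
      rw [Fintype.card_congr this, Fintype.card_sigma]
      simp [sq]
    have e3 : Fintype.card {p : (Σ ℓ, Fin (v ℓ)) × (Σ s, Fin (d (o' s))) // lev p.2 = κ p.1} =
        ∑ q, v (g q) * x (obj q) := by
      have : {p : (Σ ℓ, Fin (v ℓ)) × (Σ s, Fin (d (o' s))) // lev p.2 = κ p.1} ≃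
          Σ ℓ, Fin (v ℓ) × {ρ : Σ s, Fin (d (o' s)) // lev ρ = 2 * ((ℓ : ℕ) + 1)} :=
        { toFun := fun p => ⟨p.1.1.1, p.1.1.2, ⟨p.1.2, p.2⟩⟩
          invFun := fun z => ⟨(⟨z.1, z.2.1⟩, z.2.2.1), z.2.2.2⟩
          left_inv := fun _ => rfl
          right_inv := fun _ => rfl }
      rw [Fintype.card_congr this, Fintype.card_sigma]
      simp only [Fintype.card_prod, Fintype.card_fin, hrowcard, Finset.mul_sum]
      rw [← Finset.sum_fiberwise Finset.univ g]
      refine Finset.sum_congr rfl fun ℓ _ => Finset.sum_congr rfl fun q hq => ?_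
      rw [(Finset.mem_filter.1 hq).2]
    rw [e1, e2, e3]
    omega

/-- Between two objects acting on three-dimensional spaces, the diagonals of lower triangular
radical morphisms cannot all be proportional. -/
theorem HasFiniteOrbits.not_diagonal_line [Infinite k] (hR : HasFiniteOrbits R) {a b : J}
    (hab : a ≠ b) (ha : d a = 3) (hb : d b = 3)
    (haa : ∀ F ∈ R a a, ∀ p i, F p i ≠ 0 → (i : ℕ) < p)
    (hbb : ∀ F ∈ R b b, ∀ p i, F p i ≠ 0 → (i : ℕ) < p)
    (hba : ∀ F ∈ R b a, ∀ p i, F p i ≠ 0 → (i : ℕ) < p)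
    (hlow : ∀ F ∈ R a b, ∀ p i, F p i ≠ 0 → (i : ℕ) ≤ p) (y : ℕ → k)
    (hline : ∀ F ∈ R a b, ∃ c, ∀ (p : Fin _) (i : Fin _), (i : ℕ) = p → F p i = c * y i) : False := by
  classical
  let o : Fin 2 → J := ![a, b]
  have ho : ∀ s s', o s = o s' → s = s' := by
    intro s s'
    fin_cases s <;> fin_cases s' <;> simp [o, hab, hab.symm]
  have hd : ∀ s, d (o s) = 3 := by
    intro s
    fin_cases s <;> simp [o, ha, hb]
  have hle : ∀ s s', ∀ F ∈ R (o s) (o s'), ∀ p i, F p i ≠ 0 → (i : ℕ) ≤ p := by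
    intro s s'
    fin_cases s <;> fin_cases s'
    · exact fun F hF p i h => (haa F hF p i h).le
    · exact hlow
    · exact fun F hF p i h => (hba F hF p i h).le
    · exact fun F hF p i h => (hbb F hF p i h).le
  have hdiag : ∀ s s', ∀ F ∈ R (o s) (o s'), ∃ c : k, ∀ (p : Fin _) (i : Fin _), (i : ℕ) = p →
      F p i = if s = 0 ∧ s' = 1 then c * y i else 0 := by
    intro s s' F hF
    fin_cases s <;> fin_cases s'
    · exact ⟨0, fun p i h => by by_contra hne; exact absurd (haa F hF p i hne) (by omega)⟩
    · obtain ⟨c, hc⟩ := hline F hF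
      exact ⟨c, fun p i h => by simpa using hc p i h⟩
    · exact ⟨0, fun p i h => by by_contra hne; exact absurd (hba F hF p i hne) (by omega)⟩
    · exact ⟨0, fun p i h => by by_contra hne; exact absurd (hbb F hF p i hne) (by omega)⟩
  -- One copy of each object and one column at each of three levels. The degree zero parameters are
  -- the two scalars and the factor of the common diagonal `y`, so the count reads `3 + 3 ≤ 6`.
  refine hR.not_card_le (C := Fin 3) (D := Fin 3) o (fun ρ => ρ.2) (fun c => c)
    (fun δ ρ σ => if δ = 2 then (if σ.1 = 0 ∧ ρ.1 = 1 then y σ.2 else 0) else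
      if σ.1 = ρ.1 ∧ (σ.1 : ℕ) = δ then 1 else 0)
    ?_ ?_ (fun c => ⟨0, Fin.cast (hd 0).symm c⟩) (fun c => rfl) ?_ ?_
  · rintro Ξ hΞ ⟨s', p⟩ ⟨s, i⟩ - hne
    obtain ⟨F, hF, c, h⟩ := hΞ s s'
    rw [h] at hne
    by_cases hFp : F p i = 0
    · rw [hFp, zero_add] at hne
      split_ifs at hne with h1
      · exact h1.2.ge
      · exact absurd rfl hne
    · exact hle s s' F hF p i hFp
  · intro Ξ hΞ
    choose F hF c h using hΞ
    choose e he using fun s s' => hdiag s s' (F s s') (hF s s')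
    refine ⟨![c 0 0, c 1 1, e 0 1], ?_⟩
    rintro ⟨s', p⟩ ⟨s, i⟩ - heq
    simp only at heq
    rw [h, he _ _ _ _ heq]
    have h01 : o 0 ≠ o 1 := fun h => absurd (ho _ _ h) (by decide)
    have h10 : o 1 ≠ o 0 := fun h => absurd (ho _ _ h) (by decide)
    fin_cases s <;> fin_cases s' <;> simp [Fin.sum_univ_three, heq, h01, h10]
  · intro c c' h
    simp only [Sigma.mk.injEq, heq_eq_eq, true_and] at h
    exact Fin.ext (by simpa [Fin.ext_iff] using h)
  · have e1 : Fintype.card {p : Fin 3 × Fin 3 // (p.1 : ℕ) = p.2} = 3 := by decide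
    have e2 : Fintype.card {p : Fin 3 × (Σ s, Fin (d (o s))) // (p.2.2 : ℕ) = p.1} = 6 := by
      have : {p : Fin 3 × (Σ s, Fin (d (o s))) // (p.2.2 : ℕ) = p.1} ≃ Fin 2 × Fin 3 :=
        { toFun := fun p => (p.1.2.1, p.1.1)
          invFun := fun z => ⟨(z.2, ⟨z.1, Fin.cast (hd z.1).symm z.2⟩), rfl⟩
          left_inv := by
            rintro ⟨⟨c, ⟨s, i⟩⟩, h⟩
            simp only at h
            simp only [Subtype.mk.injEq, Prod.mk.injEq, Sigma.mk.injEq, heq_eq_eq, true_and]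
            exact Fin.ext h.symm
          right_inv := fun _ => rfl }
      rw [Fintype.card_congr this]
      rfl
    simp only [e1, e2, Fintype.card_fin]
    norm_num

end Tits

end Aggregate

/-! ### Triangular bases and local endomorphism rings. -/

namespace Aggregate

section Flag

variable {k : Type u} [Field k] {V : Type v} [AddCommGroup V] [Module k V] [Module.Finite k V]

/-- A nonzero functional vanishing on the image of each element of a multiplicative space of
endomorphisms without nonzero fixed vectors. -/
theorem exists_dual_comp_eq_zero [Nontrivial V] (R : Submodule k (V →ₗ[k] V))
    (hmul : ∀ f ∈ R, ∀ g ∈ R, f ∘ₗ g ∈ R) (hfix : ∀ f ∈ R, ∀ v, f v = v → v = 0) :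
    ∃ φ : V →ₗ[k] k, φ ≠ 0 ∧ ∀ f ∈ R, φ ∘ₗ f = 0 := by
  classical
  let P : (V →ₗ[k] k) → Submodule k (V →ₗ[k] k) := fun φ => R.map (LinearMap.llcomp k V V k φ)
  have hP : ∀ φ ψ, ψ ∈ P φ ↔ ∃ f ∈ R, φ ∘ₗ f = ψ := fun φ ψ => by
    simp only [P, Submodule.mem_map]
    rfl
  obtain ⟨x, hx⟩ := exists_ne (0 : V)
  obtain ⟨φ₀, hφ₀⟩ : ∃ φ : V →ₗ[k] k, φ ≠ 0 := by
    by_contra! h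
    exact hx ((Module.forall_dual_apply_eq_zero_iff k x).1 fun f => by rw [h f]; rfl)
  -- Choose `φ` with `φR` of minimal dimension. If `φf ≠ 0`, then `φfR ⊆ φR` is an equality, so `φf
  -- = φfg` for some `g` in `R`; thus `φf` vanishes on the image of the bijection `1 - g`.
  have hex : ∃ n, ∃ φ : V →ₗ[k] k, φ ≠ 0 ∧ Module.finrank k (P φ) = n := ⟨_, φ₀, hφ₀, rfl⟩
  obtain ⟨φ, hφ, hn⟩ := Nat.find_spec hex
  refine ⟨φ, hφ, fun f hf => ?_⟩
  by_contra hne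
  have hle : P (φ ∘ₗ f) ≤ P φ := by
    intro ψ hψ
    obtain ⟨g, hg, rfl⟩ := (hP _ _).1 hψ
    exact (hP _ _).2 ⟨f ∘ₗ g, hmul f hf g hg, rfl⟩
  have h1 : Nat.find hex ≤ Module.finrank k (P (φ ∘ₗ f)) := Nat.find_min' hex ⟨_, hne, rfl⟩
  rw [← hn] at h1
  have heq := Submodule.eq_of_le_of_finrank_le hle h1
  have hmem : φ ∘ₗ f ∈ P (φ ∘ₗ f) := by
    rw [heq]
    exact (hP _ _).2 ⟨f, hf, rfl⟩
  obtain ⟨g, hg, hgf⟩ := (hP _ _).1 hmem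
  have hinj : Function.Injective (LinearMap.id - g : V →ₗ[k] V) := by
    rw [← LinearMap.ker_eq_bot, LinearMap.ker_eq_bot']
    intro v hv
    exact hfix g hg v (sub_eq_zero.1 hv).symm
  have hsurj := LinearMap.injective_iff_surjective.1 hinj
  apply hne
  ext y
  obtain ⟨z, rfl⟩ := hsurj y
  have := LinearMap.congr_fun hgf z
  simp only [LinearMap.comp_apply] at this
  simp [this]

/-- A functional annihilated by `R` has a kernel containing the image of every member of `R`. A flag
basis of this kernel, preceded by one vector outside it, is a flag basis of the whole space. -/
theorem exists_flag_basis (n : ℕ) : ∀ {V : Type v} [AddCommGroup V] [Module k V]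
    [Module.Finite k V], Module.finrank k V = n → ∀ (R : Submodule k (V →ₗ[k] V)),
    (∀ f ∈ R, ∀ g ∈ R, f ∘ₗ g ∈ R) → (∀ f ∈ R, ∀ v, f v = v → v = 0) →
    ∃ b : Module.Basis (Fin n) k V, ∀ f ∈ R, ∀ p i, b.repr (f (b i)) p ≠ 0 → i < p := by
  induction n with
  | zero =>
    intro V _ _ _ hV R _ _
    exact ⟨Module.finBasisOfFinrankEq k V hV, fun f _ p => p.elim0⟩
  | succ n ih =>
    intro V _ _ _ hV R hmul hfix
    have : Nontrivial V := Module.nontrivial_of_finrank_pos (R := k) (by omega)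
    obtain ⟨φ, hφ, hφR⟩ := exists_dual_comp_eq_zero R hmul hfix
    let W := LinearMap.ker φ
    have hW : Module.finrank k W = n := by
      have h1 := LinearMap.finrank_range_add_finrank_ker φ
      have h2 : LinearMap.range φ = ⊤ := LinearMap.range_eq_top.2 (LinearMap.surjective hφ)
      rw [h2, finrank_top, Module.finrank_self] at h1
      simp only [W]
      omega
    have hRW : ∀ f ∈ R, ∀ v, f v ∈ W := fun f hf v => LinearMap.congr_fun (hφR f hf) v
    let R' : Submodule k (W →ₗ[k] W) :=
      { carrier := {g | ∃ f ∈ R, ∀ w, (g w : V) = f w}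
        zero_mem' := ⟨0, R.zero_mem, fun w => rfl⟩
        add_mem' := by
          rintro g g' ⟨f, hf, h⟩ ⟨f', hf', h'⟩
          exact ⟨f + f', R.add_mem hf hf', fun w => by simp [h, h']⟩
        smul_mem' := by
          rintro c g ⟨f, hf, h⟩
          exact ⟨c • f, R.smul_mem c hf, fun w => by simp [h]⟩ }
    obtain ⟨b, hb⟩ := ih hW R'
      (by
        rintro g ⟨f, hf, h⟩ g' ⟨f', hf', h'⟩
        exact ⟨f ∘ₗ f', hmul f hf f' hf', fun w => by simp [h, h']⟩)
      (by
        rintro g ⟨f, hf, h⟩ w hw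
        exact Subtype.ext (hfix f hf w (by rw [← h, hw])))
    obtain ⟨y, hy⟩ := LinearMap.surjective hφ 1
    let B : Module.Basis (Fin (n + 1)) k V := Module.Basis.mkFinCons y b
      (by
        intro c x hx h
        have := congrArg φ h
        simpa [hy, LinearMap.mem_ker.1 hx] using this)
      (fun z => ⟨-φ z, by simp [W, LinearMap.mem_ker, hy]⟩)
    have hB0 : B 0 = y := by simp [B]
    have hBs : ∀ i : Fin n, B i.succ = b i := fun i => by simp [B]
    have hrepr : ∀ w : W, ∀ p, B.repr (w : V) p = Fin.cases 0 (fun j => b.repr w j) p := by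
      intro w p
      have hw : (w : V) = ∑ j, b.repr w j • B j.succ := by
        conv_lhs => rw [← b.sum_repr w]
        simp only [hBs, Submodule.coe_sum, Submodule.coe_smul]
      conv_lhs => rw [hw]
      rw [map_sum, Finsupp.finsetSum_apply]
      simp only [map_smul, B.repr_self, Finsupp.smul_apply, smul_eq_mul]
      refine Fin.cases ?_ (fun j => ?_) p
      · simp
      · simp [Finsupp.single_apply]
    refine ⟨B, fun f hf p i => ?_⟩
    have h1 := hrepr ⟨f (B i), hRW f hf _⟩ p
    simp only at h1
    rw [h1]
    refine Fin.cases (by simp) (fun q => ?_) p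
    refine Fin.cases (fun _ => Fin.succ_pos q) (fun j hj => ?_) i
    rw [Fin.succ_lt_succ_iff]
    let g : W →ₗ[k] W := (f.comp W.subtype).codRestrict W fun w => hRW f hf _
    refine hb g ⟨f, hf, fun w => rfl⟩ q j ?_
    convert hj using 3
    simp only [Fin.cases_succ]
    congr 2
    exact Subtype.ext (by simp [g, hBs])

end Flag

section Local

variable {C : Type w} [Category.{v} C] [Preadditive C] [HasFiniteBiproducts C]
  [IsIdempotentComplete C]

/-- Splitting an idempotent and its complement decomposes the object into a biproduct. -/
theorem Indecomposable.eq_zero_or_eq_id {a : C} (ha : Indecomposable a) (e : a ⟶ a)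
    (he : e ≫ e = e) : e = 0 ∨ e = 𝟙 a := by
  obtain ⟨Y, i, p, h1, h2⟩ := IsIdempotentComplete.idempotents_split a e he
  obtain ⟨Z, j, q, h3, h4⟩ := IsIdempotentComplete.idempotents_split a (𝟙 a - e) (by
    simp [Preadditive.sub_comp, Preadditive.comp_sub, he])
  have hiq : i ≫ q = 0 := by
    calc i ≫ q = (i ≫ p) ≫ i ≫ q ≫ (j ≫ q) := by rw [h1, h3]; simp
      _ = i ≫ (p ≫ i) ≫ (q ≫ j) ≫ q := by simp only [Category.assoc]
      _ = 0 := by rw [h2, h4]; simp [Preadditive.sub_comp, reassoc_of% he]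
  have hjp : j ≫ p = 0 := by
    calc j ≫ p = (j ≫ q) ≫ j ≫ p ≫ (i ≫ p) := by rw [h1, h3]; simp
      _ = j ≫ (q ≫ j) ≫ (p ≫ i) ≫ p := by simp only [Category.assoc]
      _ = 0 := by rw [h2, h4]; simp [Preadditive.sub_comp, reassoc_of% he]
  let ε : a ≅ Y ⊞ Z :=
    { hom := biprod.lift p q
      inv := biprod.desc i j
      hom_inv_id := by simp [biprod.lift_desc, h2, h4]
      inv_hom_id := by
        ext <;> simp [h1, h3, hiq, hjp] }
  rcases ha.2 Y Z ε with h | h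
  · left
    rw [← h2, h.eq_of_src i 0, comp_zero]
  · right
    have : 𝟙 a - e = 0 := by rw [← h4, h.eq_of_src j 0, comp_zero]
    exact (sub_eq_zero.1 this).symm

/-- Fitting's lemma. If `X ^ m * q` annihilates `x` and `q` is prime to `X`, a Bézout identity
produces an idempotent, which is 0 or 1. -/
theorem Indecomposable.isNilpotent_or_isUnit (k : Type u) [Field k] [Linear k C]
    [∀ X Y : C, Module.Finite k (X ⟶ Y)] {a : C} (ha : Indecomposable a) (x : End a) :
    IsNilpotent x ∨ IsUnit x := by
  have hint : IsIntegral k x := by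
    have : Module.Finite k (End a) := inferInstanceAs (Module.Finite k (a ⟶ a))
    exact Algebra.IsIntegral.isIntegral x
  obtain ⟨p, hp, hp0⟩ := hint
  -- The extra factor `X` guarantees `m ≥ 1`, so that an inverse of `x ^ m` yields an inverse of
  -- `x`.
  have hp' : Polynomial.X * p ≠ 0 := mul_ne_zero Polynomial.X_ne_zero hp.ne_zero
  obtain ⟨q, hq, hqX⟩ := Polynomial.exists_eq_pow_rootMultiplicity_mul_and_not_dvd _ hp' 0
  rw [map_zero, sub_zero] at hq hqX
  set m := Polynomial.rootMultiplicity 0 (Polynomial.X * p)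
  have hm : m ≠ 0 := by
    intro h
    rw [h, pow_zero, one_mul] at hq
    exact hqX ⟨p, hq.symm⟩
  have hco : IsCoprime (Polynomial.X ^ m : Polynomial k) q :=
    ((Polynomial.irreducible_X.coprime_iff_not_dvd).2 hqX).pow_left
  obtain ⟨A, B, hAB⟩ := hco
  have h0 : Polynomial.aeval x (Polynomial.X ^ m * q) = 0 := by
    rw [← hq, map_mul]
    have : Polynomial.aeval x p = 0 := hp0
    rw [this, mul_zero]
  have h1 : Polynomial.aeval x A * x ^ m + Polynomial.aeval x (B * q) = 1 := by
    have := congrArg (Polynomial.aeval x) hAB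
    simpa using this
  have hidem : Polynomial.aeval x (B * q) * Polynomial.aeval x (B * q) =
      Polynomial.aeval x (B * q) := by
    rw [← map_mul]
    have : B * q * (B * q) = B * q - (A * B) * (Polynomial.X ^ m * q) := by
      linear_combination (B * q) * hAB
    rw [this, map_sub, map_mul _ (A * B), h0, mul_zero, sub_zero]
  rcases Indecomposable.eq_zero_or_eq_id ha (Polynomial.aeval x (B * q)) hidem with h | h
  · right
    have h2 : Polynomial.aeval x A * x ^ m = 1 := by
      rw [← h1]
      rw [h]
      exact (add_zero _).symm
    have hcomm : Commute (Polynomial.aeval x A) x := by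
      have := (Polynomial.commute_X A).symm
      have := congrArg (Polynomial.aeval x) (mul_comm A Polynomial.X)
      simpa [Commute, SemiconjBy] using this
    obtain ⟨m', hm'⟩ := Nat.exists_eq_succ_of_ne_zero hm
    rw [hm', Nat.succ_eq_add_one] at h2
    refine ⟨⟨x, Polynomial.aeval x A * x ^ m', ?_, ?_⟩, rfl⟩
    · rw [← mul_assoc, ← hcomm.eq, mul_assoc, ← pow_succ', h2]
    · rw [mul_assoc, ← pow_succ, h2]
  · left
    refine ⟨m, ?_⟩
    calc x ^ m = x ^ m * 1 := (mul_one _).symm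
      _ = x ^ m * Polynomial.aeval x (B * q) := by
        congr 1; exact h.symm
      _ = Polynomial.aeval x (B * (Polynomial.X ^ m * q)) := by
        rw [show B * (Polynomial.X ^ m * q) = Polynomial.X ^ m * (B * q) by ring]
        simp
      _ = 0 := by rw [map_mul, h0, mul_zero]

theorem isIso_of_isUnit {a : C} {x : End a} (hx : IsUnit x) : IsIso (x : a ⟶ a) :=
  (isUnit_iff_isIso x).1 hx

theorem Indecomposable.isIso_sub_or (k : Type u) [Field k] [Linear k C]
    [∀ X Y : C, Module.Finite k (X ⟶ Y)] {a : C} (ha : Indecomposable a) (x : a ⟶ a) :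
    IsIso (𝟙 a - x) ∨ IsIso x := by
  rcases Indecomposable.isNilpotent_or_isUnit k ha (x : End a) with h | h
  · exact Or.inl (isIso_of_isUnit (x := (1 - (show End a from x) : End a)) h.isUnit_one_sub)
  · exact Or.inr (isIso_of_isUnit h)

/-- After normalising `g` to a retraction `g'`, the composite `g' ≫ f` is an idempotent of `b`; it
is nonzero because `a` is. -/
theorem Indecomposable.isIso_of_isIso_comp {a b : C} (ha : Indecomposable a)
    (hb : Indecomposable b) (f : a ⟶ b) (g : b ⟶ a) (h : IsIso (f ≫ g)) : IsIso f := by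
  let g' := g ≫ inv (f ≫ g)
  have h1 : f ≫ g' = 𝟙 a := by simp only [g', ← Category.assoc, IsIso.hom_inv_id]
  rcases Indecomposable.eq_zero_or_eq_id hb (g' ≫ f) (by
    simp only [Category.assoc, reassoc_of% h1]) with h2 | h2
  · exfalso
    apply ha.1
    rw [IsZero.iff_id_eq_zero, ← h1]
    calc f ≫ g' = (f ≫ g') ≫ f ≫ g' := by rw [h1, Category.comp_id]
      _ = f ≫ (g' ≫ f) ≫ g' := by simp only [Category.assoc]
      _ = 0 := by rw [h2]; simp
  · exact ⟨g', h1, h2⟩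

variable {k : Type u} [Field k] [Linear k C] [∀ X Y : C, Module.Finite k (X ⟶ Y)]

/-- A morphism between indecomposables is radical if and only if it is not invertible. -/
theorem mem_radical_iff {a b : C} (ha : Indecomposable a) (hb : Indecomposable b) (f : a ⟶ b) :
    f ∈ radical k a b ↔ ¬ IsIso f := by
  constructor
  · intro h hf
    have := h (inv f)
    rw [IsIso.hom_inv_id, sub_self] at this
    apply ha.1
    rw [IsZero.iff_id_eq_zero, ← IsIso.hom_inv_id (0 : a ⟶ a), zero_comp]
  · intro h g
    exact (Indecomposable.isIso_sub_or k ha (f ≫ g)).resolve_right fun h' =>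
      h (Indecomposable.isIso_of_isIso_comp ha hb f g h')

theorem comp_mem_radical {a b c : C} (f : a ⟶ b) (g : b ⟶ c) (hf : f ∈ radical k a b) :
    f ≫ g ∈ radical k a c := fun h => by
  rw [Category.assoc]
  exact hf (g ≫ h)

/-- Over an algebraically closed field `f` has an eigenvalue, and subtracting it makes `f`
non-invertible. -/
theorem exists_sub_smul_id_mem_radical [IsAlgClosed k] {a : C} (ha : Indecomposable a)
    (f : a ⟶ a) : ∃ c : k, f - c • 𝟙 a ∈ radical k a a := by
  have : Module.Finite k (End a) := inferInstanceAs (Module.Finite k (a ⟶ a))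
  have : Nontrivial (End a) := ⟨⟨𝟙 a, 0, fun h => ha.1 ((IsZero.iff_id_eq_zero a).2 h)⟩⟩
  obtain ⟨c, hc⟩ := spectrum.nonempty_of_isAlgClosed_of_finiteDimensional k (show End a from f)
  refine ⟨c, (mem_radical_iff ha ha _).2 fun h => ?_⟩
  rw [spectrum.mem_iff] at hc
  apply hc
  have h2 : IsUnit ((show End a from f) - c • (1 : End a)) := (isUnit_iff_isIso _).2 h
  have h3 : algebraMap k (End a) c - (show End a from f) = -((show End a from f) - c • (1 : End a)) := by
    rw [Algebra.algebraMap_eq_smul_one]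
    exact (neg_sub _ _).symm
  rw [h3]
  exact h2.neg

end Local

end Aggregate

/-! ### Matrices of morphisms, and the matrix problem they define. -/

namespace Aggregate

section HomMatrix

variable {k : Type u} [Field k] {C : Type w} [Category.{v} C] [Preadditive C] [Linear k C]
  (M : C ⥤ FGModuleCat.{u} k) [M.Additive] [M.Linear k] {J : Set C} {d : J → ℕ}
  (m : ∀ a : J, Module.Basis (Fin (d a)) k (M.obj a.1))

/-- The matrix of the action of a morphism between objects of a spectroid. -/
noncomputable def homMatrix (a b : J) :
    (a.1 ⟶ b.1) →ₗ[k] Matrix (Fin (d b)) (Fin (d a)) k :=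
  (LinearMap.toMatrix (m a) (m b)).toLinearMap ∘ₗ actHom M a.1 b.1

theorem homMatrix_eq {a b : J} (f : a.1 ⟶ b.1) :
    homMatrix M m a b f = LinearMap.toMatrix (m a) (m b) (act M f) := rfl

theorem homMatrix_apply {a b : J} (f : a.1 ⟶ b.1) (p i) :
    homMatrix M m a b f p i = (m b).repr (act M f (m a i)) p := by
  rw [homMatrix_eq, LinearMap.toMatrix_apply]

theorem homMatrix_comp {a b c : J} (f : a.1 ⟶ b.1) (g : b.1 ⟶ c.1) :
    homMatrix M m a c (f ≫ g) = homMatrix M m b c g * homMatrix M m a b f := by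
  simp only [homMatrix_eq, act_comp]
  exact LinearMap.toMatrix_comp _ _ _ _ _

theorem homMatrix_id (a : J) : homMatrix M m a a (𝟙 a.1) = 1 := by
  simp only [homMatrix_eq, act_id, LinearMap.toMatrix_id]

theorem homMatrix_injective [M.Faithful] (a b : J) :
    Function.Injective (homMatrix M m a b) :=
  (LinearMap.toMatrix (m a) (m b)).injective.comp (act_injective M)

/-- The matrices of the radical morphisms. -/
noncomputable def radMatrix (a b : J) : Submodule k (Matrix (Fin (d b)) (Fin (d a)) k) :=
  (radical k a.1 b.1).map (homMatrix M m a b)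

variable [∀ X Y : C, Module.Finite k (X ⟶ Y)] [HasFiniteBiproducts C] [IsIdempotentComplete C]

theorem mul_mem_radMatrix {a b c : J} {F G} (hF : F ∈ radMatrix M m a b)
    (hG : G ∈ radMatrix M m b c) : G * F ∈ radMatrix M m a c := by
  obtain ⟨f, hf, rfl⟩ := hF
  obtain ⟨g, -, rfl⟩ := hG
  exact ⟨f ≫ g, comp_mem_radical f g hf, homMatrix_comp M m f g⟩

open Classical in
theorem exists_mem_radMatrix [IsAlgClosed k] (hJ : IsSpectroid J) (a b : J) (f : a.1 ⟶ b.1) :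
    ∃ F ∈ radMatrix M m a b, ∃ c : k, ∀ p i, homMatrix M m a b f p i = F p i +
      if a = b ∧ (p : ℕ) = i then c else 0 := by
  have ha := hJ.indecomposable a.1 a.2
  have hb := hJ.indecomposable b.1 b.2
  by_cases hab : a = b
  · subst hab
    obtain ⟨c, hc⟩ := exists_sub_smul_id_mem_radical (k := k) ha f
    refine ⟨_, ⟨_, hc, rfl⟩, c, fun p i => ?_⟩
    rw [map_sub, map_smul, homMatrix_id]
    simp [Matrix.one_apply, Fin.ext_iff]
  · refine ⟨_, ⟨f, (mem_radical_iff ha hb f).2 fun h => hab (Subtype.ext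
      (hJ.eq_of_iso a.1 a.2 b.1 b.2 ⟨asIso f⟩)), rfl⟩, 0, fun p i => by simp⟩

/-- A matrix `H` is read as the space `k^D → M(X)` with `X` the direct sum of the objects `o s`, and
isomorphisms of such spaces are read in coordinates. Only `coord ∘ₗ glue = id` is needed for this.
By `exists_mem_radMatrix` each block of an endomorphism of `X` is radical up to a scalar. -/
theorem hasFiniteOrbits_radMatrix [IsAlgClosed k] [M.Faithful] (hM : FinitelySpaced M)
    (hJ : IsSpectroid J) : HasFiniteOrbits (radMatrix M m) := by
  classical
  intro I _ o D _ _
  let X : C := ⨁ fun s => (o s).1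
  let ι : ∀ s, (o s).1 ⟶ X := fun s => biproduct.ι (fun s => (o s).1) s
  let π : ∀ s, X ⟶ (o s).1 := fun s => biproduct.π (fun s => (o s).1) s
  let glue : ((Σ s, Fin (d (o s))) → k) →ₗ[k] M.obj X :=
    (Pi.basisFun k _).constr k fun ρ => act M (ι ρ.1) (m (o ρ.1) ρ.2)
  let coord : M.obj X →ₗ[k] ((Σ s, Fin (d (o s))) → k) :=
    LinearMap.pi fun ρ => (m (o ρ.1)).coord ρ.2 ∘ₗ act M (π ρ.1)
  have hglue : ∀ ρ, glue (Pi.single ρ 1) = act M (ι ρ.1) (m (o ρ.1) ρ.2) := fun ρ => by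
    have := (Pi.basisFun k (Σ s, Fin (d (o s)))).constr_basis k
      (fun ρ => act M (ι ρ.1) (m (o ρ.1) ρ.2)) ρ
    rwa [Pi.basisFun_apply] at this
  have hcg : coord ∘ₗ glue = LinearMap.id := by
    refine (Pi.basisFun k _).ext fun ρ => ?_
    rw [Pi.basisFun_apply, LinearMap.comp_apply, hglue]
    funext σ
    simp only [coord, LinearMap.pi_apply, LinearMap.comp_apply, act_comp_apply, LinearMap.id_apply]
    obtain ⟨s, i⟩ := ρ
    obtain ⟨t, p⟩ := σ
    by_cases hst : s = t
    · subst hst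
      simp only [ι, π, biproduct.ι_π_self, act_id, LinearMap.id_apply, Module.Basis.coord_apply,
        Module.Basis.repr_self, Finsupp.single_apply, Pi.single_apply, Sigma.mk.injEq, heq_eq_eq,
        true_and, eq_comm]
    · simp only [ι, π, biproduct.ι_π_ne _ hst, act_zero, LinearMap.zero_apply, map_zero]
      rw [Pi.single_eq_of_ne]
      intro h
      exact hst (congrArg Sigma.fst h).symm
  let Ξ : (X ⟶ X) → Matrix (Σ s, Fin (d (o s))) (Σ s, Fin (d (o s))) k := fun ξ =>
    LinearMap.toMatrix' (coord ∘ₗ act M ξ ∘ₗ glue)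
  have hΞ : ∀ ξ, IsHomMatrix (radMatrix M m) o (Ξ ξ) := by
    intro ξ s s'
    obtain ⟨F, hF, c, h⟩ := exists_mem_radMatrix M m hJ (o s) (o s') (ι s ≫ ξ ≫ π s')
    refine ⟨F, hF, c, fun p i => ?_⟩
    refine Eq.trans ?_ ((h p i).trans (by congr))
    rw [homMatrix_apply]
    change LinearMap.toMatrix' (coord ∘ₗ act M ξ ∘ₗ glue) ⟨s', p⟩ ⟨s, i⟩ = _
    rw [LinearMap.toMatrix'_apply]
    simp only [LinearMap.comp_apply]
    have := hglue ⟨s, i⟩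
    have e : (fun j' => if j' = (⟨s, i⟩ : Σ s, Fin (d (o s))) then (1 : k) else 0) =
      Pi.single ⟨s, i⟩ 1 := by
      funext j'
      simp [Pi.single_apply]
    first
      | rw [e, hglue]
      | rw [hglue]
    simp only [coord, LinearMap.pi_apply, LinearMap.comp_apply, act_comp_apply,
      Module.Basis.coord_apply, Category.assoc]
  obtain ⟨n, cls, hcls⟩ := exists_finite_orbits M hM X D
  have key : ∀ (H H' : Matrix (Σ s, Fin (d (o s))) D k) (ξ : X ⟶ X) (φ : (D → k) →ₗ[k] (D → k)),
      (glue ∘ₗ Matrix.toLin' H) ∘ₗ φ = act M ξ ∘ₗ (glue ∘ₗ Matrix.toLin' H') →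
      H * LinearMap.toMatrix' φ = Ξ ξ * H' := by
    intro H H' ξ φ h
    have h2 := congrArg (fun f => coord ∘ₗ f) h
    simp only [← LinearMap.comp_assoc, hcg] at h2
    apply Matrix.toLin'.injective
    rw [Matrix.toLin'_mul, Matrix.toLin'_mul, Matrix.toLin'_toMatrix']
    simp only [Ξ, Matrix.toLin'_toMatrix']
    simpa only [LinearMap.id_comp, LinearMap.comp_assoc] using h2
  refine ⟨n, fun H => cls (glue ∘ₗ Matrix.toLin' H), fun H H' hH => ?_⟩
  obtain ⟨ξ, ξ', φ, ψ, h1, h2, h3, h4⟩ := hcls _ _ hH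
  refine ⟨Ξ ξ, Ξ ξ', hΞ ξ, hΞ ξ', LinearMap.toMatrix' φ, LinearMap.toMatrix' ψ, ?_, ?_,
    key _ _ _ _ h3, key _ _ _ _ h4⟩
  · rw [← LinearMap.toMatrix'_comp, h1, LinearMap.toMatrix'_id]
  · rw [← LinearMap.toMatrix'_comp, h2, LinearMap.toMatrix'_id]

/-- For a basis adapted to the radical filtration, the radical endomorphisms act by strictly lower
triangular matrices. -/
theorem exists_basis_radMatrix_lower (a : J) :
    ∃ b : Module.Basis (Fin (Module.finrank k (M.obj a.1))) k (M.obj a.1),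
      ∀ f ∈ radical k a.1 a.1, ∀ p i, b.repr (act M f (b i)) p ≠ 0 → i < p := by
  obtain ⟨b, hb⟩ := exists_flag_basis _ rfl ((radical k a.1 a.1).map (actHom M a.1 a.1))
    (by
      rintro _ ⟨f, hf, rfl⟩ _ ⟨g, hg, rfl⟩
      exact ⟨g ≫ f, comp_mem_radical g f hg, act_comp M g f⟩)
    (by
      rintro _ ⟨f, hf, rfl⟩ x hx
      have h1 := hf (𝟙 a.1)
      rw [Category.comp_id] at h1
      have h2 : act M (𝟙 a.1 - f) x = 0 := by
        rw [act_sub, act_id]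
        exact sub_eq_zero.2 (Eq.symm hx)
      have h3 := act_comp_apply M (𝟙 a.1 - f) (inv (𝟙 a.1 - f)) x
      rw [h2, map_zero, IsIso.hom_inv_id, act_id] at h3
      exact h3.symm)
  exact ⟨b, fun f hf => hb _ ⟨f, hf, rfl⟩⟩

end HomMatrix

end Aggregate

/-! ### Bases permuted by a shift, the bound 3, and the model by `3 × 3` matrices. -/

namespace Aggregate

section Shift

variable {k : Type u} [Field k] {V : Type v} [AddCommGroup V] [Module k V]

/-- The vector `z ^ i` applied to the first basis vector has its leading coordinate at place `i`,
namely a product of subdiagonal entries of `z`. The change of basis is therefore lower triangular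
and invertible, and it preserves strict lower triangularity. -/
theorem exists_shift_basis {n : ℕ} (b : Module.Basis (Fin n) k V) (R : Submodule k (V →ₗ[k] V))
    (hR : ∀ f ∈ R, ∀ p i, b.repr (f (b i)) p ≠ 0 → i < p) (z : V →ₗ[k] V) (hz : z ∈ R)
    (hz1 : ∀ i p : Fin n, (p : ℕ) = i + 1 → b.repr (z (b i)) p ≠ 0) :
    ∃ b' : Module.Basis (Fin n) k V, (∀ f ∈ R, ∀ p i, b'.repr (f (b' i)) p ≠ 0 → i < p) ∧
      ∀ p i, b'.repr (z (b' i)) p = if (p : ℕ) = i + 1 then 1 else 0 := by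
  rcases Nat.eq_zero_or_pos n with rfl | hn
  · exact ⟨b, hR, fun p => p.elim0⟩
  let e : ℕ → V := fun i => (z ^ i) (b ⟨0, hn⟩)
  have hze : ∀ i, z (e i) = e (i + 1) := fun i => by
    simp only [e, pow_succ']; rfl
  have hrepr : ∀ x p, b.repr (z x) p = ∑ j, b.repr x j * b.repr (z (b j)) p := by
    intro x p
    conv_lhs => rw [← b.sum_repr x]
    simp only [map_sum, map_smul, Finsupp.finsetSum_apply, Finsupp.smul_apply, smul_eq_mul]
  have he : ∀ i (p : Fin n), ((p : ℕ) < i → b.repr (e i) p = 0) ∧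
      ((p : ℕ) = i → b.repr (e i) p ≠ 0) := by
    intro i
    induction i with
    | zero =>
      refine fun p => ⟨fun h => by omega, fun h => ?_⟩
      have : p = ⟨0, hn⟩ := Fin.ext h
      simp [e, this]
    | succ i ih =>
      intro p
      have hterm : ∀ j : Fin n, (p : ℕ) ≤ i + 1 → (j : ℕ) ≠ i →
          b.repr (e i) j * b.repr (z (b j)) p = 0 := by
        intro j hp hj
        rcases lt_or_gt_of_ne hj with h | h
        · rw [(ih j).1 h, zero_mul]
        · have : b.repr (z (b j)) p = 0 := by
            by_contra hne
            have := hR z hz p j hne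
            rw [Fin.lt_def] at this
            omega
          rw [this, mul_zero]
      constructor
      · intro hp
        rw [← hze, hrepr]
        refine Finset.sum_eq_zero fun j _ => ?_
        by_cases hj : (j : ℕ) = i
        · have : b.repr (z (b j)) p = 0 := by
            by_contra hne
            have := hR z hz p j hne
            rw [Fin.lt_def] at this
            omega
          rw [this, mul_zero]
        · exact hterm j (by omega) hj
      · intro hp
        have hi : i < n := by omega
        rw [← hze, hrepr, Finset.sum_eq_single ⟨i, hi⟩ (fun j _ hj => hterm j (by omega)
          (fun h => hj (Fin.ext h))) (fun h => absurd (Finset.mem_univ _) h)]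
        exact mul_ne_zero ((ih _).2 rfl) (hz1 _ _ hp)
  let P : Matrix (Fin n) (Fin n) k := b.toMatrix fun i : Fin n => e i
  have hP : P.BlockTriangular OrderDual.toDual := fun p i h => (he i p).1 h
  have hdet : IsUnit P.det := by
    rw [Matrix.det_of_isLowerTriangular P hP, isUnit_iff_ne_zero, Finset.prod_ne_zero_iff]
    exact fun i _ => (he i i).2 rfl
  have hb := (Module.Basis.is_basis_iff_det b (v := fun i : Fin n => e i)).2
    (by rw [Module.Basis.det_apply]; exact hdet)
  let b' : Module.Basis (Fin n) k V := Module.Basis.mk hb.1 hb.2.ge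
  have hb' : ∀ i, b' i = e i := fun i => by simp [b']
  have hPb : b.toMatrix b' = P := by
    ext p i
    simp [P, Module.Basis.toMatrix_apply, hb']
  have hinv : b'.toMatrix b = P⁻¹ := by
    rw [← hPb]
    exact (Matrix.inv_eq_left_inv (b'.toMatrix_mul_toMatrix_flip b)).symm
  have hPinv : (P⁻¹).BlockTriangular OrderDual.toDual := by
    have : Invertible P := P.invertibleOfIsUnitDet hdet
    exact Matrix.blockTriangular_inv_of_blockTriangular hP
  have hlow : ∀ f ∈ R, ∀ p i, b'.repr (f (b' i)) p ≠ 0 → i < p := by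
    intro f hf p i hne
    rw [← LinearMap.toMatrix_apply b' b' f,
      ← basis_toMatrix_mul_linearMap_toMatrix_mul_basis_toMatrix b' b b' b f, hinv, hPb,
      Matrix.mul_apply] at hne
    obtain ⟨j, -, hj⟩ := Finset.exists_ne_zero_of_sum_ne_zero hne
    rw [Matrix.mul_apply, Finset.sum_mul] at hj
    obtain ⟨q, -, hq⟩ := Finset.exists_ne_zero_of_sum_ne_zero hj
    have h1 : q ≤ p := by
      by_contra h
      apply hq
      rw [hPinv (i := p) (j := q) (by simpa using h), zero_mul, zero_mul]
    have h2 : i ≤ j := by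
      by_contra h
      apply hq
      rw [hP (i := j) (j := i) (by simpa using h), mul_zero]
    have h3 : j < q := by
      refine hR f hf q j fun h => hq ?_
      rw [LinearMap.toMatrix_apply, h, mul_zero, zero_mul]
    exact h2.trans_lt (h3.trans_le h1)
  refine ⟨b', hlow, fun p i => ?_⟩
  rw [hb', hze]
  by_cases hi : (i : ℕ) + 1 < n
  · have := hb' ⟨i + 1, hi⟩
    simp only at this
    rw [← this, b'.repr_self, Finsupp.single_apply]
    simp only [Fin.ext_iff, eq_comm]
  · rw [if_neg (by omega)]
    by_contra hne
    rw [← hze, ← hb'] at hne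
    have := hlow z hz p i hne
    rw [Fin.lt_def] at this
    omega

end Shift

section Bound

variable {k : Type u} [Field k] [Infinite k] {J : Type w} {d : J → ℕ}
  {R : ∀ a b : J, Submodule k (Matrix (Fin (d b)) (Fin (d a)) k)}

/-- Four vectors of one object at four levels, with two copies of the object and one column per
level, make the Tits form vanish: `4 + 4 = 8`. -/
theorem HasFiniteOrbits.le_three (hR : HasFiniteOrbits R) (a : J)
    (hlow : ∀ F ∈ R a a, ∀ p i, F p i ≠ 0 → i < p) : d a ≤ 3 := by
  by_contra! h
  refine hR.tits (m := 1) (n := 4) (r := 4) (fun _ => a) (Function.injective_of_subsingleton _)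
    (fun s t => s.2 < t.2) (fun s t u => lt_trans) (fun t t' F hF p i h => hlow F hF p i h)
    (fun _ => 0) (fun q => q) (fun q => by have := q.2; omega) id
    (fun q q' _ h => Fin.ext h) (fun q q' h => not_lt.2 h) (fun _ => 2) (fun _ => 1)
    (fun ℓ => ?_) (by simp) ⟨0, one_ne_zero⟩
  have : Finset.univ.filter (fun q : Fin 4 => id q = ℓ) = {ℓ} := by ext; simp
  rw [this]
  simp

/-- If this entry vanished on all of `R a a`, the two consecutive vectors would be incomparable and
could share a level; one copy and one column then give `1 + 1 = 2`. -/
theorem HasFiniteOrbits.exists_subdiagonal_ne_zero (hR : HasFiniteOrbits R) (a : J)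
    (hlow : ∀ F ∈ R a a, ∀ p i, F p i ≠ 0 → i < p) (i p : Fin (d a)) (hp : (p : ℕ) = i + 1) :
    ∃ F ∈ R a a, F p i ≠ 0 := by
  by_contra! h
  refine hR.tits (m := 1) (n := 2) (r := 1) (fun _ => a) (Function.injective_of_subsingleton _)
    (fun s t => s.2 < t.2 ∧ ¬ (s.2 = i ∧ t.2 = p)) ?_ ?_
    (fun _ => 0) (fun q => i + q) (fun q => by have := q.2; have := p.2; omega)
    (fun _ => 0) (fun q q' _ h => Fin.ext (by simpa using h)) ?_
    (fun _ => 1) (fun _ => 1) (by simp) (by simp) ⟨0, one_ne_zero⟩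
  · rintro s t u ⟨h1, h2⟩ ⟨h3, h4⟩
    exact ⟨h1.trans h3, by omega⟩
  · intro t t' F hF q j hne
    refine ⟨hlow F hF q j hne, fun hh => hne ?_⟩
    rw [Fin.ext hh.1, Fin.ext hh.2]
    exact h F hF
  · intro q q' _ hh
    have := q.2
    have := q'.2
    simp only at hh
    omega

/-- There are at most two subdiagonal entries. If neither of two matrices has both nonzero, their
sum does. -/
theorem HasFiniteOrbits.exists_subdiagonal (hR : HasFiniteOrbits R) (a : J)
    (hlow : ∀ F ∈ R a a, ∀ p i, F p i ≠ 0 → i < p) :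
    ∃ F ∈ R a a, ∀ i p : Fin (d a), (p : ℕ) = i + 1 → F p i ≠ 0 := by
  have h3 := hR.le_three a hlow
  have key := hR.exists_subdiagonal_ne_zero a hlow
  by_cases h1 : d a ≤ 1
  · exact ⟨0, (R a a).zero_mem, fun i p h => by omega⟩
  obtain ⟨F, hF, hF1⟩ := key ⟨0, by omega⟩ ⟨1, by omega⟩ rfl
  by_cases h2 : d a ≤ 2
  · refine ⟨F, hF, fun i p h => ?_⟩
    have hi : i = ⟨0, by omega⟩ := Fin.ext (by simp only; omega)
    have hp : p = ⟨1, by omega⟩ := Fin.ext (by simp only; omega)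
    rw [hi, hp]; exact hF1
  obtain ⟨G, hG, hG1⟩ := key ⟨1, by omega⟩ ⟨2, by omega⟩ rfl
  have hsplit : ∀ H : Matrix (Fin (d a)) (Fin (d a)) k, H ⟨1, by omega⟩ ⟨0, by omega⟩ ≠ 0 →
      H ⟨2, by omega⟩ ⟨1, by omega⟩ ≠ 0 → ∀ i p : Fin (d a), (p : ℕ) = i + 1 → H p i ≠ 0 := by
    intro H h10 h21 i p h
    by_cases hi0 : (i : ℕ) = 0
    · have hi : i = ⟨0, by omega⟩ := Fin.ext hi0
      have hp : p = ⟨1, by omega⟩ := Fin.ext (by simp only; omega)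
      rw [hi, hp]; exact h10
    · have hi : i = ⟨1, by omega⟩ := Fin.ext (by simp only; omega)
      have hp : p = ⟨2, by omega⟩ := Fin.ext (by simp only; omega)
      rw [hi, hp]; exact h21
  by_cases hF2 : F ⟨2, by omega⟩ ⟨1, by omega⟩ = 0
  · by_cases hG2 : G ⟨1, by omega⟩ ⟨0, by omega⟩ = 0
    · refine ⟨F + G, add_mem hF hG, hsplit _ ?_ ?_⟩
      · rw [Matrix.add_apply, hG2, add_zero]; exact hF1
      · rw [Matrix.add_apply, hF2, zero_add]; exact hG1
    · exact ⟨G, hG, hsplit _ hG2 hG1⟩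
  · exact ⟨F, hF, hsplit _ hF1 hF2⟩

end Bound

/-- The matrices with entries `F p i` of the radical morphisms between the objects of the spectroid
of a finitely spaced module, in bases permuted by a nilpotent endomorphism of each object. -/
structure RadicalModel (k : Type u) [Field k] (J : Type w) where
  d : J → ℕ
  d_le (a : J) : d a ≤ 3
  R (a b : J) : Submodule k (Matrix (Fin 3) (Fin 3) k)
  supp {a b : J} {F} (hF : F ∈ R a b) {p i : Fin 3} (h : F p i ≠ 0) :
    (i : ℕ) < d a ∧ (p : ℕ) < d b
  mul_mem {a b c : J} {F G} (hF : F ∈ R a b) (hG : G ∈ R b c) : G * F ∈ R a c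
  shift_mem (a : J) : (Matrix.of fun p i : Fin 3 =>
    if (p : ℕ) = i + 1 ∧ (p : ℕ) < d a then (1 : k) else 0) ∈ R a a
  lower {a : J} {F} (hF : F ∈ R a a) {p i : Fin 3} (h : F p i ≠ 0) : i < p
  tits {m n r : ℕ}
    (o : Fin m → J) (ho : Function.Injective o)
    (lt : Fin m × Fin 3 → Fin m × Fin 3 → Prop) (htrans : ∀ s t u, lt s t → lt t u → lt s u)
    (hlt : ∀ t t', ∀ F ∈ R (o t) (o t'), ∀ p i, F p i ≠ 0 → lt (t, i) (t', p))
    (obj : Fin n → Fin m) (pos : Fin n → Fin 3) (hpos : ∀ q, (pos q : ℕ) < d (o (obj q)))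
    (g : Fin n → Fin r) (hinj : ∀ q q', obj q = obj q' → pos q = pos q' → q = q')
    (hord : ∀ q q', g q ≤ g q' → ¬ lt (obj q', pos q') (obj q, pos q))
    (x : Fin m → ℕ) (v : Fin r → ℕ) (hv : ∀ ℓ, v ℓ ≤ ∑ q with g q = ℓ, x (obj q))
    (hq : ∑ ℓ, v ℓ ^ 2 + ∑ t, x t ^ 2 ≤ ∑ q, v (g q) * x (obj q)) (hv0 : ∃ ℓ, v ℓ ≠ 0) : False
  not_diagonal_line {a b : J} (hab : a ≠ b) (ha : d a = 3) (hb : d b = 3)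
    (hba : ∀ F ∈ R b a, ∀ p i, F p i ≠ 0 → i < p)
    (hlow : ∀ F ∈ R a b, ∀ p i, F p i ≠ 0 → i ≤ p) (y : Fin 3 → k)
    (hline : ∀ F ∈ R a b, ∃ c, ∀ i, F i i = c * y i) : False

section ToModel

variable {k : Type u} [Field k] [Infinite k] {J : Type w} {d : J → ℕ}

/-- Extension by zero to `3 × 3` matrices. -/
def padMatrix {m n : ℕ} (F : Matrix (Fin m) (Fin n) k) : Matrix (Fin 3) (Fin 3) k :=
  Matrix.of fun p i => if h : (p : ℕ) < m ∧ (i : ℕ) < n then F ⟨p, h.1⟩ ⟨i, h.2⟩ else 0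

theorem padMatrix_apply {m n : ℕ} (hm : m ≤ 3) (hn : n ≤ 3) (F : Matrix (Fin m) (Fin n) k) (p i) :
    padMatrix F (Fin.castLE hm p) (Fin.castLE hn i) = F p i := by
  simp [padMatrix]

theorem padMatrix_submatrix {m n : ℕ} (hm : m ≤ 3) (hn : n ≤ 3)
    (F : Matrix (Fin m) (Fin n) k) :
    (padMatrix F).submatrix (Fin.castLE hm) (Fin.castLE hn) = F := by
  ext p i
  exact padMatrix_apply hm hn F p i

variable (R : ∀ a b : J, Submodule k (Matrix (Fin (d b)) (Fin (d a)) k)) (hd : ∀ a, d a ≤ 3)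

/-- The `3 × 3` matrices obtained from `R a b` by extension by zero. -/
def padSubmodule (a b : J) : Submodule k (Matrix (Fin 3) (Fin 3) k) where
  carrier := {F | (∀ p i : Fin 3, F p i ≠ 0 → (i : ℕ) < d a ∧ (p : ℕ) < d b) ∧
    F.submatrix (Fin.castLE (hd b)) (Fin.castLE (hd a)) ∈ R a b}
  zero_mem' := ⟨fun p i h => absurd rfl h, (R a b).zero_mem⟩
  add_mem' := by
    rintro F G ⟨h1, h2⟩ ⟨h3, h4⟩
    refine ⟨fun p i h => ?_, (R a b).add_mem h2 h4⟩
    by_cases h0 : F p i = 0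
    · exact h3 p i fun h5 => h (by rw [Matrix.add_apply, h0, h5, add_zero])
    · exact h1 p i h0
  smul_mem' := by
    rintro c F ⟨h1, h2⟩
    exact ⟨fun p i h => h1 p i fun h3 => h (by rw [Matrix.smul_apply, h3, smul_zero]),
      (R a b).smul_mem c h2⟩

variable {R}

theorem padMatrix_mem {a b : J} {F} (hF : F ∈ R a b) :
    padMatrix F ∈ padSubmodule R hd a b := by
  refine ⟨fun p i h => ?_, ?_⟩
  · by_contra hn
    exact h (dif_neg fun h' => hn ⟨h'.2, h'.1⟩)
  · rwa [padMatrix_submatrix]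

theorem apply_ne_zero_of_padSubmodule {a b : J} {P : Fin 3 → Fin 3 → Prop}
    (h : ∀ F ∈ padSubmodule R hd a b, ∀ p i, F p i ≠ 0 → P p i) {F} (hF : F ∈ R a b) (p i)
    (hne : F p i ≠ 0) : P (Fin.castLE (hd b) p) (Fin.castLE (hd a) i) :=
  h _ (padMatrix_mem hd hF) _ _ (by rwa [padMatrix_apply])

/-- The model defined by a family of spaces of matrices satisfying the finiteness condition. -/
def HasFiniteOrbits.toModel (hR : HasFiniteOrbits R)
    (hmul : ∀ {a b c} {F G}, F ∈ R a b → G ∈ R b c → G * F ∈ R a c)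
    (hlow : ∀ a, ∀ F ∈ R a a, ∀ p i, F p i ≠ 0 → i < p)
    (hshift : ∀ a, (Matrix.of fun p i : Fin (d a) => if (p : ℕ) = i + 1 then (1 : k) else 0) ∈
      R a a) : RadicalModel k J where
  d := d
  d_le := hd
  R := padSubmodule R hd
  supp hF p i h := hF.1 p i h
  mul_mem := by
    rintro a b c F G ⟨h1, h2⟩ ⟨h3, h4⟩
    refine ⟨fun p i h => ?_, ?_⟩
    · rw [Matrix.mul_apply] at h
      obtain ⟨j, -, hj⟩ := Finset.exists_ne_zero_of_sum_ne_zero h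
      exact ⟨(h1 _ _ (right_ne_zero_of_mul hj)).1, (h3 _ _ (left_ne_zero_of_mul hj)).2⟩
    · convert hmul h2 h4 using 1
      ext p i
      simp only [Matrix.submatrix_apply, Matrix.mul_apply]
      symm
      refine Fintype.sum_of_injective (Fin.castLE (hd b)) (Fin.castLE_injective _) _ _ ?_
        (fun _ => rfl)
      intro j hj
      by_contra hne
      exact hj ⟨⟨j, (h1 _ _ (right_ne_zero_of_mul hne)).2⟩, rfl⟩
  shift_mem a := by
    refine ⟨fun p i h => ?_, ?_⟩
    · by_contra hn
      refine h (if_neg fun h' => hn ⟨by omega, h'.2⟩)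
    · convert hshift a using 1
      ext p i
      simp
  lower := by
    rintro a F hF p i h
    have h1 := hF.1 p i h
    exact hlow a _ hF.2 ⟨p, h1.2⟩ ⟨i, h1.1⟩ h
  tits := by
    intro m n r o ho lt htrans hlt obj pos hpos g hinj hord x v hv hq hv0
    refine hR.tits o ho (fun s t => ∃ (h1 : s.2 < 3) (h2 : t.2 < 3),
      lt (s.1, ⟨s.2, h1⟩) (t.1, ⟨t.2, h2⟩)) ?_ ?_ obj (fun q => pos q) hpos g
      (fun q q' h h' => hinj q q' h (Fin.ext h')) ?_ x v hv hq hv0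
    · rintro s t u ⟨h1, h2, h3⟩ ⟨h4, h5, h6⟩
      exact ⟨h1, h5, htrans _ _ _ h3 h6⟩
    · intro t t' F hF p i hne
      exact ⟨i.2.trans_le (hd _), p.2.trans_le (hd _),
        apply_ne_zero_of_padSubmodule hd (P := fun p i => lt (t, i) (t', p)) (hlt t t') hF p i hne⟩
    · rintro q q' h ⟨h1, h2, h3⟩
      exact hord q q' h h3
  not_diagonal_line := by
    intro a b hab ha hb hba hlow' y hline
    refine hR.not_diagonal_line hab ha hb (hlow a) (hlow b)
      (fun F hF p i h => apply_ne_zero_of_padSubmodule hd (P := fun p i => i < p) hba hF p i h)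
      (fun F hF p i h => apply_ne_zero_of_padSubmodule hd (P := fun p i => i ≤ p) hlow' hF p i h)
      (fun i => if h : i < 3 then y ⟨i, h⟩ else 0) ?_
    intro F hF
    obtain ⟨c, hc⟩ := hline _ (padMatrix_mem hd hF)
    refine ⟨c, fun p i h => ?_⟩
    have h1 := hc (Fin.castLE (hd a) i)
    have h2 : Fin.castLE (hd a) i = Fin.castLE (hd b) p := Fin.ext h
    have h3 := padMatrix_apply (hd b) (hd a) F p i
    rw [← h3, ← h2]
    rw [dif_pos (i.2.trans_le (hd a))]
    exact h1

end ToModel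

end Aggregate

/-! ### From normal matrices to a multiplicative basis. -/

namespace Aggregate

/-- Matrices all of whose `2 × 2` minors vanish. -/
def MinorsVanish {k : Type u} [Field k] (G : Matrix (Fin 3) (Fin 3) k) : Prop :=
  ∀ p q i j, G p i * G q j = G p j * G q i

/-- The matrices corresponding to the members of a multiplicative basis of rank at most `2`, after
the basis vectors have been multiplied by the scalars `s a i`. -/
structure RadicalModel.IsNormal {k : Type u} [Field k] {J : Type w} (𝓜 : RadicalModel k J)
    (s : J → Fin 3 → k) (a b : J) (F : Matrix (Fin 3) (Fin 3) k) : Prop where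
  mem : F ∈ 𝓜.R a b
  scale : ∀ p i, F p i ≠ 0 → s a i * F p i = s b p
  row : ∀ p i j, F p i ≠ 0 → F p j ≠ 0 → i = j
  col : ∀ p q i, F p i ≠ 0 → F q i ≠ 0 → p = q
  -- The second alternative encodes thinness in rank two: the matrix is not a sum of two radical
  -- matrices of rank at most one.
  shape : (∃ p, ∀ q j, F q j ≠ 0 → q = p) ∨ ((∃ p p', ∀ q j, F q j ≠ 0 → q = p ∨ q = p') ∧
    ∀ G ∈ 𝓜.R a b, ∀ H ∈ 𝓜.R a b, F = G + H → MinorsVanish G → MinorsVanish H → False)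

section Transfer

variable {k : Type u} [Field k] {C : Type w} [Category.{v} C] [Preadditive C] [Linear k C]
  (M : C ⥤ FGModuleCat.{u} k) [M.Additive] [M.Linear k] {J : Set C} {d : J → ℕ}
  (m : ∀ a : J, Module.Basis (Fin (d a)) k (M.obj a.1))
  [∀ X Y : C, Module.Finite k (X ⟶ Y)] [HasFiniteBiproducts C] [IsIdempotentComplete C]
  [M.Faithful]

theorem rk_le_card {a b : J} (f : a.1 ⟶ b.1) (T : Finset (M.obj b.1))
    (h : ∀ x, act M f x ∈ Submodule.span k (T : Set (M.obj b.1))) : rk M f ≤ T.card := by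
  refine (Submodule.finrank_mono (t := Submodule.span k (T : Set (M.obj b.1))) ?_).trans
    (finrank_span_finset_le_card T)
  rintro _ ⟨x, rfl⟩
  exact h x

theorem eq_zero_of_rk_eq_zero {a b : C} {f : a ⟶ b} (h : rk M f = 0) : f = 0 := by
  apply act_injective M
  rw [act_zero]
  rw [rk, Submodule.finrank_eq_zero, LinearMap.range_eq_bot] at h
  exact h

theorem homMatrix_minors {a b : J} {f : a.1 ⟶ b.1} (h : rk M f ≤ 1) (p q i j) :
    homMatrix M m a b f p i * homMatrix M m a b f q j =
      homMatrix M m a b f p j * homMatrix M m a b f q i := by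
  rw [rk, finrank_le_one_iff] at h
  obtain ⟨⟨v, hv⟩, h⟩ := h
  have key : ∀ x, ∃ c : k, act M f x = c • v := fun x => by
    obtain ⟨c, hc⟩ := h ⟨act M f x, x, rfl⟩
    exact ⟨c, (congrArg Subtype.val hc).symm⟩
  obtain ⟨c, hc⟩ := key (m a i)
  obtain ⟨c', hc'⟩ := key (m a j)
  simp only [homMatrix_apply, hc, hc', map_smul, Finsupp.smul_apply, smul_eq_mul]
  ring

theorem padMatrix_minors {m n : ℕ} {F : Matrix (Fin m) (Fin n) k}
    (h : ∀ p q i j, F p i * F q j = F p j * F q i) : MinorsVanish (padMatrix F) := by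
  intro p q i j
  simp only [padMatrix, Matrix.of_apply]
  by_cases hp : (p : ℕ) < m <;> by_cases hq : (q : ℕ) < m <;> by_cases hi : (i : ℕ) < n <;>
    by_cases hj : (j : ℕ) < n <;> simp [hp, hq, hi, hj]
  exact h _ _ _ _

theorem padMatrix_add {m n : ℕ} (F G : Matrix (Fin m) (Fin n) k) :
    padMatrix (F + G) = padMatrix F + padMatrix G := by
  ext p i
  simp only [padMatrix, Matrix.of_apply, Matrix.add_apply]
  split_ifs <;> simp

variable [IsAlgClosed k]

/-- Bases of the spaces `M(a)` permuted by a radical endomorphism. -/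
theorem exists_basis_shift (hM : FinitelySpaced M) (hJ : IsSpectroid J) :
    ∃ m : ∀ a : J, Module.Basis (Fin (Module.finrank k (M.obj a.1))) k (M.obj a.1),
      (∀ a, ∀ F ∈ radMatrix M m a a, ∀ p i, F p i ≠ 0 → i < p) ∧
      ∀ a, (Matrix.of fun p i : Fin (Module.finrank k (M.obj a.1)) =>
        if (p : ℕ) = i + 1 then (1 : k) else 0) ∈ radMatrix M m a a := by
  have : Infinite k := IsAlgClosed.instInfinite
  choose m₀ hm₀ using fun a : J => exists_basis_radMatrix_lower (k := k) M a
  have hfin := hasFiniteOrbits_radMatrix M m₀ hM hJ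
  have key : ∀ a : J, ∃ b : Module.Basis (Fin (Module.finrank k (M.obj a.1))) k (M.obj a.1),
      (∀ f ∈ radical k a.1 a.1, ∀ p i, b.repr (act M f (b i)) p ≠ 0 → i < p) ∧
      ∃ z ∈ radical k a.1 a.1, ∀ p i, b.repr (act M z (b i)) p =
        if (p : ℕ) = i + 1 then 1 else 0 := by
    intro a
    have hlow : ∀ F ∈ radMatrix M m₀ a a, ∀ p i, F p i ≠ 0 → i < p := by
      rintro _ ⟨f, hf, rfl⟩ p i h
      rw [homMatrix_apply] at h
      exact hm₀ a f hf p i h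
    obtain ⟨_, ⟨z, hz, rfl⟩, hz1⟩ := hfin.exists_subdiagonal a hlow
    obtain ⟨b, hb, hb'⟩ := exists_shift_basis (m₀ a) ((radical k a.1 a.1).map (actHom M a.1 a.1))
      (by rintro _ ⟨f, hf, rfl⟩; exact hm₀ a f hf) (act M z) ⟨z, hz, rfl⟩
      (fun i p h => by simpa only [homMatrix_apply] using hz1 i p h)
    exact ⟨b, fun f hf => hb _ ⟨f, hf, rfl⟩, z, hz, hb'⟩
  choose m hm z hz hz' using key
  refine ⟨m, ?_, fun a => ⟨z a, hz a, ?_⟩⟩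
  · rintro a _ ⟨f, hf, rfl⟩ p i h
    rw [homMatrix_apply] at h
    exact hm a f hf p i h
  · ext p i
    rw [homMatrix_apply, hz']
    rfl

/-- The bases of the radical spaces are extracted from the spanning normal matrices, and the vectors
`m a i` are multiplied by `s`. The fields `scale`, `row` and `col` of normality then give
multiplicativity, while `shape` gives the rank bound and thinness. -/
theorem exists_pairBasis_of_normal (hM : FinitelySpaced M) (hJ : IsSpectroid J)
    (H : ∀ 𝓜 : RadicalModel k J, ∃ s : J → Fin 3 → k, (∀ a i, s a i ≠ 0) ∧
      ∀ a b, 𝓜.R a b ≤ Submodule.span k {F | 𝓜.IsNormal s a b F}) :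
    ∃ B : PairBasis M J, B.IsMultiplicative ∧ B.RankLE 2 := by
  classical
  have : Infinite k := IsAlgClosed.instInfinite
  obtain ⟨m, hlow, hshift⟩ := exists_basis_shift M hM hJ
  have hfin := hasFiniteOrbits_radMatrix M m hM hJ
  have hd := fun a => hfin.le_three a (hlow a)
  let 𝓜 : RadicalModel k J := hfin.toModel hd (mul_mem_radMatrix M m) hlow hshift
  obtain ⟨s, hs, hspan⟩ := H 𝓜
  let c : ∀ (a : J), Fin (Module.finrank k (M.obj a.1)) → Fin 3 := fun a => Fin.castLE (hd a)
  let S : ∀ a b : J, Set (radical k a.1 b.1) := fun a b =>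
    {f | 𝓜.IsNormal s a b (padMatrix (homMatrix M m a b f))}
  have hS : ∀ a b, ⊤ ≤ Submodule.span k (S a b) := by
    intro a b f _
    let Φ : radical k a.1 b.1 →ₗ[k] Matrix (Fin 3) (Fin 3) k :=
      { toFun := fun f => padMatrix (homMatrix M m a b f)
        map_add' := fun f g => by
          rw [Submodule.coe_add, map_add, padMatrix_add]
        map_smul' := fun c f => by
          rw [Submodule.coe_smul, map_smul]
          ext p i
          simp only [padMatrix, Matrix.of_apply, Matrix.smul_apply, RingHom.id_apply]
          split_ifs <;> simp }
    have hΦ : Function.Injective Φ := by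
      intro f g h
      apply Subtype.ext
      apply homMatrix_injective M m
      have := congrArg (fun F => Matrix.submatrix F (Fin.castLE (hd b)) (Fin.castLE (hd a))) h
      simpa only [Φ, LinearMap.coe_mk, AddHom.coe_mk, padMatrix_submatrix] using this
    have h1 : Φ f ∈ Submodule.span k {F | 𝓜.IsNormal s a b F} :=
      hspan a b (padMatrix_mem hd ⟨f, f.2, rfl⟩)
    have h2 : {F | 𝓜.IsNormal s a b F} ⊆ Φ '' S a b := by
      intro F hF
      obtain ⟨g, hg, hgF⟩ := hF.mem.2
      have : padMatrix (homMatrix M m a b g) = F := by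
        rw [hgF]
        ext p i
        simp only [padMatrix, Matrix.of_apply, Matrix.submatrix_apply]
        split_ifs with h
        · rfl
        · by_contra hne
          have := hF.mem.1 p i (Ne.symm hne)
          exact h ⟨this.2, this.1⟩
      refine ⟨⟨g, hg⟩, ?_, this⟩
      simp only [S, Set.mem_ofPred_eq]
      rwa [this]
    have h3 := Submodule.span_mono h2 h1
    rw [Submodule.span_image] at h3
    obtain ⟨g, hg, hgf⟩ := h3
    rwa [← hΦ hgf]
  have hbasis : ∀ a b : J, ∃ B : Module.Basis (Fin (Module.finrank k (radical k a.1 b.1))) k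
      (radical k a.1 b.1), ∀ l, B l ∈ S a b := by
    intro a b
    let B₀ := Module.Basis.ofSpan (hS a b)
    have hfi := Module.Finite.finite_basis B₀
    have := Fintype.ofFinite ((linearIndepOn_empty k id).extend (Set.empty_subset (S a b)))
    let e := Fintype.equivFinOfCardEq (Module.finrank_eq_card_basis B₀).symm
    refine ⟨B₀.reindex e, fun l => ?_⟩
    rw [Module.Basis.reindex_apply]
    exact Module.Basis.ofSpan_subset (hS a b) ⟨_, rfl⟩
  choose Bf hBf using hbasis
  have hunit : ∀ a : J, ∀ i, IsUnit (s a (c a i)) := fun a i => (hs a _).isUnit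
  let B : PairBasis M J :=
    { m := fun a => (m a).isUnitSMul (hunit a)
      f := Bf }
  have hBm : ∀ a i, B.m a i = s a (c a i) • m a i := fun a i => by
    simp only [B, Module.Basis.isUnitSMul_apply]
  have hpad : ∀ a b l p i, padMatrix (homMatrix M m a b (Bf a b l)) (c b p) (c a i) =
      homMatrix M m a b (Bf a b l) p i := fun a b l p i => padMatrix_apply _ _ _ _ _
  have hexp : ∀ (a b : J) (f : a.1 ⟶ b.1) i, act M f (m a i) =
      ∑ p, homMatrix M m a b f p i • m b p := by
    intro a b f i
    simp only [homMatrix_apply]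
    exact ((m b).sum_repr _).symm
  -- the products
  have hprod : ∀ a b l i, B.prod (a := a) (b := b) l i = 0 ∨ ∃ p,
      homMatrix M m a b (Bf a b l) p i ≠ 0 ∧ B.prod (a := a) (b := b) l i = B.m b p := by
    intro a b l i
    have hn := hBf a b l
    have e1 : B.prod (a := a) (b := b) l i =
        ∑ p, (s a (c a i) * homMatrix M m a b (Bf a b l) p i) • m b p := by
      simp only [PairBasis.prod, hBm, map_smul]
      change s a (c a i) • act M (Bf a b l : a.1 ⟶ b.1) (m a i) = _
      rw [hexp, Finset.smul_sum]
      simp only [smul_smul]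
    by_cases h : ∀ p, homMatrix M m a b (Bf a b l) p i = 0
    · left
      rw [e1]
      exact Finset.sum_eq_zero fun p _ => by rw [h p, mul_zero, zero_smul]
    · push Not at h
      obtain ⟨p, hp⟩ := h
      right
      refine ⟨p, hp, ?_⟩
      rw [e1, Finset.sum_eq_single p, hBm]
      · congr 1
        have := hn.scale (c b p) (c a i) (by rwa [hpad])
        rwa [hpad] at this
      · intro q _ hq
        have : homMatrix M m a b (Bf a b l) q i = 0 := by
          by_contra hne
          apply hq
          have := hn.col (c b q) (c b p) (c a i) (by rwa [hpad]) (by rwa [hpad])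
          exact Fin.castLE_injective _ this
        rw [this, mul_zero, zero_smul]
      · exact fun h => absurd (Finset.mem_univ _) h
  -- ranks
  have hrk : ∀ a b l (T : Finset (Fin 3)), (∀ q j,
      padMatrix (homMatrix M m a b (Bf a b l)) q j ≠ 0 → q ∈ T) →
      rk M (Bf a b l : a.1 ⟶ b.1) ≤ T.card := by
    intro a b l T hT
    let T' : Finset (M.obj b.1) := Finset.image (α := Fin 3) (fun q =>
      if h : (q : ℕ) < Module.finrank k (M.obj b.1) then m b ⟨q, h⟩ else 0) T
    refine (rk_le_card M _ T' ?_).trans Finset.card_image_le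
    have : ∀ i, act M (Bf a b l : a.1 ⟶ b.1) (m a i) ∈
        Submodule.span k (T' : Set (M.obj b.1)) := by
      intro i
      rw [hexp]
      refine Submodule.sum_mem _ fun p _ => ?_
      by_cases h : homMatrix M m a b (Bf a b l) p i = 0
      · rw [h, zero_smul]; exact Submodule.zero_mem _
      · refine Submodule.smul_mem _ _ (Submodule.subset_span ?_)
        refine Finset.mem_coe.2 (Finset.mem_image.2 ⟨c b p, hT _ (c a i) (by rwa [hpad]), ?_⟩)
        exact dif_pos p.2
    intro x
    rw [← (m a).sum_repr x, map_sum]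
    exact Submodule.sum_mem _ fun i _ => by
      rw [map_smul]; exact Submodule.smul_mem _ _ (this i)
  have hrk2 : B.RankLE 2 := by
    intro a b l
    rcases (hBf a b l).shape with ⟨p, hp⟩ | ⟨⟨p, p', hp⟩, -⟩
    · exact (hrk a b l {p} fun q j h => by simp [hp q j h]).trans (by simp)
    · exact (hrk a b l {p, p'} fun q j h => by simpa using hp q j h).trans Finset.card_le_two
  have hJi := hJ.indecomposable
  refine ⟨B, ⟨⟨?_, ?_, ?_⟩, ?_⟩, hrk2⟩
  · intro a b l g h hgh
    change (Bf a b l : a.1 ⟶ b.1) = g + h at hgh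
    change rk M (Bf a b l : a.1 ⟶ b.1) ≤ _ ∨ rk M (Bf a b l : a.1 ⟶ b.1) ≤ _
    -- A summand outside the radical is invertible and hence acts with the largest possible rank.
    -- Thinness thus has to be tested only against radical summands.
    have hiso : ∀ g : a.1 ⟶ b.1, IsIso g → rk M (Bf a b l : a.1 ⟶ b.1) ≤ rk M g := by
      intro g hg
      have h1 : LinearMap.range (act M g) = ⊤ := by
        rw [LinearMap.range_eq_top]
        intro x
        refine ⟨act M (inv g) x, ?_⟩
        rw [act_comp_apply, IsIso.inv_hom_id, act_id]
        rfl
      rw [rk, rk, h1]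
      exact Submodule.finrank_mono le_top
    by_cases hg : IsIso g
    · exact Or.inl (hiso g hg)
    by_cases hh : IsIso h
    · exact Or.inr (hiso h hh)
    have hg' := (mem_radical_iff (k := k) (hJi _ a.2) (hJi _ b.2) g).2 hg
    have hh' := (mem_radical_iff (k := k) (hJi _ a.2) (hJi _ b.2) h).2 hh
    by_contra! hlt
    rcases (hBf a b l).shape with ⟨p, hp⟩ | ⟨-, hth⟩
    · have h1 := hrk a b l {p} fun q j h => by simp [hp q j h]
      rw [Finset.card_singleton] at h1
      have hg0 := eq_zero_of_rk_eq_zero M (f := g) (by omega)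
      have hh0 := eq_zero_of_rk_eq_zero M (f := h) (by omega)
      have : rk M g = rk M (Bf a b l : a.1 ⟶ b.1) := by
        rw [hgh, hh0, add_zero]
      omega
    · have h1 := hrk2 a b l
      change rk M (Bf a b l : a.1 ⟶ b.1) ≤ 2 at h1
      refine hth _ (padMatrix_mem hd ⟨g, hg', rfl⟩) _ (padMatrix_mem hd ⟨h, hh', rfl⟩) ?_
        (padMatrix_minors (homMatrix_minors M m (by omega)))
        (padMatrix_minors (homMatrix_minors M m (by omega)))
      rw [hgh, map_add, padMatrix_add]
  · intro a b l i
    rcases hprod a b l i with h | ⟨p, -, h⟩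
    -- A zero product still needs an index `p`, that is `M(b) ≠ 0`. This holds by faithfulness, as
    -- `b` is indecomposable.
    · by_cases hb : Module.finrank k (M.obj b.1) = 0
      · exact absurd (isZero_of_finrank_eq_zero M hb) (hJi b.1 b.2).1
      · exact ⟨0, ⟨0, Nat.pos_of_ne_zero hb⟩, by rw [h, zero_smul]⟩
    · exact ⟨1, p, by rw [h, one_smul]⟩
  · intro a b l i j p x y hx hy h1 h2
    have key : ∀ i (x : k), x ≠ 0 → B.prod (a := a) (b := b) l i = x • B.m b p →
        homMatrix M m a b (Bf a b l) p i ≠ 0 := by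
      intro i x hx h
      rcases hprod a b l i with h0 | ⟨q, hq, h0⟩
      · rw [h0] at h
        exact absurd h.symm (smul_ne_zero hx ((B.m b).ne_zero p))
      · rw [h0] at h
        have := congrArg (fun y => (B.m b).repr y q) h
        simp only [Module.Basis.repr_self, map_smul, Finsupp.smul_apply, Finsupp.single_eq_same,
          Finsupp.single_apply] at this
        have hpq : p = q := by
          by_contra hne
          rw [if_neg hne, smul_zero] at this
          exact one_ne_zero this
        rwa [hpq]
    have h3 := (hBf a b l).row (c b p) (c a i) (c a j) (by rw [hpad]; exact key i x hx h1)
      (by rw [hpad]; exact key j y hy h2)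
    exact Fin.castLE_injective _ h3
  · intro a b l i hne
    rcases hprod a b l i with h | ⟨p, -, h⟩
    · exact absurd h hne
    · exact ⟨p, h⟩

end Transfer

end Aggregate

/-! ### Ideals of `k[x,y]/(x³,y³)` and the monomials they contain. -/

namespace Aggregate

section ShiftIdeal

variable {k : Type u} [Field k]

/-- The shift of the rows of a `3 × 3` matrix. -/
def rowShift (f : Matrix (Fin 3) (Fin 3) k) : Matrix (Fin 3) (Fin 3) k :=
  !![0, 0, 0; f 0 0, f 0 1, f 0 2; f 1 0, f 1 1, f 1 2]

/-- The shift of the columns of a `3 × 3` matrix. -/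
def colShift (f : Matrix (Fin 3) (Fin 3) k) : Matrix (Fin 3) (Fin 3) k :=
  !![0, f 0 0, f 0 1; 0, f 1 0, f 1 1; 0, f 2 0, f 2 1]

/-- The matrix unit at `(u, p)` stands for the monomial `x^u y^p`; `rowShift` and `colShift` are
multiplication by `x` and `y`. If every other term of `h` vanishes or lies in `I`, so does the
remaining one. Later proofs apply this to multiples of `f`, starting from the highest degree. -/
theorem single_mem_of_lead {I : Submodule k (Matrix (Fin 3) (Fin 3) k)}
    (h : Matrix (Fin 3) (Fin 3) k) (hI : h ∈ I) (u p : Fin 3) (hne : h u p ≠ 0)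
    (hz : ∀ u' p', (u', p') ≠ (u, p) → h u' p' = 0 ∨ Matrix.single u' p' 1 ∈ I) :
    Matrix.single u p 1 ∈ I := by
  have h1 : ∀ u' p', (u', p') ≠ (u, p) → h u' p' • Matrix.single u' p' (1 : k) ∈ I := by
    intro u' p' hne
    rcases hz u' p' hne with h | h
    · rw [h, zero_smul]; exact I.zero_mem
    · exact I.smul_mem _ h
  have h2 : h = ∑ x : Fin 3 × Fin 3, h x.1 x.2 • Matrix.single x.1 x.2 (1 : k) := by
    conv_lhs => rw [Matrix.matrix_eq_sum_single h]
    rw [← Finset.univ_product_univ, Finset.sum_product]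
    simp
  have h3 : h - ∑ x ∈ Finset.univ.erase (u, p), h x.1 x.2 • Matrix.single x.1 x.2 (1 : k) =
      h u p • Matrix.single u p (1 : k) := by
    rw [sub_eq_iff_eq_add, Finset.add_sum_erase _ (fun x : Fin 3 × Fin 3 => h x.1 x.2 • Matrix.single x.1 x.2 (1 : k))
      (Finset.mem_univ (u, p))]
    exact h2
  have h4 : h u p • Matrix.single u p (1 : k) ∈ I := by
    rw [← h3]
    exact I.sub_mem hI (I.sum_mem fun x hx => h1 _ _ (Finset.ne_of_mem_erase hx))
  simpa [hne] using I.smul_mem (h u p)⁻¹ h4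

variable {I : Submodule k (Matrix (Fin 3) (Fin 3) k)}
  (hx : ∀ f ∈ I, rowShift f ∈ I) (hy : ∀ f ∈ I, colShift f ∈ I)

include hx hy

/-- Here `f` is a unit of the truncated polynomial ring, so the ideal is everything. -/
theorem single_mem_of_zero_zero {f} (hf : f ∈ I) (h00 : f 0 0 ≠ 0) :
    ∀ u p, Matrix.single u p (1 : k) ∈ I := by
  have e22 : Matrix.single 2 2 (1 : k) ∈ I := by
    refine single_mem_of_lead _ (hx _ (hx _ (hy _ (hy _ hf)))) 2 2
      h00 ?_
    intro u p hne
    fin_cases u <;> fin_cases p <;> first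
      | exact absurd rfl hne
      | exact Or.inl rfl
      | exact Or.inr (by assumption)
      | exact Or.inl (by assumption)
      | assumption
  have e21 : Matrix.single 2 1 (1 : k) ∈ I := by
    refine single_mem_of_lead _ (hx _ (hx _ (hy _ hf))) 2 1
      h00 ?_
    intro u p hne
    fin_cases u <;> fin_cases p <;> first
      | exact absurd rfl hne
      | exact Or.inl rfl
      | exact Or.inr (by assumption)
      | exact Or.inl (by assumption)
      | assumption
  have e12 : Matrix.single 1 2 (1 : k) ∈ I := by
    refine single_mem_of_lead _ (hx _ (hy _ (hy _ hf))) 1 2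
      h00 ?_
    intro u p hne
    fin_cases u <;> fin_cases p <;> first
      | exact absurd rfl hne
      | exact Or.inl rfl
      | exact Or.inr (by assumption)
      | exact Or.inl (by assumption)
      | assumption
  have e20 : Matrix.single 2 0 (1 : k) ∈ I := by
    refine single_mem_of_lead _ (hx _ (hx _ hf)) 2 0
      h00 ?_
    intro u p hne
    fin_cases u <;> fin_cases p <;> first
      | exact absurd rfl hne
      | exact Or.inl rfl
      | exact Or.inr (by assumption)
      | exact Or.inl (by assumption)
      | assumption
  have e11 : Matrix.single 1 1 (1 : k) ∈ I := by
    refine single_mem_of_lead _ (hx _ (hy _ hf)) 1 1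
      h00 ?_
    intro u p hne
    fin_cases u <;> fin_cases p <;> first
      | exact absurd rfl hne
      | exact Or.inl rfl
      | exact Or.inr (by assumption)
      | exact Or.inl (by assumption)
      | assumption
  have e02 : Matrix.single 0 2 (1 : k) ∈ I := by
    refine single_mem_of_lead _ (hy _ (hy _ hf)) 0 2
      h00 ?_
    intro u p hne
    fin_cases u <;> fin_cases p <;> first
      | exact absurd rfl hne
      | exact Or.inl rfl
      | exact Or.inr (by assumption)
      | exact Or.inl (by assumption)
      | assumption
  have e10 : Matrix.single 1 0 (1 : k) ∈ I := by
    refine single_mem_of_lead _ (hx _ hf) 1 0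
      h00 ?_
    intro u p hne
    fin_cases u <;> fin_cases p <;> first
      | exact absurd rfl hne
      | exact Or.inl rfl
      | exact Or.inr (by assumption)
      | exact Or.inl (by assumption)
      | assumption
  have e01 : Matrix.single 0 1 (1 : k) ∈ I := by
    refine single_mem_of_lead _ (hy _ hf) 0 1
      h00 ?_
    intro u p hne
    fin_cases u <;> fin_cases p <;> first
      | exact absurd rfl hne
      | exact Or.inl rfl
      | exact Or.inr (by assumption)
      | exact Or.inl (by assumption)
      | assumption
  have e00 : Matrix.single 0 0 (1 : k) ∈ I := by
    refine single_mem_of_lead _ hf 0 0 h00 ?_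
    intro u p hne
    fin_cases u <;> fin_cases p <;> first
      | exact absurd rfl hne
      | exact Or.inl rfl
      | exact Or.inr (by assumption)
      | exact Or.inl (by assumption)
      | assumption
  intro u p
  fin_cases u <;> fin_cases p <;> assumption

/-- The linear part of `f` is a nonzero multiple of `x`, and all proper multiples of `x` follow. The
monomial `y²` need not. -/
theorem single_mem_of_one_zero {f} (hf : f ∈ I) (h00 : f 0 0 = 0) (h01 : f 0 1 = 0)
    (h10 : f 1 0 ≠ 0) : Matrix.single 2 2 (1 : k) ∈ I ∧ Matrix.single 2 1 (1 : k) ∈ I ∧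
      Matrix.single 1 2 (1 : k) ∈ I ∧ Matrix.single 2 0 (1 : k) ∈ I ∧
      Matrix.single 1 1 (1 : k) ∈ I := by
  have e22 : Matrix.single 2 2 (1 : k) ∈ I := by
    refine single_mem_of_lead _ (hx _ (hy _ (hy _ hf))) 2 2
      h10 ?_
    intro u p hne
    fin_cases u <;> fin_cases p <;> first
      | exact absurd rfl hne
      | exact Or.inl rfl
      | exact Or.inr (by assumption)
      | exact Or.inl (by assumption)
      | assumption
  have e21 : Matrix.single 2 1 (1 : k) ∈ I := by
    refine single_mem_of_lead _ (hx _ (hy _ hf)) 2 1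
      h10 ?_
    intro u p hne
    fin_cases u <;> fin_cases p <;> first
      | exact absurd rfl hne
      | exact Or.inl rfl
      | exact Or.inr (by assumption)
      | exact Or.inl (by assumption)
      | assumption
  have e12 : Matrix.single 1 2 (1 : k) ∈ I := by
    refine single_mem_of_lead _ (hy _ (hy _ hf)) 1 2
      h10 ?_
    intro u p hne
    fin_cases u <;> fin_cases p <;> first
      | exact absurd rfl hne
      | exact Or.inl rfl
      | exact Or.inr (by assumption)
      | exact Or.inl (by assumption)
      | assumption
  have e20 : Matrix.single 2 0 (1 : k) ∈ I := by
    refine single_mem_of_lead _ (hx _ hf) 2 0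
      h10 ?_
    intro u p hne
    fin_cases u <;> fin_cases p <;> first
      | exact absurd rfl hne
      | exact Or.inl rfl
      | exact Or.inr (by assumption)
      | exact Or.inl (by assumption)
      | assumption
  have e11 : Matrix.single 1 1 (1 : k) ∈ I := by
    refine single_mem_of_lead _ (hy _ hf) 1 1
      h10 ?_
    intro u p hne
    fin_cases u <;> fin_cases p <;> first
      | exact absurd rfl hne
      | exact Or.inl rfl
      | exact Or.inr (by assumption)
      | exact Or.inl (by assumption)
      | assumption
  exact ⟨e22, e21, e12, e20, e11⟩

theorem single_mem_of_zero_one {f} (hf : f ∈ I) (h00 : f 0 0 = 0) (h10 : f 1 0 = 0)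
    (h01 : f 0 1 ≠ 0) : Matrix.single 2 2 (1 : k) ∈ I ∧ Matrix.single 1 2 (1 : k) ∈ I ∧
      Matrix.single 2 1 (1 : k) ∈ I ∧ Matrix.single 0 2 (1 : k) ∈ I ∧
      Matrix.single 1 1 (1 : k) ∈ I := by
  have e22 : Matrix.single 2 2 (1 : k) ∈ I := by
    refine single_mem_of_lead _ (hx _ (hx _ (hy _ hf))) 2 2
      h01 ?_
    intro u p hne
    fin_cases u <;> fin_cases p <;> first
      | exact absurd rfl hne
      | exact Or.inl rfl
      | exact Or.inr (by assumption)
      | exact Or.inl (by assumption)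
      | assumption
  have e21 : Matrix.single 1 2 (1 : k) ∈ I := by
    refine single_mem_of_lead _ (hx _ (hy _ hf)) 1 2
      h01 ?_
    intro u p hne
    fin_cases u <;> fin_cases p <;> first
      | exact absurd rfl hne
      | exact Or.inl rfl
      | exact Or.inr (by assumption)
      | exact Or.inl (by assumption)
      | assumption
  have e12 : Matrix.single 2 1 (1 : k) ∈ I := by
    refine single_mem_of_lead _ (hx _ (hx _ hf)) 2 1
      h01 ?_
    intro u p hne
    fin_cases u <;> fin_cases p <;> first
      | exact absurd rfl hne
      | exact Or.inl rfl
      | exact Or.inr (by assumption)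
      | exact Or.inl (by assumption)
      | assumption
  have e20 : Matrix.single 0 2 (1 : k) ∈ I := by
    refine single_mem_of_lead _ (hy _ hf) 0 2
      h01 ?_
    intro u p hne
    fin_cases u <;> fin_cases p <;> first
      | exact absurd rfl hne
      | exact Or.inl rfl
      | exact Or.inr (by assumption)
      | exact Or.inl (by assumption)
      | assumption
  have e11 : Matrix.single 1 1 (1 : k) ∈ I := by
    refine single_mem_of_lead _ (hx _ hf) 1 1
      h01 ?_
    intro u p hne
    fin_cases u <;> fin_cases p <;> first
      | exact absurd rfl hne
      | exact Or.inl rfl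
      | exact Or.inr (by assumption)
      | exact Or.inl (by assumption)
      | assumption
  exact ⟨e22, e21, e12, e20, e11⟩

/-- Both `x` and `y` occur in the linear part. Monomials of degree at least three are obtained, but
modulo these `xf` and `yf` give only two relations between `x²`, `xy` and `y²`; one of the three
must be known from elsewhere. -/
theorem single_mem_of_linear {f} (hf : f ∈ I) (h00 : f 0 0 = 0) (h10 : f 1 0 ≠ 0)
    (h01 : f 0 1 ≠ 0) : Matrix.single 2 2 (1 : k) ∈ I ∧ Matrix.single 1 2 (1 : k) ∈ I ∧
      Matrix.single 2 1 (1 : k) ∈ I ∧ ((Matrix.single 2 0 (1 : k) ∈ I ∨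
      Matrix.single 1 1 (1 : k) ∈ I ∨ Matrix.single 0 2 (1 : k) ∈ I) →
      Matrix.single 2 0 (1 : k) ∈ I ∧ Matrix.single 1 1 (1 : k) ∈ I ∧
      Matrix.single 0 2 (1 : k) ∈ I) := by
  have e22 : Matrix.single 2 2 (1 : k) ∈ I := by
    refine single_mem_of_lead _ (hx _ (hy _ (hy _ hf))) 2 2
      h10 ?_
    intro u p hne
    fin_cases u <;> fin_cases p <;> first
      | exact absurd rfl hne
      | exact Or.inl rfl
      | exact Or.inr (by assumption)
      | exact Or.inl (by assumption)
      | assumption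
  have e21 : Matrix.single 2 1 (1 : k) ∈ I := by
    refine single_mem_of_lead _ (hx _ (hx _ hf)) 2 1
      h01 ?_
    intro u p hne
    fin_cases u <;> fin_cases p <;> first
      | exact absurd rfl hne
      | exact Or.inl rfl
      | exact Or.inr (by assumption)
      | exact Or.inl (by assumption)
      | assumption
  have e12 : Matrix.single 1 2 (1 : k) ∈ I := by
    refine single_mem_of_lead _ (hy _ (hy _ hf)) 1 2
      h10 ?_
    intro u p hne
    fin_cases u <;> fin_cases p <;> first
      | exact absurd rfl hne
      | exact Or.inl rfl
      | exact Or.inr (by assumption)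
      | exact Or.inl (by assumption)
      | assumption
  refine ⟨e22, e12, e21, ?_⟩
  have h1 : Matrix.single 2 0 (1 : k) ∈ I → Matrix.single 1 1 (1 : k) ∈ I := fun e20 => by
    refine single_mem_of_lead _ (hx _ hf) 1 1 h01 ?_
    intro u p hne
    fin_cases u <;> fin_cases p <;> first
      | exact absurd rfl hne
      | exact Or.inl rfl
      | exact Or.inr (by assumption)
      | exact Or.inl (by assumption)
      | assumption
  have h2 : Matrix.single 1 1 (1 : k) ∈ I → Matrix.single 2 0 (1 : k) ∈ I := fun e11 => by
    refine single_mem_of_lead _ (hx _ hf) 2 0 h10 ?_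
    intro u p hne
    fin_cases u <;> fin_cases p <;> first
      | exact absurd rfl hne
      | exact Or.inl rfl
      | exact Or.inr (by assumption)
      | exact Or.inl (by assumption)
      | assumption
  have h3 : Matrix.single 1 1 (1 : k) ∈ I → Matrix.single 0 2 (1 : k) ∈ I := fun e11 => by
    refine single_mem_of_lead _ (hy _ hf) 0 2 h01 ?_
    intro u p hne
    fin_cases u <;> fin_cases p <;> first
      | exact absurd rfl hne
      | exact Or.inl rfl
      | exact Or.inr (by assumption)
      | exact Or.inl (by assumption)
      | assumption
  have h4 : Matrix.single 0 2 (1 : k) ∈ I → Matrix.single 1 1 (1 : k) ∈ I := fun e02 => by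
    refine single_mem_of_lead _ (hy _ hf) 1 1 h10 ?_
    intro u p hne
    fin_cases u <;> fin_cases p <;> first
      | exact absurd rfl hne
      | exact Or.inl rfl
      | exact Or.inr (by assumption)
      | exact Or.inl (by assumption)
      | assumption
  tauto

/-- With quadratic part `αx² + βxy + γy²`, the multiples `yf` and `xf` are `αx²y + βxy²` and `βx²y +
γxy²` up to `x²y²`, and these are dependent when `β² = αγ`. For this case `hline` supplies a second,
non-proportional quadratic part. -/
theorem single_mem_of_quadratic (hlow : ∀ f ∈ I, f 0 0 = 0 ∧ f 1 0 = 0 ∧ f 0 1 = 0)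
    (hline : (∃ f ∈ I, f 2 0 ≠ 0) → (∃ f ∈ I, f 1 1 ≠ 0) → (∃ f ∈ I, f 0 2 ≠ 0) →
      ∀ y₀ y₁ y₂ : k, ∃ f ∈ I, ∀ c, ¬ (f 2 0 = c * y₀ ∧ f 1 1 = c * y₁ ∧ f 0 2 = c * y₂))
    {f} (hf : f ∈ I) : (f 2 0 ≠ 0 → Matrix.single 2 1 (1 : k) ∈ I) ∧
      (f 1 1 ≠ 0 → Matrix.single 2 1 (1 : k) ∈ I ∧ Matrix.single 1 2 (1 : k) ∈ I) ∧
      (f 0 2 ≠ 0 → Matrix.single 1 2 (1 : k) ∈ I) ∧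
      (∀ u p, f u p ≠ 0 → (u, p) ≠ (2, 2) → Matrix.single 2 2 (1 : k) ∈ I) := by
  have e22a : ∀ f ∈ I, f 2 0 ≠ 0 ∨ f 1 1 ≠ 0 ∨ f 0 2 ≠ 0 → Matrix.single 2 2 (1 : k) ∈ I := by
    intro f hf h
    obtain ⟨h00, h10, h01⟩ := hlow f hf
    rcases h with h | h | h
    · refine single_mem_of_lead _ (hy _ (hy _ hf)) 2 2 h ?_
      intro u p hne
      fin_cases u <;> fin_cases p <;> first
        | exact absurd rfl hne
        | exact Or.inl rfl
        | exact Or.inr (by assumption)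
        | exact Or.inl (by assumption)
        | assumption
    · refine single_mem_of_lead _ (hx _ (hy _ hf)) 2 2 h ?_
      intro u p hne
      fin_cases u <;> fin_cases p <;> first
        | exact absurd rfl hne
        | exact Or.inl rfl
        | exact Or.inr (by assumption)
        | exact Or.inl (by assumption)
        | assumption
    · refine single_mem_of_lead _ (hx _ (hx _ hf)) 2 2 h ?_
      intro u p hne
      fin_cases u <;> fin_cases p <;> first
        | exact absurd rfl hne
        | exact Or.inl rfl
        | exact Or.inr (by assumption)
        | exact Or.inl (by assumption)
        | assumption
  have e21 : ∀ f ∈ I, f 2 0 ≠ 0 → f 1 1 = 0 ∨ Matrix.single 1 2 (1 : k) ∈ I →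
      Matrix.single 2 1 (1 : k) ∈ I := by
    intro f hf h h'
    obtain ⟨h00, h10, h01⟩ := hlow f hf
    have e22 := e22a f hf (Or.inl h)
    refine single_mem_of_lead _ (hy _ hf) 2 1 h ?_
    intro u p hne
    fin_cases u <;> fin_cases p <;> first
      | exact absurd rfl hne
      | exact Or.inl rfl
      | exact Or.inr (by assumption)
      | exact Or.inl (by assumption)
      | assumption
  have e21' : ∀ f ∈ I, f 1 1 ≠ 0 → f 0 2 = 0 ∨ Matrix.single 1 2 (1 : k) ∈ I →
      Matrix.single 2 1 (1 : k) ∈ I := by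
    intro f hf h h'
    obtain ⟨h00, h10, h01⟩ := hlow f hf
    have e22 := e22a f hf (Or.inr (Or.inl h))
    refine single_mem_of_lead _ (hx _ hf) 2 1 h ?_
    intro u p hne
    fin_cases u <;> fin_cases p <;> first
      | exact absurd rfl hne
      | exact Or.inl rfl
      | exact Or.inr (by assumption)
      | exact Or.inl (by assumption)
      | assumption
  have e12 : ∀ f ∈ I, f 0 2 ≠ 0 → f 1 1 = 0 ∨ Matrix.single 2 1 (1 : k) ∈ I →
      Matrix.single 1 2 (1 : k) ∈ I := by
    intro f hf h h'
    obtain ⟨h00, h10, h01⟩ := hlow f hf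
    have e22 := e22a f hf (Or.inr (Or.inr h))
    refine single_mem_of_lead _ (hx _ hf) 1 2 h ?_
    intro u p hne
    fin_cases u <;> fin_cases p <;> first
      | exact absurd rfl hne
      | exact Or.inl rfl
      | exact Or.inr (by assumption)
      | exact Or.inl (by assumption)
      | assumption
  have e12' : ∀ f ∈ I, f 1 1 ≠ 0 → f 2 0 = 0 ∨ Matrix.single 2 1 (1 : k) ∈ I →
      Matrix.single 1 2 (1 : k) ∈ I := by
    intro f hf h h'
    obtain ⟨h00, h10, h01⟩ := hlow f hf
    have e22 := e22a f hf (Or.inr (Or.inl h))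
    refine single_mem_of_lead _ (hy _ hf) 1 2 h ?_
    intro u p hne
    fin_cases u <;> fin_cases p <;> first
      | exact absurd rfl hne
      | exact Or.inl rfl
      | exact Or.inr (by assumption)
      | exact Or.inl (by assumption)
      | assumption
  have hmid : f 1 1 ≠ 0 → Matrix.single 2 1 (1 : k) ∈ I ∧ Matrix.single 1 2 (1 : k) ∈ I := by
    intro h11
    by_cases h02 : f 0 2 = 0
    · have := e21' f hf h11 (Or.inl h02)
      exact ⟨this, e12' f hf h11 (Or.inr this)⟩
    by_cases h20 : f 2 0 = 0
    · have := e12' f hf h11 (Or.inl h20)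
      exact ⟨e21' f hf h11 (Or.inr this), this⟩
    obtain ⟨g, hg, hgc⟩ := hline ⟨f, hf, h20⟩ ⟨f, hf, h11⟩ ⟨f, hf, h02⟩ (f 2 0) (f 1 1) (f 0 2)
    -- Cancelling the `xy` term leaves a form in `x²` and `y²` that is not zero, and a shift of it
    -- isolates a cubic monomial.
    let c := g 1 1 / f 1 1
    have hg' : g - c • f ∈ I := I.sub_mem hg (I.smul_mem c hf)
    have hg11 : (g - c • f) 1 1 = 0 := by
      simp [c, h11]
    by_cases h3 : (g - c • f) 2 0 = 0
    · by_cases h4 : (g - c • f) 0 2 = 0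
      · simp only [Matrix.sub_apply, Matrix.smul_apply, smul_eq_mul] at h3 h4 hg11
        exact absurd ⟨sub_eq_zero.1 h3, sub_eq_zero.1 hg11, sub_eq_zero.1 h4⟩ (hgc c)
      · have := e12 _ hg' h4 (Or.inl hg11)
        exact ⟨e21' f hf h11 (Or.inr this), this⟩
    · have := e21 _ hg' h3 (Or.inl hg11)
      exact ⟨this, e12' f hf h11 (Or.inr this)⟩
  refine ⟨?_, hmid, ?_, ?_⟩
  · intro h
    by_cases h11 : f 1 1 = 0
    · exact e21 f hf h (Or.inl h11)
    · exact (hmid h11).1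
  · intro h
    by_cases h11 : f 1 1 = 0
    · exact e12 f hf h (Or.inl h11)
    · exact (hmid h11).2
  · intro u p h hne
    by_cases h' : f 2 0 ≠ 0 ∨ f 1 1 ≠ 0 ∨ f 0 2 ≠ 0
    · exact e22a f hf h'
    push Not at h'
    obtain ⟨h20, h11, h02⟩ := h'
    obtain ⟨h00, h10, h01⟩ := hlow f hf
    by_cases h21 : f 2 1 = 0
    · have h12 : f 1 2 ≠ 0 := by
        intro h12
        fin_cases u <;> fin_cases p <;> first
          | exact hne rfl
          | (apply h; assumption)
      refine single_mem_of_lead _ (hx _ hf) 2 2 h12 ?_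
      intro u p hne
      fin_cases u <;> fin_cases p <;> first
        | exact absurd rfl hne
        | exact Or.inl rfl
        | exact Or.inr (by assumption)
        | exact Or.inl (by assumption)
        | assumption
    · refine single_mem_of_lead _ (hy _ hf) 2 2 h21 ?_
      intro u p hne
      fin_cases u <;> fin_cases p <;> first
        | exact absurd rfl hne
        | exact Or.inl rfl
        | exact Or.inr (by assumption)
        | exact Or.inl (by assumption)
        | assumption

/-- In a space of `3 × 3` matrices closed under both shifts, all positions beyond the support of a
member carry matrix units, up to two exceptions of low degree. -/
theorem single_mem_of_apply_ne_zero
    (hlin : (∃ f ∈ I, f 1 0 ≠ 0) → (∃ f ∈ I, f 0 1 ≠ 0) → (∀ f ∈ I, f 0 0 = 0) →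
      Matrix.single 2 1 (1 : k) ∈ I →
      Matrix.single 2 0 (1 : k) ∈ I ∨ Matrix.single 1 1 (1 : k) ∈ I ∨
        Matrix.single 0 2 (1 : k) ∈ I)
    (hline : (∀ f ∈ I, f 0 0 = 0 ∧ f 1 0 = 0 ∧ f 0 1 = 0) →
      (∃ f ∈ I, f 2 0 ≠ 0) → (∃ f ∈ I, f 1 1 ≠ 0) → (∃ f ∈ I, f 0 2 ≠ 0) →
      ∀ y₀ y₁ y₂ : k, ∃ f ∈ I, ∀ c, ¬ (f 2 0 = c * y₀ ∧ f 1 1 = c * y₁ ∧ f 0 2 = c * y₂))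
    {f} (hf : f ∈ I) {u p u' p' : Fin 3} (hne : f u p ≠ 0) (hu : u ≤ u') (hp : p ≤ p')
    (hup : (u', p') ≠ (u, p)) : Matrix.single u' p' (1 : k) ∈ I := by
  by_cases h00 : ∃ f ∈ I, f 0 0 ≠ 0
  · obtain ⟨f, hf, h⟩ := h00
    exact single_mem_of_zero_zero hx hy hf h u' p'
  push Not at h00
  by_cases h10 : ∃ f ∈ I, f 1 0 ≠ 0
  · by_cases h01 : ∃ f ∈ I, f 0 1 ≠ 0
    · have key : Matrix.single 2 2 (1 : k) ∈ I ∧ Matrix.single 1 2 (1 : k) ∈ I ∧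
          Matrix.single 2 1 (1 : k) ∈ I ∧ Matrix.single 2 0 (1 : k) ∈ I ∧
          Matrix.single 1 1 (1 : k) ∈ I ∧ Matrix.single 0 2 (1 : k) ∈ I := by
        obtain ⟨g, hg, hg1⟩ := h10
        obtain ⟨h, hh, hh1⟩ := h01
        have main : ∀ f ∈ I, f 1 0 ≠ 0 → f 0 1 ≠ 0 → _ := fun f hf h1 h2 =>
          single_mem_of_linear hx hy hf (h00 f hf) h1 h2
        have fin : ∀ f ∈ I, f 1 0 ≠ 0 → f 0 1 ≠ 0 → _ := fun f hf h1 h2 => by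
          obtain ⟨a1, a2, a3, a4⟩ := main f hf h1 h2
          obtain ⟨a5, a6, a7⟩ := a4 (hlin ⟨g, hg, hg1⟩ ⟨h, hh, hh1⟩ h00 a3)
          exact (show _ ∧ _ ∧ _ ∧ _ ∧ _ ∧ _ from ⟨a1, a2, a3, a5, a6, a7⟩)
        by_cases h2 : g 0 1 = 0
        · by_cases h3 : h 1 0 = 0
          · exact fin (g + h) (I.add_mem hg hh) (by simpa [h3] using hg1) (by simpa [h2] using hh1)
          · exact fin h hh h3 hh1
        · exact fin g hg hg1 h2
      obtain ⟨a1, a2, a3, a4, a5, a6⟩ := key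
      have h00f := h00 f hf
      fin_cases u <;> fin_cases p <;> fin_cases u' <;> fin_cases p' <;>
        first
          | exact absurd h00f hne
          | exact absurd rfl hup
          | exact absurd hu (by decide)
          | exact absurd hp (by decide)
          | assumption
    · push Not at h01
      obtain ⟨g, hg, hg1⟩ := h10
      obtain ⟨a1, a2, a3, a4, a5⟩ := single_mem_of_one_zero hx hy hg (h00 g hg) (h01 g hg) hg1
      have h00f := h00 f hf
      have h01f := h01 f hf
      fin_cases u <;> fin_cases p <;> fin_cases u' <;> fin_cases p' <;>
        first
          | exact absurd h00f hne
          | exact absurd h01f hne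
          | exact absurd rfl hup
          | exact absurd hu (by decide)
          | exact absurd hp (by decide)
          | assumption
  · push Not at h10
    by_cases h01 : ∃ f ∈ I, f 0 1 ≠ 0
    · obtain ⟨g, hg, hg1⟩ := h01
      obtain ⟨a1, a2, a3, a4, a5⟩ := single_mem_of_zero_one hx hy hg (h00 g hg) (h10 g hg) hg1
      have h00f := h00 f hf
      have h10f := h10 f hf
      fin_cases u <;> fin_cases p <;> fin_cases u' <;> fin_cases p' <;>
        first
          | exact absurd h00f hne
          | exact absurd h10f hne
          | exact absurd rfl hup
          | exact absurd hu (by decide)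
          | exact absurd hp (by decide)
          | assumption
    · push Not at h01
      have hlow : ∀ f ∈ I, f 0 0 = 0 ∧ f 1 0 = 0 ∧ f 0 1 = 0 :=
        fun f hf => ⟨h00 f hf, h10 f hf, h01 f hf⟩
      obtain ⟨a1, a2, a3, a4⟩ := single_mem_of_quadratic hx hy hlow (hline hlow) hf
      obtain ⟨h1, h2, h3⟩ := hlow f hf
      fin_cases u <;> fin_cases p <;> fin_cases u' <;> fin_cases p' <;>
        first
          | exact absurd h1 hne
          | exact absurd h2 hne
          | exact absurd h3 hne
          | exact absurd rfl hup
          | exact absurd hu (by decide)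
          | exact absurd hp (by decide)
          | exact a4 _ _ hne (by decide)
          | exact a1 hne
          | exact (a2 hne).1
          | exact (a2 hne).2
          | exact a3 hne

end ShiftIdeal

end Aggregate

/-! ### The partial order on basis vectors and its incomparable elements. -/

namespace Aggregate

namespace RadicalModel

variable {k : Type u} [Field k] {J : Type w} (𝓜 : RadicalModel k J)

/-- The basis vector `s` is mapped to a vector involving the basis vector `t` by some radical
morphism. -/
def lt (s t : J × Fin 3) : Prop := ∃ F ∈ 𝓜.R s.1 t.1, F t.2 s.2 ≠ 0

variable {𝓜}

theorem lt_of_ne_zero {a b : J} {F} (hF : F ∈ 𝓜.R a b) {p i : Fin 3} (h : F p i ≠ 0) :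
    𝓜.lt (a, i) (b, p) := ⟨F, hF, h⟩

theorem eq_zero_of_not_lt {a b : J} {F} (hF : F ∈ 𝓜.R a b) {p i : Fin 3}
    (h : ¬ 𝓜.lt (a, i) (b, p)) : F p i = 0 := by
  by_contra hne
  exact h ⟨F, hF, hne⟩

theorem lt_valid {s t : J × Fin 3} (h : 𝓜.lt s t) :
    (s.2 : ℕ) < 𝓜.d s.1 ∧ (t.2 : ℕ) < 𝓜.d t.1 := by
  obtain ⟨F, hF, hne⟩ := h
  exact 𝓜.supp hF hne

theorem lt_irrefl (s : J × Fin 3) : ¬ 𝓜.lt s s := by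
  rintro ⟨F, hF, hne⟩
  exact absurd (𝓜.lower hF hne) (_root_.lt_irrefl _)

theorem lt_index {a : J} {i p : Fin 3} (h : 𝓜.lt (a, i) (a, p)) : i < p := by
  obtain ⟨F, hF, hne⟩ := h
  exact 𝓜.lower hF hne

/-- Precomposition with the shift endomorphism of `a`. Its truncation at `d a` is harmless, since
columns beyond `d a` vanish anyway. -/
theorem colStep_mem {a b : J} {F} (hF : F ∈ 𝓜.R a b) :
    !![F 0 1, F 0 2, 0; F 1 1, F 1 2, 0; F 2 1, F 2 2, 0] ∈ 𝓜.R a b := by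
  convert 𝓜.mul_mem (𝓜.shift_mem a) hF using 1
  have h1 : ∀ p, ¬ 1 < 𝓜.d a → F p 1 = 0 := fun p h => by
    by_contra hne
    exact h (𝓜.supp hF hne).1
  have h2 : ∀ p, ¬ 2 < 𝓜.d a → F p 2 = 0 := fun p h => by
    by_contra hne
    exact h (𝓜.supp hF hne).1
  ext p i
  simp only [Matrix.mul_apply, Fin.sum_univ_three, Matrix.of_apply]
  by_cases g1 : 1 < 𝓜.d a
  · by_cases g2 : 2 < 𝓜.d a
    · fin_cases p <;> fin_cases i <;> simp [g1, g2]
    · fin_cases p <;> fin_cases i <;> simp [g1, g2, h2]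
  · have g2 : ¬ 2 < 𝓜.d a := by omega
    fin_cases p <;> fin_cases i <;> simp [g1, g2, h1, h2]

theorem rowStep_mem {a b : J} {F} (hF : F ∈ 𝓜.R a b) :
    (Matrix.of fun p i : Fin 3 =>
      if h : 0 < (p : ℕ) ∧ (p : ℕ) < 𝓜.d b then F ⟨(p : ℕ) - 1, by omega⟩ i else 0) ∈
      𝓜.R a b := by
  convert 𝓜.mul_mem hF (𝓜.shift_mem b) using 1
  ext p i
  simp only [Matrix.mul_apply, Fin.sum_univ_three, Matrix.of_apply]
  by_cases g1 : 1 < 𝓜.d b <;> by_cases g2 : 2 < 𝓜.d b <;>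
    fin_cases p <;> simp [g1, g2]

theorem lt_pred {a b : J} {i p : Fin 3} (h : 𝓜.lt (a, i) (b, p)) {j : Fin 3} (hj : j ≤ i) :
    𝓜.lt (a, j) (b, p) := by
  have step : ∀ i j : Fin 3, (i : ℕ) = j + 1 → 𝓜.lt (a, i) (b, p) → 𝓜.lt (a, j) (b, p) := by
    rintro i j hij ⟨F, hF, hne⟩
    refine ⟨_, colStep_mem hF, ?_⟩
    fin_cases i <;> fin_cases j <;> simp at hij <;> fin_cases p <;> exact hne
  have h01 := step 1 0 rfl
  have h12 := step 2 1 rfl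
  fin_cases i <;> fin_cases j <;> first
    | exact h
    | exact absurd hj (by decide)
    | exact h01 h
    | exact h12 h
    | exact h01 (h12 h)

theorem lt_succ {a b : J} {i p : Fin 3} (h : 𝓜.lt (a, i) (b, p)) {q : Fin 3} (hq : p ≤ q)
    (hv : (q : ℕ) < 𝓜.d b) : 𝓜.lt (a, i) (b, q) := by
  have step : ∀ p q : Fin 3, (q : ℕ) = p + 1 → (q : ℕ) < 𝓜.d b → 𝓜.lt (a, i) (b, p) →
      𝓜.lt (a, i) (b, q) := by
    rintro p q hpq hv ⟨F, hF, hne⟩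
    refine ⟨_, rowStep_mem hF, ?_⟩
    simp only [Matrix.of_apply]
    rw [dif_pos ⟨by omega, hv⟩]
    convert hne using 2
    exact Fin.ext (by simp only; omega)
  have h01 := step 0 1 rfl
  have h12 := step 1 2 rfl
  fin_cases p <;> fin_cases q <;> first
    | exact h
    | exact absurd hq (by decide)
    | exact h01 hv h
    | exact h12 hv h
    | exact h12 hv (h01 (lt_of_le_of_lt (by decide) hv) h)

theorem lt_of_index {a : J} {i p : Fin 3} (h : i < p) (hv : (p : ℕ) < 𝓜.d a) :
    𝓜.lt (a, i) (a, p) := by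
  have step : ∀ i p : Fin 3, (p : ℕ) = i + 1 → (p : ℕ) < 𝓜.d a → 𝓜.lt (a, i) (a, p) := by
    intro i p hip hv
    refine ⟨_, 𝓜.shift_mem a, ?_⟩
    simp [hip, hip ▸ hv]
  have hp : (i : ℕ) + 1 < 3 := by omega
  exact lt_succ (step i ⟨i + 1, hp⟩ rfl (by simp only; omega)) (by
    rw [Fin.le_def]; simp only; omega) hv

/-- Cancellation in the product of the two matrices has to be excluded. With the help of the shifts
one arranges that column `i` of `F` begins, and row `r` of `G` ends, at the same index `q`; the
relevant entry of `G * F` is then a single nonzero product. -/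
theorem lt_trans {s t r : J × Fin 3} (hst : 𝓜.lt s t) (htr : 𝓜.lt t r) : 𝓜.lt s r := by
  classical
  obtain ⟨a, i⟩ := s
  obtain ⟨b, p⟩ := t
  obtain ⟨c, r⟩ := r
  -- the last index `q` with `(b, q) < (c, r)`
  obtain ⟨q, hq, hqmax⟩ : ∃ q, 𝓜.lt (b, q) (c, r) ∧ ∀ q', q < q' → ¬ 𝓜.lt (b, q') (c, r) := by
    by_cases h2 : 𝓜.lt (b, 2) (c, r)
    · exact ⟨2, h2, fun q' h => absurd h (by omega)⟩
    by_cases h1 : 𝓜.lt (b, 1) (c, r)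
    · refine ⟨1, h1, fun q' h => ?_⟩
      have : q' = 2 := by omega
      rwa [this]
    · refine ⟨p, htr, fun q' h => ?_⟩
      have : q' = 2 ∨ q' = 1 := by omega
      rcases this with rfl | rfl <;> assumption
  have hpq : p ≤ q := by
    by_contra h
    exact hqmax p (by omega) htr
  have hv := (lt_valid hq).1
  simp only at hv
  have hq' := lt_succ hst hpq hv
  -- a matrix whose first nonzero entry in column `i` is in row `q`
  obtain ⟨F, hF, hne, hz⟩ : ∃ F ∈ 𝓜.R a b, F q i ≠ 0 ∧ ∀ q' < q, F q' i = 0 := by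
    have aux : ∀ n : ℕ, ∀ q : Fin 3, (q : ℕ) = n → (q : ℕ) < 𝓜.d b → 𝓜.lt (a, i) (b, q) →
        ∃ F ∈ 𝓜.R a b, F q i ≠ 0 ∧ ∀ q' < q, F q' i = 0 := by
      intro n
      induction n with
      | zero =>
        rintro q hq hv ⟨F, hF, hne⟩
        exact ⟨F, hF, hne, fun q' h => absurd h (by omega)⟩
      | succ n ih =>
        rintro q hq hv ⟨F, hF, hne⟩
        by_cases hz : ∀ q' < q, F q' i = 0
        · exact ⟨F, hF, hne, hz⟩
        push Not at hz
        obtain ⟨q', hq', hne'⟩ := hz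
        have hn : n < 3 := by omega
        obtain ⟨G, hG, hG1, hG2⟩ := ih ⟨n, hn⟩ rfl (by simp only; omega)
          (lt_succ (lt_of_ne_zero hF hne') (by rw [Fin.lt_def] at hq'; rw [Fin.le_def]; simp only; omega) (by simp only; omega))
        refine ⟨_, rowStep_mem hG, ?_, ?_⟩
        · simp only [Matrix.of_apply]
          rw [dif_pos ⟨by omega, hv⟩]
          convert hG1 using 2
          exact Fin.ext (by simp only; omega)
        · intro q'' hq''
          simp only [Matrix.of_apply]
          split_ifs with h
          · exact hG2 _ (by rw [Fin.lt_def] at hq'' ⊢; simp only; omega)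
          · rfl
    exact aux q q rfl hv hq'
  obtain ⟨G, hG, hGne⟩ := hq
  refine ⟨G * F, 𝓜.mul_mem hF hG, ?_⟩
  change (G * F) r i ≠ 0
  rw [Matrix.mul_apply, Finset.sum_eq_single q]
  · exact mul_ne_zero hGne hne
  · intro q' _ hq'
    rcases lt_or_gt_of_ne hq' with h | h
    · rw [hz q' h, mul_zero]
    · rw [eq_zero_of_not_lt hG (hqmax q' h), zero_mul]
  · exact fun h => absurd (Finset.mem_univ _) h

theorem lt_asymm {s t : J × Fin 3} (h : 𝓜.lt s t) : ¬ 𝓜.lt t s :=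
  fun h' => lt_irrefl s (lt_trans h h')

variable (𝓜)

/-- Incomparable basis vectors. -/
def Incomp (s t : J × Fin 3) : Prop := ¬ 𝓜.lt s t ∧ ¬ 𝓜.lt t s

/-- A preorder for which the elements of `lt` are strictly increasing. -/
structure IsCompatible (P : J × Fin 3 → J × Fin 3 → Prop) : Prop where
  refl : ∀ s, P s s
  trans : ∀ s t r, P s t → P t r → P s r
  of_lt : ∀ s t, 𝓜.lt s t → P s t
  not_of_lt : ∀ s t, 𝓜.lt s t → ¬ P t s

/-- The order generated by `lt`. -/
def le (s t : J × Fin 3) : Prop := s = t ∨ 𝓜.lt s t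

/-- The preorder obtained from `P` by making `x` and `y` equivalent. -/
def glue (P : J × Fin 3 → J × Fin 3 → Prop) (x y s t : J × Fin 3) : Prop :=
  P s t ∨ (P s x ∧ P y t) ∨ (P s y ∧ P x t)

variable {𝓜}

theorem isCompatible_le : 𝓜.IsCompatible 𝓜.le where
  refl s := Or.inl rfl
  trans := by
    rintro s t r (rfl | h) (rfl | h')
    · exact Or.inl rfl
    · exact Or.inr h'
    · exact Or.inr h
    · exact Or.inr (lt_trans h h')
  of_lt s t h := Or.inr h
  not_of_lt := by
    rintro s t h (rfl | h')
    · exact lt_irrefl _ h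
    · exact lt_asymm h h'

/-- A strict relation reversed through the identification of `x` and `y` would force `P x y` or `P y
x`. Gluing is what allows incomparable vectors to be placed at one level of the Tits form. -/
theorem IsCompatible.glue {P} (hP : 𝓜.IsCompatible P) {x y : J × Fin 3} (hxy : ¬ P x y)
    (hyx : ¬ P y x) : 𝓜.IsCompatible (glue P x y) where
  refl s := Or.inl (hP.refl s)
  trans := by
    have T := hP.trans
    rintro s t r (h | ⟨h1, h2⟩ | ⟨h1, h2⟩) (h' | ⟨h3, h4⟩ | ⟨h3, h4⟩)
    · exact Or.inl (T _ _ _ h h')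
    · exact Or.inr (Or.inl ⟨T _ _ _ h h3, h4⟩)
    · exact Or.inr (Or.inr ⟨T _ _ _ h h3, h4⟩)
    · exact Or.inr (Or.inl ⟨h1, T _ _ _ h2 h'⟩)
    · exact Or.inr (Or.inl ⟨h1, h4⟩)
    · exact Or.inl (T _ _ _ h1 h4)
    · exact Or.inr (Or.inr ⟨h1, T _ _ _ h2 h'⟩)
    · exact Or.inl (T _ _ _ h1 h4)
    · exact Or.inr (Or.inr ⟨h1, h4⟩)
  of_lt s t h := Or.inl (hP.of_lt s t h)
  not_of_lt := by
    have T := hP.trans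
    rintro s t h (h' | ⟨h1, h2⟩ | ⟨h1, h2⟩)
    · exact hP.not_of_lt s t h h'
    · exact hyx (T _ _ _ h2 (T _ _ _ (hP.of_lt s t h) h1))
    · exact hxy (T _ _ _ h2 (T _ _ _ (hP.of_lt s t h) h1))

/-- The inequality for the Tits form, with groups of equivalent elements for a compatible
preorder. -/
theorem tits_of_isCompatible {P} (hP : 𝓜.IsCompatible P) {m n r : ℕ}
    (o : Fin m → J) (ho : Function.Injective o)
    (obj : Fin n → Fin m) (pos : Fin n → Fin 3) (hpos : ∀ q, (pos q : ℕ) < 𝓜.d (o (obj q)))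
    (g : Fin n → Fin r) (hinj : ∀ q q', obj q = obj q' → pos q = pos q' → q = q')
    (hg : ∀ q q', g q = g q' → P (o (obj q), pos q) (o (obj q'), pos q'))
    (x : Fin m → ℕ) (v : Fin r → ℕ) (hv : ∀ ℓ, v ℓ ≤ ∑ q with g q = ℓ, x (obj q))
    (hq : ∑ ℓ, v ℓ ^ 2 + ∑ t, x t ^ 2 ≤ ∑ q, v (g q) * x (obj q)) (hv0 : ∃ ℓ, v ℓ ≠ 0) :
    False := by
  classical
  let el : Fin n → J × Fin 3 := fun q => (o (obj q), pos q)
  -- The number of vectors lying below a group. It increases strictly along `lt`, so sorting the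
  -- groups by it gives the linear arrangement required by `tits`.
  let ht : Fin r → ℕ := fun ℓ => Finset.card
    {s : Fin m × Fin 3 | ∃ q, g q = ℓ ∧ P (o s.1, s.2) (el q)}
  have hht : ∀ q q', 𝓜.lt (el q') (el q) → ht (g q') < ht (g q) := by
    intro q q' h
    apply Finset.card_lt_card
    rw [Finset.ssubset_iff_of_subset]
    · refine ⟨(obj q, pos q), ?_, ?_⟩
      · simp only [Finset.mem_filter_univ]
        exact ⟨q, rfl, hP.refl _⟩
      · simp only [Finset.mem_filter_univ, not_exists, not_and]
        intro q'' hq'' h'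
        exact hP.not_of_lt _ _ h (hP.trans _ _ _ h' (hg _ _ hq''))
    · intro s hs
      simp only [Finset.mem_filter_univ] at hs ⊢
      obtain ⟨q'', hq'', h'⟩ := hs
      exact ⟨q, rfl, hP.trans _ _ _ (hP.trans _ _ _ h' (hg _ _ hq'')) (hP.of_lt _ _ h)⟩
  let σ : Equiv.Perm (Fin r) := Tuple.sort ht
  have hσ : Monotone (ht ∘ σ) := Tuple.monotone_sort ht
  refine 𝓜.tits o ho (fun s t => 𝓜.lt (o s.1, s.2) (o t.1, t.2)) (fun s t u => lt_trans)
    (fun t t' F hF p i h => ⟨F, hF, h⟩) obj pos hpos (fun q => σ.symm (g q)) hinj ?_ x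
    (fun ℓ => v (σ ℓ)) ?_ ?_ ?_
  · intro q q' h h'
    have h1 := hσ h
    simp only [Function.comp_apply, Equiv.apply_symm_apply] at h1
    have h2 := hht q q' h'
    omega
  · intro ℓ
    refine (hv (σ ℓ)).trans (le_of_eq ?_)
    refine Finset.sum_congr ?_ fun _ _ => rfl
    ext q
    simp only [Finset.mem_filter_univ]
    exact (Equiv.symm_apply_eq σ).symm
  · have e1 : ∑ ℓ, v (σ ℓ) ^ 2 = ∑ ℓ, v ℓ ^ 2 := Equiv.sum_comp σ fun ℓ => v ℓ ^ 2
    simp only [Equiv.apply_symm_apply]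
    rw [e1]
    exact hq
  · obtain ⟨ℓ, hℓ⟩ := hv0
    exact ⟨σ.symm ℓ, by simpa using hℓ⟩

theorem not_le_of_incomp {s t : J × Fin 3} (hne : s.1 ≠ t.1) (h : 𝓜.Incomp s t) :
    ¬ 𝓜.le s t ∧ ¬ 𝓜.le t s :=
  ⟨fun h' => h'.elim (fun e => hne (congrArg Prod.fst e)) h.1,
    fun h' => h'.elim (fun e => hne (congrArg Prod.fst e).symm) h.2⟩

/-- Vectors belonging to different objects of dimension three are comparable. -/
theorem not_incomp_of_three {a b : J} (hab : a ≠ b) (ha : 𝓜.d a = 3) (hb : 𝓜.d b = 3)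
    (i p : Fin 3) : ¬ 𝓜.Incomp (a, i) (b, p) := by
  intro h
  obtain ⟨h1, h2⟩ := not_le_of_incomp hab h
  have hP := isCompatible_le.glue h1 h2
  -- The two incomparable vectors share a group with two columns, the other four vectors have one
  -- column each, and each object occurs twice: `8 + 8 = 16`.
  refine tits_of_isCompatible hP (m := 2) (n := 6) (r := 5) ![a, b] ?_ ![0, 0, 0, 1, 1, 1]
    ![i, i + 1, i + 2, p, p + 1, p + 2] ?_ ![0, 1, 2, 0, 3, 4] ?_ ?_ ![2, 2] ![2, 1, 1, 1, 1]
    (by decide) (by decide) ⟨0, by decide⟩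
  · intro s t h
    fin_cases s <;> fin_cases t <;> simp_all
  · intro q
    fin_cases q <;> simp [ha, hb]
  · intro q q'
    clear h h1 h2 hP
    revert q q' i p
    decide
  · intro q q' h
    have r1 : glue 𝓜.le (a, i) (b, p) (a, i) (b, p) :=
      Or.inr (Or.inl ⟨Or.inl rfl, Or.inl rfl⟩)
    have r2 : glue 𝓜.le (a, i) (b, p) (b, p) (a, i) :=
      Or.inr (Or.inr ⟨Or.inl rfl, Or.inl rfl⟩)
    fin_cases q <;> fin_cases q' <;> first
      | exact absurd h (by decide)
      | exact hP.refl _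
      | exact r1
      | exact r2

/-- Two pairs of vectors of different objects cannot be incomparable in order. -/
theorem not_incomp_pair {a c : J} (hac : a ≠ c) {i j l m : Fin 3} (hij : i < j) (hlm : l < m)
    (hj : (j : ℕ) < 𝓜.d a) (hm : (m : ℕ) < 𝓜.d c) (h1 : 𝓜.Incomp (a, i) (c, l))
    (h2 : 𝓜.Incomp (a, j) (c, m)) : False := by
  have hi : (i : ℕ) < 𝓜.d a := by omega
  have hl : (l : ℕ) < 𝓜.d c := by omega
  -- Two groups of two vectors with all multiplicities one: `2 + 2 = 4`.
  refine 𝓜.tits (m := 2) (n := 4) (r := 2) ![a, c] ?_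
    (fun s t => 𝓜.lt (![a, c] s.1, s.2) (![a, c] t.1, t.2)) (fun s t u => lt_trans)
    (fun t t' F hF p i h => ⟨F, hF, h⟩) ![0, 1, 0, 1] ![i, l, j, m] ?_ ![0, 0, 1, 1] ?_ ?_
    ![1, 1] ![1, 1] (by decide) (by decide) ⟨0, by decide⟩
  · intro s t h
    fin_cases s <;> fin_cases t <;> simp_all
  · intro q
    fin_cases q <;> assumption
  · intro q q' h h'
    have := hij.ne
    have := hlm.ne
    fin_cases q <;> fin_cases q' <;> simp_all
  · have g1 : ¬ 𝓜.lt (a, j) (a, i) := fun h => absurd (lt_index h) (by omega)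
    have g2 : ¬ 𝓜.lt (c, m) (c, l) := fun h => absurd (lt_index h) (by omega)
    have g3 : ¬ 𝓜.lt (a, j) (c, l) := fun h => h1.1 (lt_pred h hij.le)
    have g4 : ¬ 𝓜.lt (c, m) (a, i) := fun h => h1.2 (lt_pred h hlm.le)
    intro q q' h
    fin_cases q <;> fin_cases q' <;> first
      | exact absurd h (by decide)
      | exact lt_irrefl _
      | exact g1
      | exact g2
      | exact g3
      | exact g4
      | exact h1.1
      | exact h1.2
      | exact h2.1
      | exact h2.2

/-- Both incomparable pairs are glued, one after the other. After the first gluing, a relation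
between the second pair could only arise from `lt (c', x') (c, x)`, which `hlt` excludes. -/
theorem incomp_aux {b c c' : J} (hc : 𝓜.d c = 2) (hc' : 𝓜.d c' = 2) (hb : 𝓜.d b = 3)
    (hcc : c ≠ c') {x x' p p' : Fin 3} (hx : (x : ℕ) < 2) (hx' : (x' : ℕ) < 2) (hpp : p < p')
    (h1 : 𝓜.Incomp (c, x) (b, p)) (h2 : 𝓜.Incomp (c', x') (b, p'))
    (hlt : ¬ 𝓜.lt (c', x') (c, x)) : False := by
  have hbc : b ≠ c := fun h => by rw [h, hc] at hb; omega
  have hbc' : b ≠ c' := fun h => by rw [h, hc'] at hb; omega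
  have hv : ∀ y : Fin 3, (y : ℕ) < 𝓜.d b := fun y => by rw [hb]; exact y.2
  have hpp' : 𝓜.lt (b, p) (b, p') := lt_of_index hpp (hv _)
  obtain ⟨n1, n2⟩ := not_le_of_incomp hbc.symm h1
  have hP := isCompatible_le.glue n1 n2
  have hne : ∀ {s t : J × Fin 3}, s.1 ≠ t.1 → ¬ 𝓜.lt s t → ¬ 𝓜.le s t :=
    fun h h' e => e.elim (fun e => h (congrArg Prod.fst e)) h'
  have k1 : ¬ glue 𝓜.le (c, x) (b, p) (c', x') (b, p') := by
    rintro (h | ⟨h, -⟩ | ⟨h, -⟩)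
    · exact hne hbc'.symm h2.1 h
    · exact hne hcc.symm hlt h
    · exact hne hbc'.symm (fun h => h2.1 (lt_trans h hpp')) h
  have k2 : ¬ glue 𝓜.le (c, x) (b, p) (b, p') (c', x') := by
    rintro (h | ⟨h, -⟩ | ⟨h, -⟩)
    · exact hne hbc' h2.2 h
    · exact hne hbc (fun h => h1.2 (lt_trans hpp' h)) h
    · rcases h with h | h
      · exact hpp.ne' (congrArg Prod.snd h)
      · exact absurd (lt_index h) (by omega)
  have hP' := hP.glue k1 k2
  obtain ⟨y, hy, hxy⟩ : ∃ y : Fin 3, (y : ℕ) < 2 ∧ x ≠ y := by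
    by_cases h : x = 0
    · exact ⟨1, by decide, by omega⟩
    · exact ⟨0, by decide, h⟩
  obtain ⟨y', hy', hxy'⟩ : ∃ y : Fin 3, (y : ℕ) < 2 ∧ x' ≠ y := by
    by_cases h : x' = 0
    · exact ⟨1, by decide, by omega⟩
    · exact ⟨0, by decide, h⟩
  obtain ⟨q, hq1, hq2⟩ : ∃ q : Fin 3, q ≠ p ∧ q ≠ p' := by
    have : ∀ p p' : Fin 3, ∃ q : Fin 3, q ≠ p ∧ q ≠ p' := by decide
    exact this p p'
  -- The Tits form vanishes: `(9 + 9 + 4 + 1 + 1) + (16 + 4 + 4) = 48`, and the mixed terms also sum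
  -- to 48.
  refine tits_of_isCompatible hP' (m := 3) (n := 7) (r := 5) ![b, c, c'] ?_
    ![0, 0, 0, 1, 1, 2, 2] ![p, p', q, x, y, x', y'] ?_ ![0, 1, 2, 0, 3, 1, 4] ?_ ?_
    ![4, 2, 2] ![3, 3, 2, 1, 1] (by decide) (by decide) ⟨0, by decide⟩
  · intro s t h
    fin_cases s <;> fin_cases t <;> first
      | rfl
      | exact absurd h hbc
      | exact absurd h hbc'
      | exact absurd h hcc
      | exact absurd h hbc.symm
      | exact absurd h hbc'.symm
      | exact absurd h hcc.symm
  · intro t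
    fin_cases t <;> first
      | exact hv _
      | (change (_ : ℕ) < 𝓜.d c; rw [hc]; assumption)
      | (change (_ : ℕ) < 𝓜.d c'; rw [hc']; assumption)
  · intro t t' h h'
    have := hpp.ne
    fin_cases t <;> fin_cases t' <;> first
      | rfl
      | exact absurd h (by decide)
      | exact absurd h' this
      | exact absurd h' this.symm
      | exact absurd h' hq1
      | exact absurd h' hq1.symm
      | exact absurd h' hq2
      | exact absurd h' hq2.symm
      | exact absurd h' hxy
      | exact absurd h' hxy.symm
      | exact absurd h' hxy'
      | exact absurd h' hxy'.symm
  · have r1 : glue (glue 𝓜.le (c, x) (b, p)) (c', x') (b, p') (c, x) (b, p) :=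
      Or.inl (Or.inr (Or.inl ⟨Or.inl rfl, Or.inl rfl⟩))
    have r2 : glue (glue 𝓜.le (c, x) (b, p)) (c', x') (b, p') (b, p) (c, x) :=
      Or.inl (Or.inr (Or.inr ⟨Or.inl rfl, Or.inl rfl⟩))
    have r3 : glue (glue 𝓜.le (c, x) (b, p)) (c', x') (b, p') (c', x') (b, p') :=
      Or.inr (Or.inl ⟨Or.inl (Or.inl rfl), Or.inl (Or.inl rfl)⟩)
    have r4 : glue (glue 𝓜.le (c, x) (b, p)) (c', x') (b, p') (b, p') (c', x') :=
      Or.inr (Or.inr ⟨Or.inl (Or.inl rfl), Or.inl (Or.inl rfl)⟩)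
    intro t t' h
    fin_cases t <;> fin_cases t' <;> first
      | exact absurd h (by decide)
      | exact hP'.refl _
      | exact r1
      | exact r2
      | exact r3
      | exact r4

/-- Vectors of two-dimensional objects incomparable to different vectors of a three-dimensional
object coincide. -/
theorem eq_of_incomp {b : J} (hb : 𝓜.d b = 3) {t t' : J × Fin 3} (ht : 𝓜.d t.1 = 2)
    (ht' : 𝓜.d t'.1 = 2) (hv : (t.2 : ℕ) < 2) (hv' : (t'.2 : ℕ) < 2) {p p' : Fin 3} (hpp : p < p')
    (h1 : 𝓜.Incomp t (b, p)) (h2 : 𝓜.Incomp t' (b, p')) : t = t' := by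
  obtain ⟨c, x⟩ := t
  obtain ⟨c', x'⟩ := t'
  simp only at ht ht' hv hv'
  have hvb : ∀ y : Fin 3, (y : ℕ) < 𝓜.d b := fun y => by rw [hb]; exact y.2
  have hpp' : 𝓜.lt (b, p) (b, p') := lt_of_index hpp (hvb _)
  by_contra hne
  by_cases hcc : c = c'
  · subst hcc
    have hbc : b ≠ c := fun h => by rw [h, ht] at hb; omega
    have hxx : x ≠ x' := fun h => hne (by rw [h])
    have hvc : ∀ y : Fin 3, (y : ℕ) < 2 → (y : ℕ) < 𝓜.d c := fun y h => by rw [ht]; exact h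
    rcases lt_or_gt_of_ne hxx with h | h
    · exact not_incomp_pair hbc.symm h hpp (hvc _ hv') (hvb _) h1 h2
    · have hlt : 𝓜.lt (c, x') (c, x) := lt_of_index h (hvc _ hv)
      have h3 : 𝓜.Incomp (c, x') (b, p) :=
        ⟨fun h' => h2.1 (lt_trans h' hpp'), fun h' => h1.2 (lt_trans h' hlt)⟩
      have h4 : 𝓜.Incomp (c, x) (b, p') :=
        ⟨fun h' => h2.1 (lt_trans hlt h'), fun h' => h1.2 (lt_trans hpp' h')⟩
      exact not_incomp_pair hbc.symm h hpp (hvc _ hv) (hvb _) h3 h4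
  -- When the order is the wrong one, transitivity makes the crossed pairs incomparable too, and the
  -- roles of the two objects can be exchanged.
  · by_cases hlt : 𝓜.lt (c', x') (c, x)
    · have h3 : 𝓜.Incomp (c', x') (b, p) :=
        ⟨fun h' => h2.1 (lt_trans h' hpp'), fun h' => h1.2 (lt_trans h' hlt)⟩
      have h4 : 𝓜.Incomp (c, x) (b, p') :=
        ⟨fun h' => h2.1 (lt_trans hlt h'), fun h' => h1.2 (lt_trans hpp' h')⟩
      exact incomp_aux ht' ht hb (Ne.symm hcc) hv' hv hpp h3 h4 (lt_asymm hlt)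
    · exact incomp_aux ht ht' hb hcc hv hv' hpp h1 h2 hlt

end RadicalModel

end Aggregate

/-! ### Matrix units beyond the support of a radical space. -/

namespace Aggregate

namespace RadicalModel

variable {k : Type u} [Field k] {J : Type w} {𝓜 : RadicalModel k J}

variable (𝓜) in
/-- The matrices of `R a b` with rows indexed by codegree and columns by degree. -/
def shiftIdeal (a b : J) : Submodule k (Matrix (Fin 3) (Fin 3) k) where
  carrier := {f | ∃ F ∈ 𝓜.R a b, ∀ u i p : Fin 3, (u : ℕ) + i + 1 = 𝓜.d a → (p : ℕ) < 𝓜.d b →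
    f u p = F p i}
  zero_mem' := ⟨0, (𝓜.R a b).zero_mem, fun _ _ _ _ _ => rfl⟩
  add_mem' := by
    rintro f g ⟨F, hF, h⟩ ⟨G, hG, h'⟩
    exact ⟨F + G, (𝓜.R a b).add_mem hF hG, fun u i p hu hp => by
      rw [Matrix.add_apply, Matrix.add_apply, h u i p hu hp, h' u i p hu hp]⟩
  smul_mem' := by
    rintro c f ⟨F, hF, h⟩
    exact ⟨c • F, (𝓜.R a b).smul_mem c hF, fun u i p hu hp => by
      rw [Matrix.smul_apply, Matrix.smul_apply, h u i p hu hp]⟩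

theorem rowShift_mem_shiftIdeal {a b : J} {f} (hf : f ∈ 𝓜.shiftIdeal a b) :
    rowShift f ∈ 𝓜.shiftIdeal a b := by
  obtain ⟨F, hF, h⟩ := hf
  refine ⟨_, colStep_mem hF, fun u i p hu hp => ?_⟩
  have e : rowShift f u p = if hh : 0 < (u : ℕ) then f ⟨u - 1, by omega⟩ p else 0 := by
    fin_cases u <;> fin_cases p <;> rfl
  have e' : !![F 0 1, F 0 2, 0; F 1 1, F 1 2, 0; F 2 1, F 2 2, 0] p i =
      if hh : (i : ℕ) + 1 < 3 then F p ⟨i + 1, hh⟩ else 0 := by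
    fin_cases i <;> fin_cases p <;> rfl
  have hd := 𝓜.d_le a
  rw [e, e']
  split_ifs with h1 h2 h2
  · exact h _ _ p (by simp only; omega) hp
  · omega
  · by_contra hne
    have := (𝓜.supp hF (Ne.symm hne)).1
    simp only at this
    omega
  · rfl

theorem colShift_mem_shiftIdeal {a b : J} {f} (hf : f ∈ 𝓜.shiftIdeal a b) :
    colShift f ∈ 𝓜.shiftIdeal a b := by
  obtain ⟨F, hF, h⟩ := hf
  refine ⟨_, rowStep_mem hF, fun u i p hu hp => ?_⟩
  have h0 := h u i 0 hu
  have h1 := h u i 1 hu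
  simp only [Matrix.of_apply]
  have e : ∀ u, colShift f u p = if hh : 0 < (p : ℕ) then f u ⟨p - 1, by omega⟩ else 0 := by
    intro u
    fin_cases u <;> fin_cases p <;> rfl
  rw [e]
  split_ifs with h2 h3 h3
  · exact h u i _ hu (by simp only; omega)
  · exact absurd ⟨h2, hp⟩ h3
  · exact absurd h3.1 h2
  · rfl

theorem exists_mem_shiftIdeal {a b : J} {F} (hF : F ∈ 𝓜.R a b) :
    ∃ f ∈ 𝓜.shiftIdeal a b, ∀ u i p : Fin 3, (u : ℕ) + i + 1 = 𝓜.d a → f u p = F p i := by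
  have hd := 𝓜.d_le a
  have key : ∀ u i p : Fin 3, (u : ℕ) + i + 1 = 𝓜.d a → (Matrix.of fun u p : Fin 3 =>
      F p ⟨𝓜.d a - 1 - u, by omega⟩) u p = F p i := by
    intro u i p h
    simp only [Matrix.of_apply]
    congr 1
    exact Fin.ext (by simp only; omega)
  exact ⟨_, ⟨F, hF, fun u i p hu _ => key u i p hu⟩, key⟩

theorem single_mem_shiftIdeal_iff {a b : J} {u i p : Fin 3} (hu : (u : ℕ) + i + 1 = 𝓜.d a)
    (hp : (p : ℕ) < 𝓜.d b) :
    Matrix.single u p (1 : k) ∈ 𝓜.shiftIdeal a b ↔ Matrix.single p i (1 : k) ∈ 𝓜.R a b := by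
  constructor
  · rintro ⟨F, hF, h⟩
    convert hF using 1
    ext q j
    by_cases hv : (j : ℕ) < 𝓜.d a ∧ (q : ℕ) < 𝓜.d b
    · have hd := 𝓜.d_le a
      have h1 : 𝓜.d a - 1 - j < 3 := by omega
      rw [← h ⟨𝓜.d a - 1 - j, h1⟩ j q (by simp only; omega) hv.2]
      simp only [Matrix.single_apply]
      congr 1
      simp only [Fin.ext_iff, eq_iff_iff]
      constructor <;> rintro ⟨h2, h3⟩ <;> constructor <;> omega
    · have h0 : F q j = 0 := by
        by_contra hne
        exact hv (𝓜.supp hF hne)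
      rw [h0, Matrix.single_apply, if_neg]
      rintro ⟨rfl, rfl⟩
      exact hv ⟨by omega, hp⟩
  · intro h
    refine ⟨_, h, fun u' i' p' hu' hp' => ?_⟩
    simp only [Matrix.single_apply]
    congr 1
    simp only [Fin.ext_iff, eq_iff_iff]
    constructor <;> rintro ⟨h2, h3⟩ <;> constructor <;> omega

theorem single_two_zero_mem {b : J} (hb : 𝓜.d b = 3) : Matrix.single 2 0 (1 : k) ∈ 𝓜.R b b := by
  convert 𝓜.mul_mem (𝓜.shift_mem b) (𝓜.shift_mem b) using 1
  ext p i
  simp only [Matrix.mul_apply, Fin.sum_univ_three, Matrix.of_apply, hb]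
  fin_cases p <;> fin_cases i <;> simp

/-- By comparability `R b a` is nonzero, and the hypotheses confine it to the entry `(2, 0)`.
Composing it with a morphism from `a` to `b` puts the unit at `(1, 0)` into `R b b`. Multiplying by
this unit moves row 0 of `K` into row 1, where the only new entry is the one at `(1, 1)`. -/
theorem single_one_one_mem {a b : J} (hab : a ≠ b) (ha : 𝓜.d a = 3) (hb : 𝓜.d b = 3)
    (h10 : 𝓜.lt (a, 1) (b, 0)) (h21 : 𝓜.lt (a, 2) (b, 1)) (h20 : ¬ 𝓜.lt (a, 2) (b, 0))
    (hs : Matrix.single 1 0 (1 : k) ∈ 𝓜.R a b) : Matrix.single 1 1 (1 : k) ∈ 𝓜.R a b := by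
  have hv : ∀ y : Fin 3, (y : ℕ) < 𝓜.d b := fun y => by rw [hb]; exact y.2
  have hba : 𝓜.lt (b, 0) (a, 2) := by
    by_contra h
    exact not_incomp_of_three hab ha hb 2 0 ⟨h20, h⟩
  obtain ⟨G, hG, hG20⟩ := hba
  have hGz : ∀ p i, (p, i) ≠ ((2, 0) : Fin 3 × Fin 3) → G p i = 0 := by
    intro p i hpi
    by_contra hne
    have h1 := lt_of_ne_zero hG hne
    by_cases hp : p = 2
    · subst hp
      have hi : i ≠ 0 := fun h => hpi (by rw [h])
      exact lt_asymm h1 (lt_succ h21 (by omega) (hv i))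
    · exact lt_asymm h1 (lt_succ (lt_pred h10 (by omega : p ≤ 1)) (Fin.zero_le i) (hv i))
  obtain ⟨F, hF, hF12⟩ := h21
  change F 1 2 ≠ 0 at hF12
  change G 2 0 ≠ 0 at hG20
  have hF02 : F 0 2 = 0 := eq_zero_of_not_lt hF h20
  have hE : Matrix.single 1 0 (1 : k) ∈ 𝓜.R b b := by
    refine single_mem_of_lead (F * G) (𝓜.mul_mem hG hF) 1 0 ?_ ?_
    · rw [Matrix.mul_apply, Fin.sum_univ_three, hGz 0 0 (by decide), hGz 1 0 (by decide)]
      simpa using ⟨hF12, hG20⟩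
    · intro p i hpi
      rw [Matrix.mul_apply, Fin.sum_univ_three]
      by_cases hi : i = 0
      · subst hi
        rw [hGz 0 0 (by decide), hGz 1 0 (by decide)]
        fin_cases p
        · left; simp [hF02]
        · exact absurd rfl hpi
        · right; exact single_two_zero_mem hb
      · left
        rw [hGz 0 i (by simp), hGz 1 i (by simp), hGz 2 i (by simp [hi])]
        simp
  obtain ⟨K, hK, hK01⟩ := h10
  change K 0 1 ≠ 0 at hK01
  have hK02 : K 0 2 = 0 := eq_zero_of_not_lt hK h20
  refine single_mem_of_lead (Matrix.single 1 0 1 * K) (𝓜.mul_mem hK hE) 1 1 ?_ ?_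
  · simpa using hK01
  · intro p i hpi
    by_cases hp : p = 1
    · subst hp
      fin_cases i
      · right; exact hs
      · exact absurd rfl hpi
      · left; simp [hK02]
    · left
      rw [Matrix.single_mul_apply_of_ne _ _ _ _ _ hp]

theorem not_lt_of_lt_diagonal {a b : J} (hb : 𝓜.d b = 3) {p i : Fin 3}
    (hd : 𝓜.lt (a, p) (b, p)) (hpi : p ≤ i) : ¬ 𝓜.lt (b, i) (a, p) := fun h =>
  lt_asymm h (lt_succ hd hpi (by rw [hb]; exact i.2))

/-- Matrix units belong to `R a b` at the positions strictly beyond its support. -/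
theorem single_mem_of_lt {a b : J} {i j p q : Fin 3} (h : 𝓜.lt (a, j) (b, q)) (hij : i ≤ j)
    (hqp : q ≤ p) (hp : (p : ℕ) < 𝓜.d b) (hne : (i, p) ≠ (j, q)) :
    Matrix.single p i (1 : k) ∈ 𝓜.R a b := by
  have hj := (lt_valid h).1
  simp only at hj
  have hda := 𝓜.d_le a
  have hdb := 𝓜.d_le b
  obtain ⟨F, hF, hFne⟩ := h
  change F q j ≠ 0 at hFne
  obtain ⟨f, hf, hfF⟩ := exists_mem_shiftIdeal hF
  have hu1 : 𝓜.d a - 1 - j < 3 := by omega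
  have hu2 : 𝓜.d a - 1 - i < 3 := by omega
  have hile : (i : ℕ) ≤ j := hij
  refine (single_mem_shiftIdeal_iff (u := ⟨𝓜.d a - 1 - i, hu2⟩) (by simp only; omega) hp).1
    (single_mem_of_apply_ne_zero (fun f => rowShift_mem_shiftIdeal)
    (fun f => colShift_mem_shiftIdeal) ?_ ?_ hf (u := ⟨𝓜.d a - 1 - j, hu1⟩) (p := q)
    (by rw [hfF _ j q (by simp only; omega)]; exact hFne) (by rw [Fin.le_def]; simp only; omega)
    hqp ?_)
  · rintro ⟨f, ⟨F, hF, hfF⟩, hf1⟩ ⟨g, ⟨G, hG, hgG⟩, hg1⟩ h00 hs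
    -- Positions outside the true dimensions impose no condition in `shiftIdeal`, so their matrix
    -- units belong to it, represented by 0. Only the case of two three-dimensional objects has
    -- content.
    by_cases ha : 𝓜.d a ≤ 2
    · left
      refine ⟨0, zero_mem _, fun u i p hu hp => ?_⟩
      rw [Matrix.single_apply, if_neg]
      · rfl
      · rintro ⟨h1, -⟩
        rw [← h1] at hu
        change 2 + (i : ℕ) + 1 = 𝓜.d a at hu
        omega
    by_cases hb : 𝓜.d b ≤ 2
    · right; right
      refine ⟨0, zero_mem _, fun u i p hu hp => ?_⟩
      rw [Matrix.single_apply, if_neg]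
      · rfl
      · rintro ⟨-, h1⟩
        rw [← h1] at hp
        change 2 < 𝓜.d b at hp
        omega
    have ha3 : 𝓜.d a = 3 := by omega
    have hb3 : 𝓜.d b = 3 := by omega
    have e1 : F 0 1 ≠ 0 := by
      rw [← hfF 1 1 0 (by rw [ha3]; rfl) (by rw [hb3]; decide)]; exact hf1
    have e2 : G 1 2 ≠ 0 := by
      rw [← hgG 0 2 1 (by rw [ha3]; rfl) (by rw [hb3]; decide)]; exact hg1
    by_cases hab : a = b
    · subst hab
      exact absurd (𝓜.lower hF e1) (by decide)
    right; left
    refine (single_mem_shiftIdeal_iff (i := 1) (by rw [ha3]; rfl) (by rw [hb3]; decide)).2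
      (single_one_one_mem hab ha3 hb3 ⟨F, hF, e1⟩ ⟨G, hG, e2⟩ ?_
      ((single_mem_shiftIdeal_iff (u := 2) (by rw [ha3]; rfl) (by rw [hb3]; decide)).1 hs))
    rintro ⟨H, hH, hne⟩
    obtain ⟨h, hh, hhH⟩ := exists_mem_shiftIdeal hH
    apply hne
    change H 0 2 = 0
    rw [← hhH 0 2 0 (by rw [ha3]; rfl)]
    exact h00 h hh
  · intro hlow h20 h11 h02 y₀ y₁ y₂
    by_contra! hcon
    by_cases ha : 𝓜.d a ≤ 2
    -- This unit lies in the ideal for lack of a row of codegree 2. Proportionality to `(y₀, y₁,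
    -- y₂)` then forces `y₁ = 0`, against `h11`.
    · have hs : Matrix.single 2 0 (1 : k) ∈ 𝓜.shiftIdeal a b := by
        refine ⟨0, zero_mem _, fun u i p hu hp => ?_⟩
        rw [Matrix.single_apply, if_neg]
        · rfl
        · rintro ⟨h1, -⟩
          rw [← h1] at hu
          change 2 + (i : ℕ) + 1 = 𝓜.d a at hu
          omega
      obtain ⟨c, hc0, hc1, -⟩ := hcon _ hs
      obtain ⟨f, hf, hf11⟩ := h11
      obtain ⟨c', -, hc', -⟩ := hcon f hf
      have hy : y₁ = 0 := by
        have hc : c ≠ 0 := by rintro rfl; simp at hc0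
        simpa [hc, Matrix.single_apply] using hc1
      rw [hy, mul_zero] at hc'
      exact hf11 hc'
    by_cases hb : 𝓜.d b ≤ 2
    · have hs : Matrix.single 0 2 (1 : k) ∈ 𝓜.shiftIdeal a b := by
        refine ⟨0, zero_mem _, fun u i p hu hp => ?_⟩
        rw [Matrix.single_apply, if_neg]
        · rfl
        · rintro ⟨-, h1⟩
          rw [← h1] at hp
          change 2 < 𝓜.d b at hp
          omega
      obtain ⟨c, -, hc1, hc0⟩ := hcon _ hs
      obtain ⟨f, hf, hf11⟩ := h11
      obtain ⟨c', -, hc', -⟩ := hcon f hf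
      have hy : y₁ = 0 := by
        have hc : c ≠ 0 := by rintro rfl; simp at hc0
        simpa [hc, Matrix.single_apply] using hc1
      rw [hy, mul_zero] at hc'
      exact hf11 hc'
    have ha3 : 𝓜.d a = 3 := by omega
    have hb3 : 𝓜.d b = 3 := by omega
    have entry : ∀ F ∈ 𝓜.R a b, ∃ f ∈ 𝓜.shiftIdeal a b, f 0 0 = F 0 2 ∧ f 1 0 = F 0 1 ∧
        f 0 1 = F 1 2 ∧ f 2 0 = F 0 0 ∧ f 1 1 = F 1 1 ∧ f 0 2 = F 2 2 := by
      intro F hF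
      obtain ⟨f, hf, h⟩ := exists_mem_shiftIdeal hF
      exact ⟨f, hf, h 0 2 0 (by rw [ha3]; rfl), h 1 1 0 (by rw [ha3]; rfl),
        h 0 2 1 (by rw [ha3]; rfl), h 2 0 0 (by rw [ha3]; rfl), h 1 1 1 (by rw [ha3]; rfl),
        h 0 2 2 (by rw [ha3]; rfl)⟩
    have hdiag : ∀ p, 𝓜.lt (a, p) (b, p) := by
      obtain ⟨f, ⟨F, hF, hfF⟩, hf⟩ := h20
      obtain ⟨g, ⟨G, hG, hgG⟩, hg⟩ := h11
      obtain ⟨h, ⟨H, hH, hhH⟩, hh⟩ := h02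
      rw [hfF 2 0 0 (by rw [ha3]; rfl) (by rw [hb3]; decide)] at hf
      rw [hgG 1 1 1 (by rw [ha3]; rfl) (by rw [hb3]; decide)] at hg
      rw [hhH 0 2 2 (by rw [ha3]; rfl) (by rw [hb3]; decide)] at hh
      intro p
      fin_cases p
      · exact ⟨F, hF, hf⟩
      · exact ⟨G, hG, hg⟩
      · exact ⟨H, hH, hh⟩
    have hab : a ≠ b := by
      rintro rfl
      exact lt_irrefl _ (hdiag 0)
    refine 𝓜.not_diagonal_line hab ha3 hb3 ?_ ?_ ![y₀, y₁, y₂] ?_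
    · intro G hG p i hne
      by_contra h
      exact not_lt_of_lt_diagonal hb3 (hdiag p) (not_lt.1 h) (lt_of_ne_zero hG hne)
    · intro F hF p i hne
      obtain ⟨f, hf, e1, e2, e3, -⟩ := entry F hF
      obtain ⟨z1, z2, z3⟩ := hlow f hf
      rw [e1] at z1
      rw [e2] at z2
      rw [e3] at z3
      by_contra h
      have : (p = 0 ∧ i = 1) ∨ (p = 0 ∧ i = 2) ∨ (p = 1 ∧ i = 2) := by omega
      rcases this with ⟨rfl, rfl⟩ | ⟨rfl, rfl⟩ | ⟨rfl, rfl⟩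
      · exact hne z2
      · exact hne z1
      · exact hne z3
    · intro F hF
      obtain ⟨f, hf, -, -, -, e1, e2, e3⟩ := entry F hF
      obtain ⟨c, h1, h2, h3⟩ := hcon f hf
      refine ⟨c, fun i => ?_⟩
      fin_cases i
      · exact e1 ▸ h1
      · exact e2 ▸ h2
      · exact e3 ▸ h3
  · intro h
    simp only [Prod.mk.injEq, Fin.mk.injEq] at h
    exact hne (by rw [h.2, show i = j from Fin.ext (by omega)])

end RadicalModel

end Aggregate

/-! ### Tied positions and the links between them. -/

namespace Aggregate

namespace RadicalModel

variable {k : Type u} [Field k] {J : Type w} (𝓜 : RadicalModel k J)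

/-- The position `(p, i)` lies in the support of `R a b` but its matrix unit is not in `R a b`. -/
def IsTied (a b : J) (i p : Fin 3) : Prop :=
  𝓜.lt (a, i) (b, p) ∧ Matrix.single p i (1 : k) ∉ 𝓜.R a b

/-- All diagonal positions of `R a b` are tied. -/
def IsGeneric (a b : J) : Prop := ∀ i, 𝓜.IsTied a b i i

/-- The matrix with entries `1` and `c` at the tied positions `(p, i)` and `(q, j)` belongs to
`R a b`. -/
structure Link (a b : J) (i p j q : Fin 3) (c : k) : Prop where
  tied : 𝓜.IsTied a b i p
  tied' : 𝓜.IsTied a b j q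
  ne : i ≠ j
  ne_zero : c ≠ 0
  mem : Matrix.single p i 1 + c • Matrix.single q j 1 ∈ 𝓜.R a b

variable {𝓜}

/-- If one tied position lay weakly beyond the other in the support order, its matrix unit would
belong to `R a b` by `single_mem_of_lt`. So tied positions increase strictly in both coordinates. -/
theorem IsTied.lt_or_lt {a b : J} {i p j q : Fin 3} (h : 𝓜.IsTied a b i p)
    (h' : 𝓜.IsTied a b j q) (hne : (i, p) ≠ (j, q)) : (i < j ∧ p < q) ∨ (j < i ∧ q < p) := by
  have hp := (lt_valid h.1).2
  have hq := (lt_valid h'.1).2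
  have h1 : ¬ (i ≤ j ∧ q ≤ p) := fun hh => h.2 (single_mem_of_lt h'.1 hh.1 hh.2 hp hne)
  have h2 : ¬ (j ≤ i ∧ p ≤ q) := fun hh => h'.2 (single_mem_of_lt h.1 hh.1 hh.2 hq hne.symm)
  omega

theorem IsTied.eq_of_row {a b : J} {i p j : Fin 3} (h : 𝓜.IsTied a b i p)
    (h' : 𝓜.IsTied a b j p) : i = j := by
  by_contra hne
  have := h.lt_or_lt h' (fun e => hne (congrArg Prod.fst e))
  omega

theorem IsTied.eq_of_col {a b : J} {i p q : Fin 3} (h : 𝓜.IsTied a b i p)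
    (h' : 𝓜.IsTied a b i q) : p = q := by
  by_contra hne
  have := h.lt_or_lt h' (fun e => hne (congrArg Prod.snd e))
  omega

theorem IsTied.not_lt {a b : J} {i p j : Fin 3} (h : 𝓜.IsTied a b i p) (hij : i < j) :
    ¬ 𝓜.lt (a, j) (b, p) := fun h' =>
  h.2 (single_mem_of_lt h' hij.le le_rfl (lt_valid h.1).2 fun e => hij.ne (congrArg Prod.fst e))

theorem Link.lt_iff {a b : J} {i p j q : Fin 3} {c : k} (h : 𝓜.Link a b i p j q c) :
    (i < j ↔ p < q) ∧ p ≠ q := by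
  have := h.tied.lt_or_lt h.tied' (fun e => h.ne (congrArg Prod.fst e))
  omega

theorem Link.symm {a b : J} {i p j q : Fin 3} {c : k} (h : 𝓜.Link a b i p j q c) :
    𝓜.Link a b j q i p c⁻¹ where
  tied := h.tied'
  tied' := h.tied
  ne := h.ne.symm
  ne_zero := inv_ne_zero h.ne_zero
  mem := by
    have := (𝓜.R a b).smul_mem c⁻¹ h.mem
    rwa [smul_add, smul_smul, inv_mul_cancel₀ h.ne_zero, one_smul, add_comm] at this

open Classical in
/-- The part of a matrix supported in the tied positions. -/
noncomputable def tiedPart (𝓜 : RadicalModel k J) (a b : J) (F : Matrix (Fin 3) (Fin 3) k) :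
    Matrix (Fin 3) (Fin 3) k :=
  Matrix.of fun p i => if 𝓜.IsTied a b i p then F p i else 0

open Classical in
theorem tiedPart_apply {a b : J} (F : Matrix (Fin 3) (Fin 3) k) (p i : Fin 3) :
    tiedPart 𝓜 a b F p i = if 𝓜.IsTied a b i p then F p i else 0 := rfl

theorem tiedPart_apply_of {a b : J} (F : Matrix (Fin 3) (Fin 3) k) {p i : Fin 3}
    (h : 𝓜.IsTied a b i p) : tiedPart 𝓜 a b F p i = F p i := if_pos h

theorem tiedPart_apply_of_not {a b : J} (F : Matrix (Fin 3) (Fin 3) k) {p i : Fin 3}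
    (h : ¬ 𝓜.IsTied a b i p) : tiedPart 𝓜 a b F p i = 0 := if_neg h

theorem eq_sum_single (F : Matrix (Fin 3) (Fin 3) k) :
    F = ∑ x : Fin 3 × Fin 3, F x.1 x.2 • Matrix.single x.1 x.2 (1 : k) := by
  conv_lhs => rw [Matrix.matrix_eq_sum_single F]
  rw [← Finset.univ_product_univ, Finset.sum_product]
  simp

theorem sub_tiedPart_mem {a b : J} {F} (hF : F ∈ 𝓜.R a b) (S : Submodule k _)
    (hS : ∀ p i, Matrix.single p i (1 : k) ∈ 𝓜.R a b → Matrix.single p i (1 : k) ∈ S) :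
    F - tiedPart 𝓜 a b F ∈ S := by
  rw [eq_sum_single (F - tiedPart 𝓜 a b F)]
  refine S.sum_mem fun x _ => ?_
  by_cases h : 𝓜.IsTied a b x.2 x.1
  · rw [Matrix.sub_apply, tiedPart_apply_of F h, sub_self, zero_smul]
    exact S.zero_mem
  · by_cases h0 : F x.1 x.2 = 0
    · rw [Matrix.sub_apply, tiedPart_apply_of_not F h, h0, sub_self, zero_smul]
      exact S.zero_mem
    · refine S.smul_mem _ (hS _ _ ?_)
      by_contra hn
      exact h ⟨lt_of_ne_zero hF h0, hn⟩

theorem tiedPart_mem {a b : J} {F} (hF : F ∈ 𝓜.R a b) : tiedPart 𝓜 a b F ∈ 𝓜.R a b := by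
  have := sub_tiedPart_mem hF (𝓜.R a b) fun _ _ h => h
  have h2 := (𝓜.R a b).sub_mem hF this
  rwa [sub_sub_cancel] at h2

theorem IsGeneric.eq {a b : J} (h : 𝓜.IsGeneric a b) {i p : Fin 3} (h' : 𝓜.IsTied a b i p) :
    i = p := (h p).eq_of_row h' |>.symm

theorem IsGeneric.ne {a b : J} (h : 𝓜.IsGeneric a b) : a ≠ b := by
  rintro rfl
  exact lt_irrefl _ (h 0).1

theorem IsGeneric.dim {a b : J} (h : 𝓜.IsGeneric a b) : 𝓜.d a = 3 ∧ 𝓜.d b = 3 := by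
  have := lt_valid (h 2).1
  have h1 := 𝓜.d_le a
  have h2 := 𝓜.d_le b
  simp only at this
  change 2 < _ ∧ 2 < _ at this
  omega

/-- A strictly increasing chain of three positions in a `3 × 3` grid is the diagonal. -/
theorem isGeneric_of_three {a b : J} {i p j q l r : Fin 3} (h1 : 𝓜.IsTied a b i p)
    (h2 : 𝓜.IsTied a b j q) (h3 : 𝓜.IsTied a b l r) (h12 : (i, p) ≠ (j, q))
    (h13 : (i, p) ≠ (l, r)) (h23 : (j, q) ≠ (l, r)) : 𝓜.IsGeneric a b := by
  have k12 := h1.lt_or_lt h2 h12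
  have k13 := h1.lt_or_lt h3 h13
  have k23 := h2.lt_or_lt h3 h23
  have e1 : p = i := by omega
  have e2 : q = j := by omega
  have e3 : r = l := by omega
  subst e1 e2 e3
  intro x
  have : x = p ∨ x = q ∨ x = r := by omega
  rcases this with rfl | rfl | rfl <;> assumption

/-- In the generic case any two diagonal positions are linked. -/
theorem IsGeneric.link {a b : J} (h : 𝓜.IsGeneric a b) {i j : Fin 3} (hij : i ≠ j) :
    ∃ c, 𝓜.Link a b i i j j c := by
  obtain ⟨ha, hb⟩ := h.dim
  obtain ⟨r, hri, hrj⟩ : ∃ r : Fin 3, r ≠ i ∧ r ≠ j := by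
    have : ∀ p p' : Fin 3, ∃ q : Fin 3, q ≠ p ∧ q ≠ p' := by decide
    exact this i j
  have hr3 : ∀ x, x = i ∨ x = j ∨ x = r := fun x => by omega
  obtain ⟨A, hA, hArr⟩ := (h r).1
  change A r r ≠ 0 at hArr
  obtain ⟨B, hB, hBA⟩ : ∃ B ∈ 𝓜.R a b, ∀ c, ∃ x, B x x ≠ c * A x x := by
    by_contra! hcon
    refine 𝓜.not_diagonal_line h.ne ha hb ?_ ?_ (fun x => A x x) hcon
    · intro G hG p x hne
      by_contra hpx
      exact not_lt_of_lt_diagonal hb (h p).1 (not_lt.1 hpx) (lt_of_ne_zero hG hne)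
    · intro F hF p x hne
      by_contra hpx
      exact (h p).not_lt (not_le.1 hpx) (lt_of_ne_zero hF hne)
  -- A combination of two matrices with non-proportional diagonals that vanishes at `r`. Its two
  -- other diagonal entries must both be nonzero, for a lone entry would be a matrix unit at a tied
  -- position.
  let c₀ := B r r / A r r
  let D := tiedPart 𝓜 a b (B - c₀ • A)
  have hD : D ∈ 𝓜.R a b := tiedPart_mem ((𝓜.R a b).sub_mem hB ((𝓜.R a b).smul_mem _ hA))
  have hDx : ∀ x, D x x = B x x - c₀ * A x x := fun x => by
    rw [show D x x = _ from tiedPart_apply_of _ (h x)]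
    simp
  have hDr : D r r = 0 := by
    rw [hDx]
    simp [c₀, hArr]
  have hDoff : ∀ p x, p ≠ x → D p x = 0 := fun p x hpx =>
    tiedPart_apply_of_not _ fun h' => hpx (h.eq h').symm
  have hDeq : D = D i i • Matrix.single i i 1 + D j j • Matrix.single j j 1 := by
    ext p x
    by_cases hpx : p = x
    · subst hpx
      rcases hr3 p with rfl | rfl | rfl
      · simp [hij.symm]
      · simp [hij]
      · simp [hDr, hri.symm, hrj.symm]
    · rw [hDoff p x hpx]
      simp only [Matrix.add_apply, Matrix.smul_apply, Matrix.single_apply]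
      rw [if_neg (by rintro ⟨rfl, rfl⟩; exact hpx rfl), if_neg (by rintro ⟨rfl, rfl⟩; exact hpx rfl)]
      simp
  have hi : D i i ≠ 0 := by
    intro h0
    rw [h0, zero_smul, zero_add] at hDeq
    have hj : D j j = 0 := by
      by_contra hj
      apply (h j).2
      have := (𝓜.R a b).smul_mem (D j j)⁻¹ (hDeq ▸ hD)
      simpa [smul_smul, hj] using this
    obtain ⟨x, hx⟩ := hBA c₀
    apply hx
    rw [← sub_eq_zero, ← hDx]
    rcases hr3 x with rfl | rfl | rfl <;> assumption
  have hj : D j j ≠ 0 := by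
    intro h0
    rw [h0, zero_smul, add_zero] at hDeq
    apply (h i).2
    have := (𝓜.R a b).smul_mem (D i i)⁻¹ (hDeq ▸ hD)
    simpa [smul_smul, hi] using this
  refine ⟨(D i i)⁻¹ * D j j, h i, h j, hij, mul_ne_zero (inv_ne_zero hi) hj, ?_⟩
  have := (𝓜.R a b).smul_mem (D i i)⁻¹ (hDeq ▸ hD)
  rwa [smul_add, smul_smul, smul_smul, inv_mul_cancel₀ hi, one_smul] at this

/-- Each tied position is linked to another one. -/
theorem IsTied.exists_link {a b : J} {i p : Fin 3} (h : 𝓜.IsTied a b i p) :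
    ∃ j q c, 𝓜.Link a b i p j q c := by
  obtain ⟨F, hF, hne⟩ := h.1
  change F p i ≠ 0 at hne
  let G := tiedPart 𝓜 a b F
  have hG : G ∈ 𝓜.R a b := tiedPart_mem hF
  have hGip : G p i = F p i := tiedPart_apply_of _ h
  have htied : ∀ q j, G q j ≠ 0 → 𝓜.IsTied a b j q := fun q j hn => by
    by_contra h'
    exact hn (tiedPart_apply_of_not _ h')
  obtain ⟨q, j, hqj, hqj0⟩ : ∃ q j, (q, j) ≠ (p, i) ∧ G q j ≠ 0 := by
    by_contra! hcon
    exact h.2 (single_mem_of_lead G hG p i (by rwa [hGip]) fun q j hn => Or.inl (hcon q j hn))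
  have hne' : (i, p) ≠ (j, q) := fun e => hqj (by
    rw [Prod.ext_iff] at e ⊢; exact ⟨e.2.symm, e.1.symm⟩)
  have ht' := htied q j hqj0
  have hij : i ≠ j := by
    have := h.lt_or_lt ht' hne'
    omega
  -- A third tied position puts us in the generic case, where links are known; otherwise `G` itself
  -- has just two entries.
  by_cases h3 : ∃ r l, 𝓜.IsTied a b l r ∧ (l, r) ≠ (i, p) ∧ (l, r) ≠ (j, q)
  · obtain ⟨r, l, ht'', h4, h5⟩ := h3
    have hgen := isGeneric_of_three h ht' ht'' hne' h4.symm h5.symm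
    obtain ⟨c, hc⟩ := hgen.link hij
    rw [← hgen.eq h]
    exact ⟨j, j, c, hc⟩
  · push Not at h3
    refine ⟨j, q, (G p i)⁻¹ * G q j, h, ht', hij,
      mul_ne_zero (inv_ne_zero (by rwa [hGip])) hqj0, ?_⟩
    have hGeq : G = G p i • Matrix.single p i 1 + G q j • Matrix.single q j 1 := by
      ext r l
      simp only [Matrix.add_apply, Matrix.smul_apply, Matrix.single_apply, smul_eq_mul]
      by_cases h4 : p = r ∧ i = l
      · obtain ⟨rfl, rfl⟩ := h4
        rw [if_pos ⟨rfl, rfl⟩, if_neg]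
        · simp
        · rintro ⟨rfl, rfl⟩; exact hne' rfl
      · by_cases h5 : q = r ∧ j = l
        · obtain ⟨rfl, rfl⟩ := h5
          rw [if_neg h4, if_pos ⟨rfl, rfl⟩]
          simp
        · rw [if_neg h4, if_neg h5]
          simp only [mul_zero, add_zero]
          by_contra hn
          have := h3 r l (htied r l hn) (fun e => h4 (by
            rw [Prod.ext_iff] at e; exact ⟨e.2.symm, e.1.symm⟩))
          rw [Prod.ext_iff] at this
          exact h5 ⟨this.2.symm, this.1.symm⟩
    have := (𝓜.R a b).smul_mem (G p i)⁻¹ (hGeq ▸ hG)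
    rwa [smul_add, smul_smul, smul_smul, inv_mul_cancel₀ (by rwa [hGip]), one_smul] at this

/-- Otherwise, subtracting `H p i` times the link matrix from the tied part of `H` leaves a nonzero
multiple of the unit at the tied position `(q, j)`. -/
theorem Link.apply_eq {a b : J} {i p j q : Fin 3} {c : k} (h : 𝓜.Link a b i p j q c) {H}
    (hH : H ∈ 𝓜.R a b) (hz : ∀ r l, 𝓜.IsTied a b l r → H r l ≠ 0 → (l, r) = (i, p) ∨ (l, r) = (j, q)) :
    H q j = c * H p i := by
  have hne : (i, p) ≠ (j, q) := fun e => h.ne (congrArg Prod.fst e)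
  by_contra hcon
  refine h.tied'.2 (single_mem_of_lead (tiedPart 𝓜 a b H - H p i • (Matrix.single p i 1 +
    c • Matrix.single q j 1)) ((𝓜.R a b).sub_mem (tiedPart_mem hH) ((𝓜.R a b).smul_mem _ h.mem))
    q j ?_ ?_)
  · simp only [Matrix.sub_apply, Matrix.smul_apply, Matrix.add_apply, tiedPart_apply_of H h.tied',
      Matrix.single_apply, smul_eq_mul]
    rw [if_neg (fun e => h.ne e.2)]
    simp only [and_self, if_true, zero_add, mul_one]
    rw [mul_comm]
    exact sub_ne_zero.2 hcon
  · intro r l hrl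
    left
    have e1 : ¬ (q = r ∧ j = l) := by
      rintro ⟨rfl, rfl⟩; exact hrl rfl
    simp only [Matrix.sub_apply, Matrix.smul_apply, Matrix.add_apply,
      Matrix.single_apply, smul_eq_mul, if_neg e1]
    by_cases e2 : p = r ∧ i = l
    · obtain ⟨rfl, rfl⟩ := e2
      rw [tiedPart_apply_of H h.tied]
      simp
    · rw [if_neg e2]
      simp only [mul_zero, add_zero, sub_zero]
      rw [tiedPart_apply]
      split_ifs with ht
      · by_contra hn
        rcases hz r l ht hn with e | e
        · exact e2 ⟨(congrArg Prod.snd e).symm, (congrArg Prod.fst e).symm⟩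
        · exact e1 ⟨(congrArg Prod.snd e).symm, (congrArg Prod.fst e).symm⟩
      · rfl

theorem Link.apply_eq_of_rows {a b : J} {i p j q : Fin 3} {c : k} (h : 𝓜.Link a b i p j q c) {H}
    (hH : H ∈ 𝓜.R a b) (hz : ∀ r, r ≠ p → r ≠ q → ∀ l, H r l = 0) : H q j = c * H p i := by
  refine h.apply_eq hH fun r l ht hn => ?_
  by_cases hp : r = p
  · subst hp
    exact Or.inl (by rw [ht.eq_of_row h.tied])
  by_cases hq : r = q
  · subst hq
    exact Or.inr (by rw [ht.eq_of_row h.tied'])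
  exact absurd (hz r hp hq l) hn

theorem Link.apply_eq_of_cols {a b : J} {i p j q : Fin 3} {c : k} (h : 𝓜.Link a b i p j q c) {H}
    (hH : H ∈ 𝓜.R a b) (hz : ∀ l, l ≠ i → l ≠ j → ∀ r, H r l = 0) : H q j = c * H p i := by
  refine h.apply_eq hH fun r l ht hn => ?_
  by_cases hp : l = i
  · subst hp
    exact Or.inl (by rw [ht.eq_of_col h.tied])
  by_cases hq : l = j
  · subst hq
    exact Or.inr (by rw [ht.eq_of_col h.tied'])
  exact absurd (hz l hp hq r) hn

theorem Link.const_unique {a b : J} {i p j q : Fin 3} {c c' : k} (h : 𝓜.Link a b i p j q c)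
    (h' : 𝓜.Link a b i p j q c') : c = c' := by
  have hpq := h.lt_iff.2
  have := h'.apply_eq_of_rows h.mem (fun r hp hq l => by
    simp [Ne.symm hp, Ne.symm hq])
  simpa [Matrix.single_apply, hpq, hpq.symm, h.ne, h.ne.symm] using this

/-- Two circuits with the same target, the sources being comparable. -/
theorem Link.of_targets {a b c : J} {i j m n p q : Fin 3} {x y : k}
    (h1 : 𝓜.Link a b i p j q x) (h2 : 𝓜.Link c b m p n q y) (hlt : 𝓜.lt (a, i) (c, m)) :
    𝓜.Link a c i m j n (x / y) := by
  have hpq := h1.lt_iff.2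
  -- Left multiplication by the matrix of `h2` lands in `R a b` and in the rows `p` and `q`, where
  -- `h1` fixes the ratio of the entries at `(q, j)` and `(p, i)`.
  have key : ∀ F ∈ 𝓜.R a c, y * F n j = x * F m i := by
    intro F hF
    have hH := 𝓜.mul_mem hF h2.mem
    have e : ∀ r l, ((Matrix.single p m (1 : k) + y • Matrix.single q n (1 : k) : Matrix (Fin 3) (Fin 3) k) * F) r l =
        (if p = r then F m l else 0) + y * (if q = r then F n l else 0) := by
      intro r l
      rw [Matrix.add_mul, Matrix.smul_mul, Matrix.add_apply, Matrix.smul_apply, smul_eq_mul]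
      congr 1
      · by_cases hr : p = r
        · subst hr; simp
        · rw [if_neg hr, Matrix.single_mul_apply_of_ne _ _ _ _ _ (Ne.symm hr)]
      · by_cases hr : q = r
        · subst hr; simp
        · rw [if_neg hr, Matrix.single_mul_apply_of_ne _ _ _ _ _ (Ne.symm hr)]
    have := h1.apply_eq_of_rows hH (fun r hp hq l => by
      rw [e, if_neg (Ne.symm hp), if_neg (Ne.symm hq), mul_zero, add_zero])
    rw [e, e] at this
    simpa [hpq, hpq.symm] using this
  have hij := h1.ne
  have tied1 : 𝓜.IsTied a c i m := ⟨hlt, fun h => by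
    have := key _ h
    rw [Matrix.single_apply, Matrix.single_apply, if_neg (fun e => hij e.2)] at this
    exact h1.ne_zero (by simpa using this.symm)⟩
  obtain ⟨j', n', z, hz⟩ := tied1.exists_link
  have hmn := hz.lt_iff.2
  have := key _ hz.mem
  simp only [Matrix.add_apply, Matrix.smul_apply, Matrix.single_apply, smul_eq_mul] at this
  rw [if_neg (fun e => hij e.2), if_pos (⟨trivial, trivial⟩ : True ∧ True), if_neg (fun e : n' = m ∧ _ => hz.ne e.2.symm)] at this
  have h3 : n' = n ∧ j' = j := by
    by_contra hcon
    rw [if_neg hcon] at this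
    exact h1.ne_zero (by simpa using this.symm)
  obtain ⟨rfl, rfl⟩ := h3
  have hzc : z = x / y := by
    rw [eq_div_iff h2.ne_zero]
    simpa [mul_comm] using this
  rwa [← hzc]

/-- Two circuits with the same source, the targets being comparable. -/
theorem Link.of_sources {a b c : J} {i j m n p q : Fin 3} {x y : k}
    (h1 : 𝓜.Link a b i p j q x) (h2 : 𝓜.Link a c i m j n y) (hlt : 𝓜.lt (b, p) (c, m)) :
    𝓜.Link b c p m q n (y / x) := by
  have hij := h1.ne
  have hpq := h1.lt_iff.2
  have key : ∀ G ∈ 𝓜.R b c, x * G n q = y * G m p := by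
    intro G hG
    have hH := 𝓜.mul_mem h1.mem hG
    have e : ∀ r l, (G * (Matrix.single p i (1 : k) + x • Matrix.single q j (1 : k) : Matrix (Fin 3) (Fin 3) k)) r l =
        (if i = l then G r p else 0) + x * (if j = l then G r q else 0) := by
      intro r l
      rw [Matrix.mul_add, Matrix.mul_smul, Matrix.add_apply, Matrix.smul_apply, smul_eq_mul]
      congr 1
      · by_cases hr : i = l
        · subst hr; simp
        · rw [if_neg hr, Matrix.mul_single_apply_of_ne _ _ _ _ _ (Ne.symm hr)]
      · by_cases hr : j = l
        · subst hr; simp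
        · rw [if_neg hr, Matrix.mul_single_apply_of_ne _ _ _ _ _ (Ne.symm hr)]
    have := h2.apply_eq_of_cols hH (fun l hi hj r => by
      rw [e, if_neg (Ne.symm hi), if_neg (Ne.symm hj), mul_zero, add_zero])
    rw [e, e] at this
    simpa [hij, hij.symm] using this
  have hmn := h2.lt_iff.2
  have tied1 : 𝓜.IsTied b c p m := ⟨hlt, fun h => by
    have := key _ h
    rw [Matrix.single_apply, Matrix.single_apply, if_neg (fun e => hpq e.2)] at this
    exact h2.ne_zero (by simpa using this.symm)⟩
  obtain ⟨j', n', z, hz⟩ := tied1.exists_link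
  have := key _ hz.mem
  simp only [Matrix.add_apply, Matrix.smul_apply, Matrix.single_apply, smul_eq_mul] at this
  rw [if_neg (fun e => hpq e.2), if_pos (⟨trivial, trivial⟩ : True ∧ True), if_neg (fun e : n' = m ∧ _ => hz.ne e.2.symm)] at this
  have h3 : n' = n ∧ j' = q := by
    by_contra hcon
    rw [if_neg hcon] at this
    exact h2.ne_zero (by simpa using this.symm)
  obtain ⟨rfl, rfl⟩ := h3
  have hzc : z = y / x := by
    rw [eq_div_iff h1.ne_zero]
    simpa [mul_comm] using this
  rwa [← hzc]

/-- Factorization of a tied position through a third object. -/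
theorem IsTied.factor {a b c : J} {i p m : Fin 3} (h : 𝓜.IsTied a b i p)
    (h1 : 𝓜.lt (a, i) (c, m)) (h2 : 𝓜.lt (c, m) (b, p)) :
    𝓜.IsTied a c i m ∧ 𝓜.IsTied c b m p ∧ ∀ j n x, 𝓜.Link a c i m j n x →
      ∃ q y, 𝓜.Link c b m p n q y ∧ 𝓜.IsTied a b j q := by
  -- If the unit at `(m, i)` were in `R a c`, composing it with `G` would give a matrix in column
  -- `i`. That column contains only one tied position, so all its other entries can be removed,
  -- leaving the unit at `(p, i)`.
  have t1 : 𝓜.IsTied a c i m := by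
    refine ⟨h1, fun hs => h.2 ?_⟩
    obtain ⟨G, hG, hne⟩ := h2
    change G p m ≠ 0 at hne
    have hH := 𝓜.mul_mem hs hG
    refine single_mem_of_lead _ hH p i (by simpa using hne) fun r l hrl => ?_
    by_cases hl : l = i
    · subst hl
      by_cases h0 : (G * Matrix.single m l (1 : k) : Matrix (Fin 3) (Fin 3) k) r l = 0
      · exact Or.inl h0
      · right
        by_contra hn
        have := h.eq_of_col ⟨lt_of_ne_zero hH h0, hn⟩
        exact hrl (by rw [this])
    · left
      rw [Matrix.mul_single_apply_of_ne _ _ _ _ _ hl]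
  have t2 : 𝓜.IsTied c b m p := by
    refine ⟨h2, fun hs => h.2 ?_⟩
    obtain ⟨G, hG, hne⟩ := h1
    change G m i ≠ 0 at hne
    have hH := 𝓜.mul_mem hG hs
    refine single_mem_of_lead _ hH p i (by simpa using hne) fun r l hrl => ?_
    by_cases hl : r = p
    · subst hl
      by_cases h0 : (Matrix.single r m (1 : k) * G : Matrix (Fin 3) (Fin 3) k) r l = 0
      · exact Or.inl h0
      · right
        by_contra hn
        have := h.eq_of_row ⟨lt_of_ne_zero hH h0, hn⟩
        exact hrl (by rw [this])
    · left
      rw [Matrix.single_mul_apply_of_ne _ _ _ _ _ hl]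
  refine ⟨t1, t2, fun j n x hx => ?_⟩
  obtain ⟨n', q, y, hy⟩ := t2.exists_link
  have hH := 𝓜.mul_mem hx.mem hy.mem
  have hmn := hx.lt_iff.2
  have hmn' := hy.ne
  have e : (Matrix.single p m (1 : k) + y • Matrix.single q n' (1 : k)) *
      (Matrix.single m i (1 : k) + x • Matrix.single n j (1 : k)) =
      (Matrix.single p i (1 : k) + if n' = n then (y * x) • Matrix.single q j (1 : k) else 0 :
        Matrix (Fin 3) (Fin 3) k) := by
    rw [Matrix.add_mul, Matrix.mul_add, Matrix.mul_add, Matrix.mul_smul, Matrix.smul_mul,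
      Matrix.smul_mul, Matrix.mul_smul, Matrix.single_mul_single_same,
      Matrix.single_mul_single_of_ne _ _ _ _ hmn, Matrix.single_mul_single_of_ne _ _ _ _ hmn'.symm]
    split_ifs with hn
    · subst hn
      rw [Matrix.single_mul_single_same, smul_smul]
      simp
    · rw [Matrix.single_mul_single_of_ne _ _ _ _ hn]
      simp
  rw [e] at hH
  have hn : n' = n := by
    by_contra hn
    rw [if_neg hn, add_zero] at hH
    exact h.2 hH
  subst hn
  rw [if_pos rfl] at hH
  have hpq := hy.lt_iff.2
  have hij := hx.ne
  refine ⟨q, y, hy, ?_, ?_⟩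
  · refine ⟨_, hH, ?_⟩
    simp [hpq, hy.ne_zero, hx.ne_zero]
  · intro hs
    have := (𝓜.R a b).sub_mem hH ((𝓜.R a b).smul_mem (y * x) hs)
    rw [add_sub_cancel_right] at this
    exact h.2 this

/-- Different circuits through the images of the same vector in different comparable objects. -/
theorem Link.isGeneric_of_lt {b c c' : J} {i p j q p' j' q' : Fin 3} {x x' : k}
    (h : 𝓜.Link b c i p j q x) (h' : 𝓜.Link b c' i p' j' q' x') (hj : j ≠ j')
    (hlt : 𝓜.lt (c, p) (c', p')) : 𝓜.IsGeneric b c' := by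
  obtain ⟨-, -, h3⟩ := h'.tied.factor h.tied.1 hlt
  obtain ⟨r, y, -, ht⟩ := h3 j q x h
  exact isGeneric_of_three h'.tied h'.tied' ht (fun e => h'.ne (congrArg Prod.fst e))
    (fun e => h.ne (congrArg Prod.fst e)) (fun e => hj (congrArg Prod.fst e).symm)

end RadicalModel

end Aggregate

/-! ### Pairs of basis vectors, arrows and nearest sources. -/

namespace Aggregate

/-- The smaller of the two indices different from `r`. -/
def lo (r : Fin 3) : Fin 3 := if r = 0 then 1 else 0

/-- The larger of the two indices different from `r`. -/
def hi (r : Fin 3) : Fin 3 := if r = 2 then 1 else 2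

theorem lo_lt_hi (r : Fin 3) : lo r < hi r := by revert r; decide

theorem lo_ne (r : Fin 3) : lo r ≠ r := by revert r; decide

theorem hi_ne (r : Fin 3) : hi r ≠ r := by revert r; decide

theorem eq_lo_or_eq_hi {r i : Fin 3} (h : i ≠ r) : i = lo r ∨ i = hi r := by
  revert r i; decide

theorem exists_lo_hi {i j : Fin 3} (h : i < j) : ∃ r, lo r = i ∧ hi r = j := by
  revert i j; decide

theorem lo_hi_injective {r s : Fin 3} (h : lo r = lo s) (h' : hi r = hi s) : r = s := by
  revert r s; decide

namespace RadicalModel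

variable {k : Type u} [Field k] {J : Type w} (𝓜 : RadicalModel k J)

/-- A link between two pairs of basis vectors, each pair being given by its object and the index
which does not occur in it. -/
def PairLink (π ρ : J × Fin 3) (c : k) : Prop :=
  𝓜.Link π.1 ρ.1 (lo π.2) (lo ρ.2) (hi π.2) (hi ρ.2) c

/-- The two pairs are linked. -/
def Arrow (π ρ : J × Fin 3) : Prop := ∃ c, 𝓜.PairLink π ρ c

/-- `π` is the nearest pair having an arrow to `ρ`. -/
def IsNear (π ρ : J × Fin 3) : Prop := 𝓜.Arrow π ρ ∧ ∀ σ, 𝓜.Arrow σ ρ → ¬ 𝓜.Arrow π σ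

variable {𝓜}

theorem Link.exists_pairLink {a b : J} {i p j q : Fin 3} {c : k} (h : 𝓜.Link a b i p j q c) :
    ∃ r s, 𝓜.Arrow (a, r) (b, s) ∧ (r ≠ i ∧ r ≠ j) ∧ (s ≠ p ∧ s ≠ q) := by
  have key : ∀ {i p j q : Fin 3} {c : k}, 𝓜.Link a b i p j q c → i < j →
      ∃ r s, 𝓜.Arrow (a, r) (b, s) ∧ (r ≠ i ∧ r ≠ j) ∧ (s ≠ p ∧ s ≠ q) := by
    intro i p j q c h hij
    obtain ⟨r, rfl, rfl⟩ := exists_lo_hi hij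
    obtain ⟨s, rfl, rfl⟩ := exists_lo_hi (h.lt_iff.1.1 hij)
    exact ⟨r, s, ⟨c, h⟩, ⟨(lo_ne r).symm, (hi_ne r).symm⟩, (lo_ne s).symm, (hi_ne s).symm⟩
  rcases lt_or_gt_of_ne h.ne with hij | hij
  · exact key h hij
  · obtain ⟨r, s, h1, h2, h3⟩ := key h.symm hij
    exact ⟨r, s, h1, h2.symm, h3.symm⟩

theorem Arrow.lt {π ρ : J × Fin 3} (h : 𝓜.Arrow π ρ) :
    𝓜.lt (π.1, lo π.2) (ρ.1, lo ρ.2) := h.choose_spec.tied.1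

theorem Arrow.lt' {π ρ : J × Fin 3} (h : 𝓜.Arrow π ρ) :
    𝓜.lt (π.1, hi π.2) (ρ.1, hi ρ.2) := h.choose_spec.tied'.1

theorem Arrow.irrefl (π : J × Fin 3) : ¬ 𝓜.Arrow π π := fun h => lt_irrefl _ h.lt

theorem Arrow.asymm {π ρ : J × Fin 3} (h : 𝓜.Arrow π ρ) : ¬ 𝓜.Arrow ρ π :=
  fun h' => lt_asymm h.lt h'.lt

theorem Arrow.exists_tied {a b : J} {r s : Fin 3} (h : 𝓜.Arrow (a, r) (b, s)) {i : Fin 3}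
    (hi : i ≠ r) : ∃ p, 𝓜.IsTied a b i p := by
  obtain ⟨c, h⟩ := h
  rcases eq_lo_or_eq_hi hi with rfl | rfl
  · exact ⟨_, h.tied⟩
  · exact ⟨_, h.tied'⟩

theorem Arrow.valid {π ρ : J × Fin 3} (h : 𝓜.Arrow π ρ) :
    (hi π.2 : ℕ) < 𝓜.d π.1 ∧ (hi ρ.2 : ℕ) < 𝓜.d ρ.1 := lt_valid h.lt'

/-- Pairs with arrows to the same pair are linked. -/
theorem PairLink.of_targets {π σ ρ : J × Fin 3} {x y : k} (h1 : 𝓜.PairLink π ρ x)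
    (h2 : 𝓜.PairLink σ ρ y) :
    π = σ ∨ 𝓜.PairLink π σ (x / y) ∨ 𝓜.PairLink σ π (y / x) := by
  obtain ⟨a, r⟩ := π
  obtain ⟨c, s⟩ := σ
  by_cases hac : a = c
  · subst hac
    left
    have e : r = s := lo_hi_injective (h1.tied.eq_of_row h2.tied) (h1.tied'.eq_of_row h2.tied')
    rw [e]
  right
  have aux : ∀ {x y : k}, (x⁻¹ / y⁻¹)⁻¹ = x / y := fun {x y} => by
    rw [inv_div_inv, inv_div]
  -- By `not_incomp_pair` the lower or the upper vectors of the two pairs are comparable. In the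
  -- latter case the links are reversed by `symm`, which inverts their constants.
  by_cases k1 : 𝓜.Incomp (a, lo r) (c, lo s)
  · by_cases k2 : 𝓜.lt (a, hi r) (c, hi s)
    · exact Or.inl (aux ▸ (h1.symm.of_targets h2.symm k2).symm)
    by_cases k3 : 𝓜.lt (c, hi s) (a, hi r)
    · exact Or.inr (aux ▸ (h2.symm.of_targets h1.symm k3).symm)
    exact (not_incomp_pair hac (lo_lt_hi r) (lo_lt_hi s) (lt_valid h1.tied'.1).1
      (lt_valid h2.tied'.1).1 k1 ⟨k2, k3⟩).elim
  · by_cases k2 : 𝓜.lt (a, lo r) (c, lo s)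
    · exact Or.inl (Link.of_targets h1 h2 k2)
    · exact Or.inr (Link.of_targets h2 h1 (by_contra fun k3 => k1 ⟨k2, k3⟩))

/-- Pairs with arrows from the same pair are linked. -/
theorem PairLink.of_sources {π ρ τ : J × Fin 3} {x y : k} (h1 : 𝓜.PairLink π ρ x)
    (h2 : 𝓜.PairLink π τ y) :
    ρ = τ ∨ 𝓜.PairLink ρ τ (y / x) ∨ 𝓜.PairLink τ ρ (x / y) := by
  obtain ⟨a, r⟩ := ρ
  obtain ⟨c, s⟩ := τ
  by_cases hac : a = c
  · subst hac
    left
    have e : r = s := lo_hi_injective (h1.tied.eq_of_col h2.tied) (h1.tied'.eq_of_col h2.tied')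
    rw [e]
  right
  have aux : ∀ {x y : k}, (x⁻¹ / y⁻¹)⁻¹ = x / y := fun {x y} => by
    rw [inv_div_inv, inv_div]
  by_cases k1 : 𝓜.Incomp (a, lo r) (c, lo s)
  · by_cases k2 : 𝓜.lt (a, hi r) (c, hi s)
    · exact Or.inl (aux ▸ (h1.symm.of_sources h2.symm k2).symm)
    by_cases k3 : 𝓜.lt (c, hi s) (a, hi r)
    · exact Or.inr (aux ▸ (h2.symm.of_sources h1.symm k3).symm)
    exact (not_incomp_pair hac (lo_lt_hi r) (lo_lt_hi s) (lt_valid h1.tied'.1).2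
      (lt_valid h2.tied'.1).2 k1 ⟨k2, k3⟩).elim
  · by_cases k2 : 𝓜.lt (a, lo r) (c, lo s)
    · exact Or.inl (Link.of_sources h1 h2 k2)
    · exact Or.inr (Link.of_sources h2 h1 (by_contra fun k3 => k1 ⟨k2, k3⟩))

theorem Arrow.of_targets {π σ ρ : J × Fin 3} (h1 : 𝓜.Arrow π ρ) (h2 : 𝓜.Arrow σ ρ) :
    π = σ ∨ 𝓜.Arrow π σ ∨ 𝓜.Arrow σ π := by
  obtain ⟨x, h1⟩ := h1
  obtain ⟨y, h2⟩ := h2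
  exact (h1.of_targets h2).imp_right (Or.imp (fun h => ⟨_, h⟩) fun h => ⟨_, h⟩)

theorem Arrow.of_sources {π ρ τ : J × Fin 3} (h1 : 𝓜.Arrow π ρ) (h2 : 𝓜.Arrow π τ) :
    ρ = τ ∨ 𝓜.Arrow ρ τ ∨ 𝓜.Arrow τ ρ := by
  obtain ⟨x, h1⟩ := h1
  obtain ⟨y, h2⟩ := h2
  exact (h1.of_sources h2).imp_right (Or.imp (fun h => ⟨_, h⟩) fun h => ⟨_, h⟩)

theorem IsNear.eq_or_arrow {π σ ρ : J × Fin 3} (h : 𝓜.IsNear π ρ) (h' : 𝓜.Arrow σ ρ) :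
    σ = π ∨ 𝓜.Arrow σ π := by
  rcases h'.of_targets h.1 with e | e | e
  · exact Or.inl e
  · exact Or.inr e
  · exact (h.2 _ h' e).elim

theorem IsNear.eq {π σ ρ : J × Fin 3} (h : 𝓜.IsNear π ρ) (h' : 𝓜.IsNear σ ρ) : π = σ := by
  rcases h.eq_or_arrow h'.1 with e | e
  · exact e.symm
  · exact (h'.2 _ h.1 e).elim

/-- The targets of one pair are linearly ordered by arrows, and any but the first has a nearer
source. Together with the uniqueness of the nearest source, nearest arrows thus form disjoint paths.
-/
theorem IsNear.injective {π ρ τ : J × Fin 3} (h : 𝓜.IsNear π ρ) (h' : 𝓜.IsNear π τ) : ρ = τ := by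
  rcases h.1.of_sources h'.1 with e | e | e
  · exact e
  · exact (h'.2 _ e h.1).elim
  · exact (h.2 _ e h'.1).elim

theorem wellFounded_lt [Finite J] : WellFounded 𝓜.lt :=
  haveI : IsTrans _ 𝓜.lt := ⟨fun _ _ _ => lt_trans⟩
  haveI : Std.Irrefl 𝓜.lt := ⟨lt_irrefl⟩
  Finite.wellFounded_of_trans_of_irrefl _

theorem wellFounded_gt [Finite J] : WellFounded fun s t => 𝓜.lt t s :=
  haveI : IsTrans _ fun s t => 𝓜.lt t s := ⟨fun _ _ _ h h' => lt_trans h' h⟩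
  haveI : Std.Irrefl fun s t => 𝓜.lt t s := ⟨lt_irrefl⟩
  Finite.wellFounded_of_trans_of_irrefl _

theorem exists_isNear [Finite J] {σ ρ : J × Fin 3} (h : 𝓜.Arrow σ ρ) : ∃ π, 𝓜.IsNear π ρ := by
  have wf := (InvImage.wf (fun π : J × Fin 3 => (π.1, lo π.2)) (wellFounded_gt (𝓜 := 𝓜)))
  obtain ⟨π, hπ, hmin⟩ := wf.has_min {π | 𝓜.Arrow π ρ} ⟨σ, h⟩
  exact ⟨π, hπ, fun τ hτ h' => hmin τ hτ h'.lt⟩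

theorem IsGeneric.arrow {a b : J} (h : 𝓜.IsGeneric a b) (r : Fin 3) : 𝓜.Arrow (a, r) (b, r) :=
  h.link (lo_lt_hi r).ne

theorem IsGeneric.eq_of_arrow {a b : J} (h : 𝓜.IsGeneric a b) {r s : Fin 3}
    (h' : 𝓜.Arrow (a, r) (b, s)) : r = s := by
  obtain ⟨c, h'⟩ := h'
  exact lo_hi_injective (h.eq h'.tied) (h.eq h'.tied')

/-- An arrow from `σ` to `(a, r)`, composed with the generic link involving `lo r` and `r`, would
leave a single matrix unit at a tied position. So no source of `(b, r)` lies before `(a, r)`. -/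
theorem IsGeneric.arrow_to {a b : J} (h : 𝓜.IsGeneric a b) {σ : J × Fin 3} {r : Fin 3}
    (h' : 𝓜.Arrow σ (b, r)) : σ = (a, r) ∨ 𝓜.Arrow (a, r) σ := by
  rcases h'.of_targets (h.arrow r) with e | ⟨x, e⟩ | e
  · exact Or.inl e
  · exfalso
    obtain ⟨y, h'⟩ := h'
    obtain ⟨c, hc⟩ := h.link (lo_ne r)
    apply h'.tied.2
    have hH := 𝓜.mul_mem e.mem hc.mem
    have e2 := (lo_lt_hi r).ne
    have e3 := (hi_ne r).symm
    have e4 := (lo_ne r).symm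
    simp only [Matrix.add_mul, Matrix.mul_add, Matrix.mul_smul, Matrix.smul_mul,
      Matrix.single_mul_single_same, Matrix.single_mul_single_of_ne _ _ _ _ e2,
      Matrix.single_mul_single_of_ne _ _ _ _ e3, Matrix.single_mul_single_of_ne _ _ _ _ e4,
      smul_zero, add_zero, mul_one] at hH
    exact hH
  · exact Or.inr e

theorem IsGeneric.arrow_from {a b : J} (h : 𝓜.IsGeneric a b) {σ : J × Fin 3} {r : Fin 3}
    (h' : 𝓜.Arrow (a, r) σ) : σ = (b, r) ∨ 𝓜.Arrow σ (b, r) := by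
  rcases h'.of_sources (h.arrow r) with e | e | ⟨x, e⟩
  · exact Or.inl e
  · exact Or.inr e
  · exfalso
    obtain ⟨y, h'⟩ := h'
    obtain ⟨c, hc⟩ := h.link (lo_ne r)
    apply h'.tied.2
    have hH := 𝓜.mul_mem hc.mem e.mem
    have e2 := (lo_lt_hi r).ne'
    have e3 := (hi_ne r)
    have e4 := (lo_ne r)
    simp only [Matrix.add_mul, Matrix.mul_add, Matrix.mul_smul, Matrix.smul_mul,
      Matrix.single_mul_single_same, Matrix.single_mul_single_of_ne _ _ _ _ e2,
      Matrix.single_mul_single_of_ne _ _ _ _ e3, Matrix.single_mul_single_of_ne _ _ _ _ e4,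
      smul_zero, add_zero, mul_one] at hH
    exact hH

/-- Two different generic sources of `b` would have arrows in both directions between their pairs.
-/
theorem IsGeneric.unique_source {a a' b : J} (h : 𝓜.IsGeneric a b) (h' : 𝓜.IsGeneric a' b) :
    a = a' := by
  rcases h.arrow_to (h'.arrow 0) with e | e
  · exact (congrArg Prod.fst e).symm
  · rcases h'.arrow_to (h.arrow 0) with e' | e'
    · exact congrArg Prod.fst e'
    · exact (e.asymm e').elim

theorem IsGeneric.unique_target {a b b' : J} (h : 𝓜.IsGeneric a b) (h' : 𝓜.IsGeneric a b') :
    b = b' := by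
  rcases h.arrow_from (h'.arrow 0) with e | e
  · exact (congrArg Prod.fst e).symm
  · rcases h'.arrow_from (h.arrow 0) with e' | e'
    · exact congrArg Prod.fst e'
    · exact (e.asymm e').elim

/-- If all pairs of an object of dimension three are sources of arrows, the object is the source
of a generic space of morphisms. -/
theorem exists_isGeneric_of_arrows {a : J} {σ : Fin 3 → J × Fin 3}
    (h : ∀ r, 𝓜.Arrow (a, r) (σ r)) : ∃ r, 𝓜.IsGeneric a (σ r).1 := by
  by_contra! hcon
  -- Arrows from two different pairs of `a` into one object involve all three indices of `a`, hence
  -- three tied positions.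
  have hinj : Function.Injective fun r => (σ r).1 := by
    intro r s hrs
    by_contra hne
    apply hcon r
    simp only at hrs
    have h1 := h r
    have h2 := h s
    obtain ⟨p1, t1⟩ := h1.exists_tied (lo_ne r)
    obtain ⟨p2, t2⟩ := h1.exists_tied (hi_ne r)
    obtain ⟨p3, t3⟩ := h2.exists_tied hne
    rw [← hrs] at t3
    have e := (lo_lt_hi r).ne
    have e1 := lo_ne r
    have e2 := hi_ne r
    refine isGeneric_of_three t1 t2 t3 ?_ ?_ ?_ <;> intro e <;> rw [Prod.ext_iff] at e <;>
      simp_all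
  have inc : ∀ {r s : Fin 3}, r ≠ s → ∀ {i p q : Fin 3}, 𝓜.IsTied a (σ r).1 i p →
      𝓜.IsTied a (σ s).1 i q → i ≠ r → i ≠ s → ¬ 𝓜.lt ((σ r).1, p) ((σ s).1, q) := by
    intro r s hrs i p q t1 t2 hir his hlt
    obtain ⟨x, h1⟩ := h r
    obtain ⟨y, h2⟩ := h s
    have key : ∀ {r : Fin 3} {x : k}, 𝓜.PairLink (a, r) (σ r) x → ∀ {i p : Fin 3}, i ≠ r →
        𝓜.IsTied a (σ r).1 i p → ∃ j p' x', j ≠ r ∧ 𝓜.Link a (σ r).1 i p j p' x' := by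
      intro r x h i p hir t
      rcases eq_lo_or_eq_hi hir with rfl | rfl
      · rw [t.eq_of_col h.tied]
        exact ⟨_, _, _, hi_ne r, h⟩
      · rw [t.eq_of_col h.tied']
        exact ⟨_, _, _, lo_ne r, h.symm⟩
    obtain ⟨j, p', x', hj, l1⟩ := key h1 hir t1
    obtain ⟨j', q', y', hj', l2⟩ := key h2 his t2
    have := l1.ne
    have := l2.ne
    exact hcon s (l1.isGeneric_of_lt l2 (by omega) hlt)
  choose pos hpos using fun r => fun i => fun (hi : i ≠ r) => (h r).exists_tied hi
  -- Vector `i` of `a` has a tied image in each of the two targets `σ r` with `r ≠ i`. These six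
  -- images, grouped by `i`, with all multiplicities one, give `3 + 3 = 6`.
  let obj : Fin 6 → Fin 3 := ![1, 2, 2, 0, 1, 0]
  let g : Fin 6 → Fin 3 := ![0, 0, 1, 1, 2, 2]
  have hg : ∀ q, g q ≠ obj q := by decide
  let ps : Fin 6 → Fin 3 := fun q => pos (obj q) (g q) (hg q)
  have hps : ∀ q, 𝓜.IsTied a (σ (obj q)).1 (g q) (ps q) := fun q => hpos _ _ (hg q)
  refine 𝓜.tits (m := 3) (n := 6) (r := 3) (fun r => (σ r).1) hinj
    (fun s t => 𝓜.lt ((σ s.1).1, s.2) ((σ t.1).1, t.2)) (fun s t u => lt_trans)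
    (fun t t' F hF p i h => ⟨F, hF, h⟩) obj ps (fun q => (lt_valid (hps q).1).2) g ?_ ?_
    (fun _ => 1) (fun _ => 1) (by decide) (by decide) ⟨0, by decide⟩
  · intro q q' ho hp
    have t1 := hps q
    have t2 := hps q'
    rw [hp, ho] at t1
    have := t1.eq_of_row t2
    revert q q'
    clear * -
    have : ∀ q q' : Fin 6, obj q = obj q' → g q = g q' → q = q' := by decide
    intro q q' h1 _ _ _ h2
    exact this q q' h1 h2
  · intro q q' hqq hlt
    rcases hqq.lt_or_eq with hl | he
    · exact (hps q).not_lt hl (lt_trans (hps q').1 hlt)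
    · by_cases hobj : obj q' = obj q
      · have t1 := hps q
        have t2 := hps q'
        rw [hobj, ← he] at t2
        rw [hobj, t2.eq_of_col t1] at hlt
        exact lt_irrefl _ hlt
      · have t2 := hps q'
        have hg' := hg q'
        rw [← he] at t2 hg'
        exact inc hobj t2 (hps q) hg' (hg q) hlt

end RadicalModel

end Aggregate

/-! ### Dropped links and propagation of the scaling equations. -/

namespace Aggregate

/-- The basis vector with the larger or the smaller index in a pair. -/
def vec {J : Type w} (π : J × Fin 3) (β : Bool) : J × Fin 3 :=
  (π.1, if β then hi π.2 else lo π.2)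

namespace RadicalModel

variable {k : Type u} [Field k] {J : Type w} (𝓜 : RadicalModel k J)

/-- A choice of one redundant link for each generic space of morphisms. -/
def IsDropping (D : J → Fin 3) : Prop :=
  ∀ a b, 𝓜.IsGeneric a b → 𝓜.IsNear (a, D b) (b, D b) ∧
    ∀ m, (∀ r, r ≠ m → 𝓜.IsNear (a, r) (b, r)) → ¬ 𝓜.IsNear (a, m) (b, m) → D b = lo m

/-- The pairs which are targets of arrows and have not been dropped. -/
def IsFree (D : J → Fin 3) (ρ : J × Fin 3) : Prop :=
  (∃ σ, 𝓜.Arrow σ ρ) ∧ ∀ a, 𝓜.IsGeneric a ρ.1 → ρ.2 ≠ D ρ.1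

variable {𝓜}

/-- If exactly one diagonal link fails to be nearest, the prescribed choice is one of the other two.
The only obstruction would be that none is nearest. -/
theorem exists_isDropping [Finite J] : ∃ D, 𝓜.IsDropping D := by
  classical
  have key : ∀ b, ∃ D : Fin 3, ∀ a, 𝓜.IsGeneric a b → 𝓜.IsNear (a, D) (b, D) ∧
    ∀ m, (∀ r, r ≠ m → 𝓜.IsNear (a, r) (b, r)) → ¬ 𝓜.IsNear (a, m) (b, m) → D = lo m := by
    intro b
    by_cases hb : ∃ a, 𝓜.IsGeneric a b
    swap
    · exact ⟨0, fun a h => (hb ⟨a, h⟩).elim⟩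
    obtain ⟨a, ha⟩ := hb
    suffices hs : ∃ D : Fin 3, 𝓜.IsNear (a, D) (b, D) ∧
        ∀ m, (∀ r, r ≠ m → 𝓜.IsNear (a, r) (b, r)) → ¬ 𝓜.IsNear (a, m) (b, m) → D = lo m by
      obtain ⟨D, hD⟩ := hs
      exact ⟨D, fun a' ha' => by rwa [ha'.unique_source ha]⟩
    by_cases hm : ∃ m, (∀ r, r ≠ m → 𝓜.IsNear (a, r) (b, r)) ∧ ¬ 𝓜.IsNear (a, m) (b, m)
    · obtain ⟨m, hm, hm'⟩ := hm
      refine ⟨lo m, hm _ (lo_ne m), fun m' _ h' => ?_⟩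
      by_cases e : m' = m
      · rw [e]
      · exact (h' (hm m' e)).elim
    by_contra! hcon
    have hnone : ∀ r, ¬ 𝓜.IsNear (a, r) (b, r) := fun r hr => by
      obtain ⟨m, h1, h2, -⟩ := hcon r hr
      exact hm ⟨m, h1, h2⟩
    -- Each `(a, r)` then has an arrow to a nearer source of `(b, r)`. So `a` is generic towards one
    -- of these sources' objects, which must be `b`, and that source would be `(b, r)` itself.
    choose σ hσ using fun r => exists_isNear (ha.arrow r)
    have hs : ∀ r, 𝓜.Arrow (a, r) (σ r) := fun r => by
      rcases ha.arrow_to (hσ r).1 with e | e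
      · exact (hnone r (e ▸ hσ r)).elim
      · exact e
    obtain ⟨r, hr⟩ := exists_isGeneric_of_arrows hs
    have e := hr.unique_target ha
    have e' : σ r = (b, (σ r).2) := by rw [← e]
    have h1 := hs r
    rw [e'] at h1
    have h2 := ha.eq_of_arrow h1
    rw [← h2] at e'
    exact Arrow.irrefl _ (e' ▸ (hσ r).1)
  choose D hD using key
  exact ⟨D, fun a b => hD b a⟩

theorem IsDropping.eq_of_arrow {D} (hD : 𝓜.IsDropping D) {a b : J} (h : 𝓜.IsGeneric a b)
    {σ : J × Fin 3} (h' : 𝓜.Arrow σ (b, D b)) : σ = (a, D b) := by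
  rcases h.arrow_to h' with e | e
  · exact e
  · exact ((hD a b h).1.2 _ h' e).elim

/-- A rescaling compatible with the nearest links to free pairs is compatible with all links to
free pairs. -/
theorem scale_of_near [Finite J] {D} (hD : 𝓜.IsDropping D) (u : J × Fin 3 → k)
    (h : ∀ π ρ c, 𝓜.IsFree D ρ → 𝓜.IsNear π ρ → 𝓜.PairLink π ρ c → u ρ = c * u π)
    {σ ρ : J × Fin 3} {c : k} (hρ : 𝓜.IsFree D ρ) (hl : 𝓜.PairLink σ ρ c) : u ρ = c * u σ := by
  have wf := (InvImage.wf (fun π : J × Fin 3 => (π.1, lo π.2)) (wellFounded_lt (𝓜 := 𝓜)))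
  induction ρ using wf.induction generalizing σ c with
  | h ρ ih =>
  obtain ⟨π, hπ⟩ := exists_isNear ⟨c, hl⟩
  obtain ⟨x, hx⟩ := hπ.1
  have e1 := h π ρ x hρ hπ hx
  rcases hl.of_targets hx with e | e | e
  · subst e
    rwa [Link.const_unique hl hx]
  -- Were `π` dropped, its source `σ` would be the generic one, and `arrow_from` would place `ρ` at
  -- or before `π`.
  · have hfree : 𝓜.IsFree D π := by
      refine ⟨⟨σ, _, e⟩, fun a ha hd => ?_⟩
      have hπ' : π = (π.1, D π.1) := by rw [← hd]
      have hσ : σ = (a, D π.1) := hD.eq_of_arrow ha (hπ' ▸ ⟨_, e⟩)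
      have h1 : 𝓜.Arrow (a, D π.1) ρ := hσ ▸ ⟨c, hl⟩
      rcases ha.arrow_from h1 with e' | e'
      · rw [← hπ'] at e'
        exact Arrow.irrefl _ (e' ▸ hπ.1)
      · rw [← hπ'] at e'
        exact hπ.1.asymm e'
    have e2 := ih π hπ.1.lt hfree e
    rw [e1, e2, ← mul_assoc, mul_div_cancel₀ _ hx.ne_zero]
  · exact (hπ.2 _ ⟨_, hl⟩ ⟨_, e⟩).elim

theorem vec_snd_ne (π : J × Fin 3) (β : Bool) : (vec π β).2 ≠ π.2 := by
  cases β <;> simp [vec, lo_ne, hi_ne]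

theorem PairLink.vec_link {π ρ : J × Fin 3} {c : k} (h : 𝓜.PairLink π ρ c) (β : Bool) :
    ∃ c', 𝓜.Link π.1 ρ.1 (vec π β).2 (vec ρ β).2 (vec π !β).2 (vec ρ !β).2 c' := by
  cases β
  · exact ⟨c, h⟩
  · exact ⟨_, h.symm⟩

/-- The arrow given by a link between pairs with given missing indices. -/
theorem Link.arrow {a b : J} {i p j q : Fin 3} {c : k} (h : 𝓜.Link a b i p j q c) {r s : Fin 3}
    (hi : r ≠ i) (hj : r ≠ j) (hp : s ≠ p) (hq : s ≠ q) : 𝓜.Arrow (a, r) (b, s) := by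
  obtain ⟨r', s', h1, ⟨h2, h3⟩, h4, h5⟩ := h.exists_pairLink
  have := h.ne
  have := h.lt_iff.2
  have e1 : r = r' := by omega
  have e2 : s = s' := by omega
  rwa [e1, e2]

/-- A nearest link does not pass beside a vector of an object all of whose pairs containing the
first vector are nearest sources of free pairs. -/
theorem not_bypass [Finite J] {D} (hD : 𝓜.IsDropping D) {b : J}
    (hb : ∀ r, r ≠ 0 → ∃ τ, 𝓜.IsFree D τ ∧ 𝓜.IsNear (b, r) τ) {π ρ : J × Fin 3}
    (hρ : 𝓜.IsFree D ρ) (hn : 𝓜.IsNear π ρ) (β : Bool) {l : Fin 3} (hl : l ≠ 0)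
    (h1 : 𝓜.lt (vec π β) (b, l)) (h2 : 𝓜.lt (b, l) (vec ρ β)) : False := by
  obtain ⟨c, hc⟩ := hn.1
  obtain ⟨a, r⟩ := π
  obtain ⟨b', s⟩ := ρ
  obtain ⟨c', hc'⟩ := hc.vec_link β
  have ei := vec_snd_ne (a, r) β
  have ej := vec_snd_ne (a, r) (!β)
  have ep := vec_snd_ne (b', s) β
  have eq := vec_snd_ne (b', s) (!β)
  change 𝓜.lt (a, (vec (a, r) β).2) (b, l) at h1
  change 𝓜.lt (b, l) (b', (vec (b', s) β).2) at h2
  simp only at ei ej ep eq hc'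
  generalize (vec (a, r) β).2 = i at *
  generalize (vec (a, r) (!β)).2 = j at *
  generalize (vec (b', s) β).2 = p at *
  generalize (vec (b', s) (!β)).2 = q at *
  obtain ⟨t1, t2, t3⟩ := hc'.tied.factor h1 h2
  obtain ⟨j', n, x, hx⟩ := t1.exists_link
  obtain ⟨q', y, hy, t4⟩ := t3 j' n x hx
  have hij := hc'.ne
  have hij' := hx.ne
  have hpq := hc'.lt_iff.2
  have hpq' := hy.lt_iff.2
  have hln := hx.lt_iff.2
  -- If the second tied position agrees, the whole link factors through a pair of `b`, contrary to
  -- nearness. Otherwise three positions are tied and `a` is generic towards `b'`.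
  by_cases hj : j' = j
  · subst hj
    have : q' = q := t4.eq_of_col hc'.tied'
    subst this
    obtain ⟨o, ho1, ho2⟩ : ∃ o : Fin 3, o ≠ l ∧ o ≠ n := by
      have : ∀ p p' : Fin 3, ∃ q : Fin 3, q ≠ p ∧ q ≠ p' := by decide
      exact this l n
    exact hn.2 _ (hy.arrow ho1 ho2 ep.symm eq.symm) (hx.arrow ei.symm ej.symm ho1 ho2)
  · have hjr : j' = r := by omega
    subst hjr
    have hg : 𝓜.IsGeneric a b' := isGeneric_of_three hc'.tied hc'.tied' t4
      (fun e => hij (congrArg Prod.fst e)) (fun e => hij' (congrArg Prod.fst e))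
      (fun e => hj (congrArg Prod.fst e).symm)
    have e1 := hg.eq hc'.tied
    have e2 := hg.eq hc'.tied'
    have e3 := hg.eq t4
    subst e1 e2 e3
    have e4 : s = j' := by omega
    subst e4
    obtain ⟨o, ho1, ho2⟩ : ∃ o : Fin 3, o ≠ l ∧ o ≠ n := by
      have : ∀ p p' : Fin 3, ∃ q : Fin 3, q ≠ p ∧ q ≠ p' := by decide
      exact this l n
    have a1 := hx.arrow hij.symm (Ne.symm hj) ho1 ho2
    have a2 := hy.arrow ho1 ho2 hij.symm (Ne.symm hj)
    -- The link that factors through `b` is not nearest, so it is not the dropped one; nor is `s`,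
    -- which is free. Hence `i` is dropped, and the second clause of `IsDropping` forces `i = lo j`,
    -- so `i < s`. With `l ≠ 0` this leaves `o = 0`.
    have nj : ¬ 𝓜.IsNear (a, j) (b', j) := fun h => h.2 _ a2 a1
    have hDs : s ≠ D b' := hρ.2 a hg
    have hDj : j ≠ D b' := fun e => nj (e ▸ (hD a b' hg).1)
    have hDi : i = D b' := by omega
    have hDl := (hD a b' hg).2 j (fun r hr => by
      have : r = i ∨ r = s := by omega
      rcases this with rfl | rfl
      · rw [hDi]; exact (hD a b' hg).1
      · exact hn) nj
    rw [← hDi] at hDl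
    have his : i < s := by
      rcases eq_lo_or_eq_hi hj with h | h
      · exact (hij' (hDl.trans h.symm)).elim
      · rw [h, hDl]; exact lo_lt_hi j
    have hln' := hx.lt_iff.1.1 his
    have ho : o = 0 := by omega
    subst ho
    have hσ : ∀ r, ∃ τ, 𝓜.Arrow (b, r) τ ∧ (r = 0 → τ = (b', j)) := by
      intro r
      by_cases hr : r = 0
      · subst hr
        exact ⟨_, a2, fun _ => rfl⟩
      · obtain ⟨τ, -, hτ⟩ := hb r hr
        exact ⟨τ, hτ.1, fun h => (hr h).elim⟩
    choose σ hσ hσ0 using hσ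
    -- Now all three pairs of `b` are sources, so `b` is generic towards some `b''`. The dropped
    -- index there is not 0, as that link is not nearest; but nonzero indices lead to free pairs, by
    -- `hb`.
    obtain ⟨r, hr⟩ := exists_isGeneric_of_arrows hσ
    generalize (σ r).1 = b'' at hr
    have n0 : ¬ 𝓜.IsNear (b, 0) (b'', 0) := by
      intro hnear
      rcases hr.arrow_from a2 with e | e
      · have e' : b' = b'' := congrArg Prod.fst e
        subst e'
        have := hg.unique_source hr
        subst this
        have := hr.eq hy.tied
        subst this
        exact lt_irrefl _ h1
      · exact hnear.2 _ e a2
    have hD0 : D b'' ≠ 0 := fun e => n0 (e ▸ (hD b b'' hr).1)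
    obtain ⟨τ, hτ1, hτ2⟩ := hb _ hD0
    have := hτ2.injective (hD b b'' hr).1
    subst this
    exact hτ1.2 b hr rfl

end RadicalModel

end Aggregate

/-! ### Integral independence of the scaling equations. -/

namespace Aggregate

/-- The sign of a vector in a pair. -/
def sgn (β : Bool) : ℤ := if β then -1 else 1

open Classical in
theorem sum_vec {J : Type w} [Fintype J] (g : J × Fin 3 → ℤ) (b : J) (i : Fin 3) :
    ∑ e : (J × Fin 3) × Bool, sgn e.2 * g e.1 * (if vec e.1 e.2 = (b, i) then 1 else 0) =
      ∑ r, g (b, r) * ((if lo r = i then 1 else 0) - if hi r = i then 1 else 0) := by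
  rw [Fintype.sum_prod_type, Fintype.sum_prod_type, Finset.sum_eq_single b]
  · refine Finset.sum_congr rfl fun r _ => ?_
    simp only [Fintype.sum_bool, sgn, vec, Prod.mk.injEq, true_and, if_true, Bool.false_eq_true,
      if_false]
    ring
  · intro a _ hab
    refine Finset.sum_eq_zero fun r _ => Finset.sum_eq_zero fun β _ => ?_
    rw [if_neg fun e => hab (congrArg Prod.fst e), mul_zero]
  · exact fun h => (h (Finset.mem_univ _)).elim

namespace RadicalModel

variable {k : Type u} [Field k] {J : Type w} {𝓜 : RadicalModel k J}

section Independence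

variable [Fintype J] {D : J → Fin 3} {n : J × Fin 3 → ℤ} {near : J × Fin 3 → J × Fin 3}

open Classical in
/-- The flow arriving at the sources of nearest arrows. -/
noncomputable def outflow (n : J × Fin 3 → ℤ) (near : J × Fin 3 → J × Fin 3) (π : J × Fin 3) : ℤ :=
  ∑ ρ, if near ρ = π then n ρ else 0

open Classical in
theorem sum_outflow (s : J × Fin 3) :
    ∑ e : (J × Fin 3) × Bool, sgn e.2 * n e.1 * (if vec (near e.1) e.2 = s then 1 else 0) =
    ∑ e : (J × Fin 3) × Bool, sgn e.2 * outflow n near e.1 *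
      (if vec e.1 e.2 = s then 1 else 0) := by
  simp only [outflow]
  rw [Fintype.sum_prod_type_right, Fintype.sum_prod_type_right]
  refine Finset.sum_congr rfl fun β _ => ?_
  simp only [Finset.mul_sum, Finset.sum_mul]
  rw [Finset.sum_comm]
  refine Finset.sum_congr rfl fun ρ _ => ?_
  rw [Finset.sum_eq_single (near ρ)]
  · rw [if_pos rfl]
  · intro π _ h
    rw [if_neg h.symm, mul_zero, zero_mul]
  · exact fun h => (h (Finset.mem_univ _)).elim

theorem exists_of_outflow_ne_zero {π : J × Fin 3} (h : outflow n near π ≠ 0) :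
    ∃ ρ, n ρ ≠ 0 ∧ near ρ = π := by
  classical
  obtain ⟨ρ, -, hρ⟩ := Finset.exists_ne_zero_of_sum_ne_zero h
  by_cases e : near ρ = π
  · exact ⟨ρ, by rwa [if_pos e] at hρ, e⟩
  · exact (hρ (if_neg e)).elim

theorem outflow_near (hn : ∀ ρ, n ρ ≠ 0 → 𝓜.IsFree D ρ)
    (hnear : ∀ ρ, 𝓜.IsFree D ρ → 𝓜.IsNear (near ρ) ρ) {ρ : J × Fin 3} (h : n ρ ≠ 0) :
    outflow n near (near ρ) = n ρ := by
  classical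
  rw [outflow, Finset.sum_eq_single ρ]
  · rw [if_pos rfl]
  · intro τ _ hτ
    split_ifs with e
    · by_contra h'
      exact hτ (IsNear.injective (e ▸ hnear τ (hn τ h')) (hnear ρ (hn ρ h)))
    · rfl
  · exact fun h => (h (Finset.mem_univ _)).elim

/-- Outflow from all three pairs would make `b` a generic source, with one of the three nearest
arrows ending in the dropped pair, which carries no flow. -/
theorem outflow_eq_zero_of_forall (hD : 𝓜.IsDropping D) (hn : ∀ ρ, n ρ ≠ 0 → 𝓜.IsFree D ρ)
    (hnear : ∀ ρ, 𝓜.IsFree D ρ → 𝓜.IsNear (near ρ) ρ) (b : J) :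
    ∃ r, outflow n near (b, r) = 0 := by
  by_contra! h
  choose ρ hρ hρ' using fun r => exists_of_outflow_ne_zero (h r)
  have hs : ∀ r, 𝓜.IsNear (b, r) (ρ r) := fun r => hρ' r ▸ hnear _ (hn _ (hρ r))
  obtain ⟨r, hr⟩ := exists_isGeneric_of_arrows fun r => (hs r).1
  generalize (ρ r).1 = b' at hr
  have e := (hs (D b')).injective (hD b b' hr).1
  have hf := hn _ (hρ (D b'))
  rw [e] at hf
  exact hf.2 b hr rfl

/-- Edges crossing the set of the predecessors of a vector strictly below it. -/
def Crosses (𝓜 : RadicalModel k J) (near : J × Fin 3 → J × Fin 3) (s : J × Fin 3)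
    (e : (J × Fin 3) × Bool) : Prop :=
  𝓜.lt (vec (near e.1) e.2) s ∧ ¬ 𝓜.le (vec e.1 e.2) s

theorem Arrow.vec_lt {π ρ : J × Fin 3} (h : 𝓜.Arrow π ρ) (β : Bool) :
    𝓜.lt (vec π β) (vec ρ β) := by
  cases β
  · exact h.lt
  · exact h.lt'

-- The relation is summed over all vectors below or equal to `(b, i)`. Edges with both ends in this
-- down-set cancel. What remains are the edges starting at `(b, i)` and the edges that cross its
-- boundary from strictly below.
open Classical in
theorem sum_crosses (hn : ∀ ρ, n ρ ≠ 0 → 𝓜.IsFree D ρ)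
    (hnear : ∀ ρ, 𝓜.IsFree D ρ → 𝓜.IsNear (near ρ) ρ)
    (hrel : ∀ s, ∑ e : (J × Fin 3) × Bool, sgn e.2 * n e.1 *
      ((if vec (near e.1) e.2 = s then 1 else 0) - if vec e.1 e.2 = s then 1 else 0) = 0)
    (b : J) (i : Fin 3) :
    ∑ r, outflow n near (b, r) * ((if lo r = i then 1 else 0) - if hi r = i then 1 else 0) +
    ∑ e : (J × Fin 3) × Bool, sgn e.2 * n e.1 *
      (if 𝓜.Crosses near (b, i) e then 1 else 0) = 0 := by
  rw [← sum_vec, ← sum_outflow, ← Finset.sum_add_distrib]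
  have h0 : ∑ s with 𝓜.le s (b, i), ∑ e : (J × Fin 3) × Bool, sgn e.2 * n e.1 *
      ((if vec (near e.1) e.2 = s then 1 else 0) - if vec e.1 e.2 = s then (1 : ℤ) else 0) = 0 :=
    Finset.sum_eq_zero fun s _ => hrel s
  rw [Finset.sum_comm] at h0
  refine Eq.trans (Finset.sum_congr rfl fun e _ => ?_) h0
  rw [← Finset.mul_sum, mul_assoc, mul_assoc, mul_assoc, ← mul_add, ← mul_add]
  by_cases hne : n e.1 = 0
  · rw [hne, zero_mul, zero_mul]
  congr 2
  rw [Finset.sum_sub_distrib, Finset.sum_ite_eq, Finset.sum_ite_eq]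
  simp only [Finset.mem_filter_univ]
  have hlt := (hnear _ (hn _ hne)).1.vec_lt e.2
  have htr := isCompatible_le (𝓜 := 𝓜)
  by_cases h1 : vec (near e.1) e.2 = (b, i)
  · rw [h1] at hlt
    have h2 : ¬ 𝓜.le (vec e.1 e.2) (b, i) := htr.not_of_lt _ _ hlt
    have h3 : ¬ 𝓜.Crosses near (b, i) e := fun h => lt_irrefl _ (h1 ▸ h.1)
    rw [if_pos h1, if_neg h2, if_neg h3, if_pos (show 𝓜.le _ _ from Or.inl h1)]
    rfl
  · rw [if_neg h1]
    by_cases h2 : 𝓜.lt (vec (near e.1) e.2) (b, i)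
    · rw [if_pos (show 𝓜.le _ _ from Or.inr h2)]
      by_cases h3 : 𝓜.le (vec e.1 e.2) (b, i)
      · rw [if_neg (fun h : 𝓜.Crosses near (b, i) e => h.2 h3), if_pos h3]
        rfl
      · rw [if_pos (show 𝓜.Crosses near (b, i) e from ⟨h2, h3⟩), if_neg h3]
        rfl
    · have h3 : ¬ 𝓜.le (vec (near e.1) e.2) (b, i) := fun h => h.elim h1 h2
      have h4 : ¬ 𝓜.le (vec e.1 e.2) (b, i) := fun h =>
        h3 (htr.trans _ _ _ (Or.inr hlt) h)
      rw [if_neg h3, if_neg h4, if_neg fun h : 𝓜.Crosses near (b, i) e => h2 h.1]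
      rfl

open Classical in
/-- The vectors of the nearest links to free pairs are linearly independent over the integers. -/
theorem eq_zero_of_relation (hD : 𝓜.IsDropping D) (hn : ∀ ρ, n ρ ≠ 0 → 𝓜.IsFree D ρ)
    (hnear : ∀ ρ, 𝓜.IsFree D ρ → 𝓜.IsNear (near ρ) ρ)
    (hrel : ∀ s, ∑ e : (J × Fin 3) × Bool, sgn e.2 * n e.1 *
      ((if vec (near e.1) e.2 = s then 1 else 0) - if vec e.1 e.2 = s then 1 else 0) = 0) :
    n = 0 := by
  by_contra hne
  obtain ⟨ρ₀, hρ₀⟩ : ∃ ρ, n ρ ≠ 0 := by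
    by_contra! h
    exact hne (funext h)
  set m := outflow n near with hm
  -- The differences of outflow and inflow at the three pairs of `b` are proportional to `(1, -1,
  -- 1)`, because the three vectors `e_lo - e_hi` satisfy just this one relation.
  have hbal : ∀ b i, ∑ r, (m (b, r) - n (b, r)) *
      ((if lo r = i then 1 else 0) - if hi r = i then 1 else 0) = 0 := by
    intro b i
    have h := hrel (b, i)
    simp only [mul_sub] at h
    rw [Finset.sum_sub_distrib, sum_outflow, sum_vec, sum_vec, ← Finset.sum_sub_distrib] at h
    exact Eq.trans (Finset.sum_congr rfl fun r _ => by rw [hm]; ring) h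
  have wf := (InvImage.wf (fun π : J × Fin 3 => (π.1, lo π.2)) (wellFounded_lt (𝓜 := 𝓜)))
  obtain ⟨⟨b, r⟩, hr, hmin⟩ := wf.has_min {π | m π ≠ 0}
    ⟨near ρ₀, by rw [Set.mem_ofPred_eq, hm, outflow_near hn hnear hρ₀]; exact hρ₀⟩
  have hvm : ∀ π, m π ≠ 0 → (hi π.2 : ℕ) < 𝓜.d π.1 := fun π h => by
    obtain ⟨ρ, h1, rfl⟩ := exists_of_outflow_ne_zero h
    exact (hnear _ (hn _ h1)).1.valid.1
  have hvn : ∀ π, n π ≠ 0 → (hi π.2 : ℕ) < 𝓜.d π.1 := fun π h =>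
    (hnear _ (hn _ h)).1.valid.2
  -- Flow into such a pair would come from a source with a smaller lower vector, against minimality.
  have hn0 : ∀ r', lo r' ≤ lo r → n (b, r') = 0 := by
    intro r' hle
    by_contra h
    refine hmin (near (b, r')) ?_ ?_
    · rw [Set.mem_ofPred_eq, hm, outflow_near hn hnear h]; exact h
    · have h1 := (hnear _ (hn _ h)).1.lt
      have h2 := hvm _ hr
      have := lo_lt_hi r
      exact lt_succ h1 hle (by simp only at h2 ⊢; omega)
  have b0 := hbal b 0
  have b1 := hbal b 1
  have e0 : lo 0 = 1 := rfl
  have e1 : lo 1 = 0 := rfl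
  have e2 : lo 2 = 0 := rfl
  have f0 : hi 0 = 2 := rfl
  have f1 : hi 1 = 2 := rfl
  have f2 : hi 2 = 1 := rfl
  simp [Fin.sum_univ_three, e0, e1, e2, f0, f1, f2] at b0 b1
  have hr' : m (b, r) ≠ 0 := hr
  have hnr := hn0 r le_rfl
  have hδ : m (b, 0) - n (b, 0) ≠ 0 := by
    have : r = 0 ∨ r = 1 ∨ r = 2 := by omega
    rcases this with rfl | rfl | rfl <;> omega
  have hd : 𝓜.d b = 3 := by
    have h1 := hvm (b, 0)
    have h2 := hvn (b, 0)
    have h3 := 𝓜.d_le b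
    simp only [f0] at h1 h2
    change _ → 2 < _ at h1
    change _ → 2 < _ at h2
    omega
  -- Some pair of `b` has no outflow. As all three differences are nonzero and there is no inflow at
  -- pairs with lower vector at most that of `r`, this leaves `r₀ = 0`, with opposite nonzero
  -- outflows at the pairs missing 1 and 2.
  obtain ⟨r₀, hr₀⟩ := outflow_eq_zero_of_forall hD hn hnear b
  rw [← hm] at hr₀
  have hr0 : r ≠ 0 := by
    rintro rfl
    have g1 := hn0 1 (by decide)
    have g2 := hn0 2 (by decide)
    have : r₀ = 0 ∨ r₀ = 1 ∨ r₀ = 2 := by omega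
    rcases this with rfl | rfl | rfl <;> omega
  have hlr : lo r = 0 := by
    have : ∀ r : Fin 3, r ≠ 0 → lo r = 0 := by decide
    exact this r hr0
  have g1 := hn0 1 (by rw [hlr]; decide)
  have g2 := hn0 2 (by rw [hlr]; decide)
  have m0 : m (b, 0) = 0 := by
    have : r₀ = 0 ∨ r₀ = 1 ∨ r₀ = 2 := by omega
    rcases this with rfl | rfl | rfl <;> omega
  have m1 : m (b, 1) ≠ 0 := by omega
  have m2 : m (b, 2) = - m (b, 1) := by omega
  have hb : ∀ r, r ≠ 0 → ∃ τ, 𝓜.IsFree D τ ∧ 𝓜.IsNear (b, r) τ := by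
    intro r h
    have : m (b, r) ≠ 0 := by
      have : r = 1 ∨ r = 2 := by omega
      rcases this with rfl | rfl <;> omega
    obtain ⟨ρ, h1, h2⟩ := exists_of_outflow_ne_zero this
    exact ⟨ρ, hn _ h1, h2 ▸ hnear _ (hn _ h1)⟩
  have hvb : ∀ i : Fin 3, (i : ℕ) < 𝓜.d b := fun i => by rw [hd]; exact i.2
  -- By `not_bypass` the end of a crossing edge is incomparable to `(b, i)`. Since `b` has dimension
  -- three, the object of that end has dimension two.
  have hinc : ∀ i, i ≠ 0 → ∀ e, n e.1 ≠ 0 → 𝓜.Crosses near (b, i) e →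
      𝓜.d e.1.1 = 2 ∧ 𝓜.Incomp (vec e.1 e.2) (b, i) := by
    intro i hi0 e he hc
    have hf := hn _ he
    have hinc : 𝓜.Incomp (vec e.1 e.2) (b, i) := ⟨fun h => hc.2 (Or.inr h), fun h =>
      not_bypass hD hb hf (hnear _ hf) e.2 hi0 hc.1 h⟩
    have hne : e.1.1 ≠ b := by
      intro h
      have hv : vec e.1 e.2 = (b, (vec e.1 e.2).2) := by rw [← h]; rfl
      rw [hv] at hinc
      rcases lt_trichotomy (vec e.1 e.2).2 i with h1 | h1 | h1
      · exact hinc.1 (lt_of_index h1 (hvb _))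
      · exact hc.2 (Or.inl (by rw [hv, h1]))
      · exact hinc.2 (lt_of_index h1 (hvb _))
    refine ⟨?_, hinc⟩
    have h1 := hvn _ he
    have h2 := 𝓜.d_le e.1.1
    have h3 : 𝓜.d e.1.1 ≠ 3 := fun h => not_incomp_of_three hne h hd _ i hinc
    have h4 : ∀ r : Fin 3, 1 ≤ (hi r : ℕ) := by decide
    have := h4 e.1.2
    omega
  -- `eq_of_incomp` identifies the ends of edges crossing at `(b, 1)` and `(b, 2)`, and a
  -- two-dimensional object has only one pair.
  have heq : ∀ e e', n e.1 ≠ 0 → n e'.1 ≠ 0 → 𝓜.Crosses near (b, 1) e →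
      𝓜.Crosses near (b, 2) e' → e = e' := by
    rintro ⟨⟨c, x⟩, β⟩ ⟨⟨c', x'⟩, β'⟩ he he' h h'
    obtain ⟨d1, i1⟩ := hinc 1 (by decide) _ he h
    obtain ⟨d2, i2⟩ := hinc 2 (by decide) _ he' h'
    have v1 := hvn _ he
    have v2 := hvn _ he'
    simp only at d1 d2 v1 v2 i1 i2
    rw [d1] at v1
    rw [d2] at v2
    have hx : ∀ x : Fin 3, (hi x : ℕ) < 2 → x = 2 := by decide
    obtain rfl := hx x v1
    obtain rfl := hx x' v2
    have hv : ∀ c : J, ∀ β, ((vec (c, 2) β).2 : ℕ) < 2 := fun c β => by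
      cases β <;> simp [vec, e2, f2]
    have := eq_of_incomp hd (t := vec (c, 2) β) (t' := vec (c', 2) β') d1 d2 (hv _ _) (hv _ _)
      (show (1 : Fin 3) < 2 by decide) i1 i2
    rw [Prod.ext_iff] at this
    obtain ⟨h1, h2⟩ := this
    simp only [vec] at h1 h2
    subst h1
    cases β <;> cases β' <;> simp [e2, f2] at h2 ⊢
  have s1 := sum_crosses hn hnear hrel b 1
  have s2 := sum_crosses hn hnear hrel b 2
  rw [← hm] at s1 s2
  simp [Fin.sum_univ_three, e0, e1, e2, f0, f1, f2, m0] at s1 s2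
  by_cases c1 : ∃ e, n e.1 ≠ 0 ∧ 𝓜.Crosses near (b, 1) e
  swap
  · rw [Finset.sum_eq_zero] at s1
    · omega
    · intro e _
      split_ifs with h
      · by_cases h0 : n e.1 = 0
        · rw [h0, mul_zero]
        · exact (c1 ⟨e, h0, h⟩).elim
      · rfl
  by_cases c2 : ∃ e, n e.1 ≠ 0 ∧ 𝓜.Crosses near (b, 2) e
  swap
  · rw [Finset.sum_eq_zero] at s2
    · omega
    · intro e _
      split_ifs with h
      · by_cases h0 : n e.1 = 0
        · rw [h0, mul_zero]
        · exact (c2 ⟨e, h0, h⟩).elim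
      · rfl
  obtain ⟨x, hx, hx'⟩ := c1
  obtain ⟨y, hy, hy'⟩ := c2
  have hiff : ∀ e, n e.1 ≠ 0 → (𝓜.Crosses near (b, 1) e ↔ 𝓜.Crosses near (b, 2) e) := by
    intro e he
    constructor
    · intro h
      rwa [heq e y he hy h hy']
    · intro h
      rwa [← heq x e hx he hx' h]
  -- The two crossing sums equal `m (b, 2)` and `m (b, 1)`. Their equality contradicts `m (b, 2) = -
  -- m (b, 1) ≠ 0` in `ℤ`.
  have : ∑ e : (J × Fin 3) × Bool, (if 𝓜.Crosses near (b, 1) e then sgn e.2 * n e.1 else 0) =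
      ∑ e : (J × Fin 3) × Bool, (if 𝓜.Crosses near (b, 2) e then sgn e.2 * n e.1 else 0) := by
    refine Finset.sum_congr rfl fun e _ => ?_
    by_cases h0 : n e.1 = 0
    · simp [h0]
    · simp only [hiff e h0]
  omega

end Independence

end RadicalModel

end Aggregate

/-! ### Solving the scaling equations in the multiplicative group. -/

namespace Aggregate

/-- Linearly independent integral systems of monomial equations are solvable in the units of an
algebraically closed field. -/
theorem exists_addMonoidHom_units {k : Type u} [Field k] [IsAlgClosed k] {ι : Type*} {A : Type*}
    [AddCommGroup A] (w : ι → A) (hw : LinearIndependent ℤ w) (c : ι → kˣ) :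
    ∃ χ : A →+ Additive kˣ, ∀ i, χ (w i) = Additive.ofMul (c i) := by
  have hdiv : ∀ {n : ℕ} (_ : n ≠ 0) (x : Additive kˣ), ∃ y : Additive kˣ, n • y = x := by
    intro n hn x
    obtain ⟨z, hz⟩ := IsAlgClosed.exists_pow_nat_eq ((Additive.toMul x : kˣ) : k)
      (Nat.pos_of_ne_zero hn)
    have hz0 : z ≠ 0 := by
      rintro rfl
      rw [zero_pow hn] at hz
      exact (Additive.toMul x).ne_zero hz.symm
    refine ⟨Additive.ofMul (Units.mk0 z hz0), ?_⟩
    apply Additive.toMul.injective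
    ext
    simpa using hz
  let : DivisibleBy (Additive kˣ) ℕ :=
    divisibleByOfSMulRightSurj (A := Additive kˣ) (α := ℕ) fun hn x => hdiv hn x
  let : DivisibleBy (Additive kˣ) ℤ := AddGroup.divisibleByIntOfDivisibleByNat _
  -- Divisible abelian groups are injective, so the homomorphism prescribed on the free group
  -- spanned by `w` extends to `A`.
  obtain ⟨χ, hχ⟩ := (Module.Baer.of_divisible (Additive kˣ)).extension_property
    (Finsupp.linearCombination ℤ w) hw
    (Finsupp.linearCombination ℤ fun i => Additive.ofMul (c i))
  refine ⟨χ.toAddMonoidHom, fun i => ?_⟩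
  have := LinearMap.congr_fun hχ (Finsupp.single i 1)
  simpa using this

namespace RadicalModel

variable {k : Type u} [Field k] {J : Type w} {𝓜 : RadicalModel k J}

/-- There is a rescaling compatible with all links to free pairs. -/
theorem exists_scale [IsAlgClosed k] [Finite J] {D} (hD : 𝓜.IsDropping D) :
    ∃ s : J → Fin 3 → k, (∀ a i, s a i ≠ 0) ∧ ∀ π ρ c, 𝓜.IsFree D ρ → 𝓜.PairLink π ρ c →
      s ρ.1 (hi ρ.2) / s ρ.1 (lo ρ.2) = c * (s π.1 (hi π.2) / s π.1 (lo π.2)) := by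
  classical
  have := Fintype.ofFinite J
  have hex : ∀ ρ, ∃ π, 𝓜.IsFree D ρ → 𝓜.IsNear π ρ := fun ρ => by
    by_cases h : 𝓜.IsFree D ρ
    · obtain ⟨σ, hσ⟩ := h.1
      obtain ⟨π, hπ⟩ := exists_isNear hσ
      exact ⟨π, fun _ => hπ⟩
    · exact ⟨ρ, fun h' => (h h').elim⟩
  choose near hnear using hex
  choose c hc using fun ρ : {ρ // 𝓜.IsFree D ρ} => (hnear ρ.1 ρ.2).1
  let e : J × Fin 3 → J × Fin 3 → ℤ := fun s => Pi.single s 1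
  -- The exponent vector of the equation for `ρ`: the ratio of upper to lower scalar at `ρ`, divided
  -- by the same ratio at its nearest source.
  let w : J × Fin 3 → J × Fin 3 → ℤ := fun ρ => (e (vec ρ true) - e (vec ρ false)) -
    (e (vec (near ρ) true) - e (vec (near ρ) false))
  have hw : LinearIndependent ℤ fun ρ : {ρ // 𝓜.IsFree D ρ} => w ρ := by
    rw [Fintype.linearIndependent_iff]
    intro g hg
    let n : J × Fin 3 → ℤ := fun ρ => if h : 𝓜.IsFree D ρ then g ⟨ρ, h⟩ else 0
    have hn : ∀ ρ, n ρ ≠ 0 → 𝓜.IsFree D ρ := fun ρ h => by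
      by_contra h'
      exact h (dif_neg h')
    have h0 : n = 0 := by
      refine eq_zero_of_relation hD hn hnear fun s => ?_
      have h1 := congrFun hg s
      rw [Finset.sum_apply, Pi.zero_apply] at h1
      rw [Fintype.sum_prod_type]
      have h2 : ∑ ρ, n ρ * w ρ s = ∑ ρ : {ρ // 𝓜.IsFree D ρ}, (g ρ • w ρ) s := by
        rw [← Finset.sum_filter_of_ne (p := 𝓜.IsFree D) fun ρ _ h => hn ρ (left_ne_zero_of_mul h),
          Finset.sum_subtype (p := 𝓜.IsFree D) _ (by simp)]
        refine Finset.sum_congr rfl fun ρ _ => ?_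
        simp [n, ρ.2]
      refine Eq.trans (Finset.sum_congr rfl fun ρ _ => ?_) (h2.trans h1)
      simp only [Fintype.sum_bool, sgn, w, e, Pi.sub_apply, Pi.single_apply, if_true,
        Bool.false_eq_true, if_false, eq_comm (a := s)]
      ring
    intro ρ
    have := congrFun h0 ρ.1
    simpa [n, ρ.2] using this
  obtain ⟨χ, hχ⟩ := exists_addMonoidHom_units _ hw fun ρ => Units.mk0 (c ρ) (hc ρ).ne_zero
  let t : J × Fin 3 → kˣ := fun s => Additive.toMul (χ (e s))
  refine ⟨fun a i => (t (a, i) : k), fun a i => (t (a, i)).ne_zero, ?_⟩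
  intro σ ρ x hρ hl
  refine scale_of_near hD (fun π => (t (π.1, hi π.2) : k) / t (π.1, lo π.2)) ?_ hρ hl
  intro π ρ x hρ hn hx
  have hπ := (hnear ρ hρ).eq hn
  subst hπ
  have hx' := Link.const_unique hx (hc ⟨ρ, hρ⟩)
  subst hx'
  have h1 := congrArg (fun z => ((Additive.toMul z : kˣ) : k)) (hχ ⟨ρ, hρ⟩)
  simp only [w, map_sub, toMul_sub, Units.val_div_eq_div_val, toMul_ofMul, Units.val_mk0] at h1
  rw [← h1]
  have := (t (vec (near ρ) true)).ne_zero
  have := (t (vec (near ρ) false)).ne_zero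
  change (t (vec ρ true) : k) / t (vec ρ false) =
    ((t (vec ρ true) : k) / t (vec ρ false)) / (t (vec (near ρ) true) / t (vec (near ρ) false)) *
      (t (vec (near ρ) true) / t (vec (near ρ) false))
  field_simp

end RadicalModel

end Aggregate

/-! ### Normal matrices span the radical spaces; conclusion. -/

namespace Aggregate

namespace RadicalModel

variable {k : Type u} [Field k] {J : Type w} {𝓜 : RadicalModel k J}

theorem eq_zero_of_support_subset {a b : J} {i p : Fin 3} (h : 𝓜.IsTied a b i p) {T}
    (hT : T ∈ 𝓜.R a b) (hz : ∀ r l, T r l ≠ 0 → (l, r) = (i, p)) : T = 0 := by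
  ext r l
  by_contra hne
  have e := hz r l hne
  rw [Prod.mk.injEq] at e
  obtain ⟨rfl, rfl⟩ := e
  refine h.2 (single_mem_of_lead T hT r l hne fun r' l' hn => ?_)
  left
  by_contra h'
  have e := hz r' l' h'
  rw [Prod.mk.injEq] at e
  exact hn (by rw [e.1, e.2])

theorem isTied_of_tiedPart_ne_zero {a b : J} {F : Matrix (Fin 3) (Fin 3) k} {p i : Fin 3}
    (h : tiedPart 𝓜 a b F p i ≠ 0) : 𝓜.IsTied a b i p := by
  by_contra h'
  exact h (tiedPart_apply_of_not F h')

/-- A tied entry is the last in its row, so for two nonzero tied entries one product in their minor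
vanishes and the other does not. Hence a matrix of rank at most one has at most one tied entry, and
its tied part would be a multiple of a forbidden matrix unit. -/
theorem tiedPart_eq_zero {a b : J} {G} (hG : G ∈ 𝓜.R a b) (hm : MinorsVanish G) :
    tiedPart 𝓜 a b G = 0 := by
  by_contra hne
  obtain ⟨p, i, hpi⟩ : ∃ p i, tiedPart 𝓜 a b G p i ≠ 0 := by
    by_contra! h
    exact hne (Matrix.ext h)
  have ht := isTied_of_tiedPart_ne_zero hpi
  refine hne (eq_zero_of_support_subset ht (tiedPart_mem hG) fun q j hqj => ?_)
  have ht' := isTied_of_tiedPart_ne_zero hqj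
  by_contra he
  rw [tiedPart_apply_of G ht] at hpi
  rw [tiedPart_apply_of G ht'] at hqj
  have h1 := hm p q i j
  rcases ht.lt_or_lt ht' (Ne.symm he) with ⟨h, -⟩ | ⟨h, -⟩
  · rw [eq_zero_of_not_lt hG (ht.not_lt h), zero_mul] at h1
    exact mul_ne_zero hpi hqj h1
  · rw [eq_zero_of_not_lt hG (ht'.not_lt h), mul_zero] at h1
    exact mul_ne_zero hpi hqj h1

variable {s : J → Fin 3 → k}

theorem isNormal_single (hs : ∀ a i, s a i ≠ 0) {a b : J} {p i : Fin 3}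
    (h : Matrix.single p i (1 : k) ∈ 𝓜.R a b) :
    𝓜.IsNormal s a b ((s b p / s a i) • Matrix.single p i (1 : k)) := by
  have hz : ∀ q j, ((s b p / s a i) • Matrix.single p i (1 : k) :
      Matrix (Fin 3) (Fin 3) k) q j ≠ 0 → p = q ∧ i = j := fun q j hne => by
    by_contra h'
    exact hne (by rw [Matrix.smul_apply, Matrix.single_apply, if_neg h', smul_zero])
  refine ⟨(𝓜.R a b).smul_mem _ h, fun q j hne => ?_, fun q j l h1 h2 => ?_, fun q r j h1 h2 => ?_,
    Or.inl ⟨p, fun q j hne => (hz q j hne).1.symm⟩⟩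
  · obtain ⟨rfl, rfl⟩ := hz q j hne
    simp [mul_div_cancel₀ _ (hs a i)]
  · rw [← (hz _ _ h1).2, ← (hz _ _ h2).2]
  · rw [← (hz _ _ h1).1, ← (hz _ _ h2).1]

/-- Thinness holds because the entry at a tied position is additive, while by `tiedPart_eq_zero` it
vanishes on both summands with vanishing minors. -/
theorem Link.isNormal (hs : ∀ a i, s a i ≠ 0) {a b : J} {i p j q : Fin 3} {c : k}
    (h : 𝓜.Link a b i p j q c) (hc : s b q / s a j = s b p / s a i * c) :
    𝓜.IsNormal s a b ((s b p / s a i) • (Matrix.single p i (1 : k) +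
      c • Matrix.single q j (1 : k))) := by
  have hpq := h.lt_iff.2
  have hij := h.ne
  have e : (s b p / s a i) • (Matrix.single p i (1 : k) + c • Matrix.single q j (1 : k)) =
      (s b p / s a i) • Matrix.single p i (1 : k) + (s b q / s a j) • Matrix.single q j (1 : k) := by
    rw [hc, smul_add, smul_smul]
  have hmem := (𝓜.R a b).smul_mem (s b p / s a i) h.mem
  have h1 : ∀ r l, ((s b p / s a i) • (Matrix.single p i (1 : k) + c • Matrix.single q j (1 : k)) :
      Matrix (Fin 3) (Fin 3) k) r l ≠ 0 → (p = r ∧ i = l) ∨ (q = r ∧ j = l) := by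
    intro r l hne
    by_contra! h'
    rw [e, Matrix.add_apply, Matrix.smul_apply, Matrix.smul_apply, Matrix.single_apply,
      Matrix.single_apply, if_neg (fun h => h'.1 h.1 h.2), if_neg (fun h => h'.2 h.1 h.2)] at hne
    simp at hne
  refine ⟨hmem, ?_, ?_, ?_, Or.inr ⟨⟨p, q, fun r l hne => ?_⟩, ?_⟩⟩
  · intro r l hne
    rcases h1 r l hne with ⟨rfl, rfl⟩ | ⟨rfl, rfl⟩
    · rw [e]
      simp [hpq.symm, mul_div_cancel₀ _ (hs a i)]
    · rw [e]
      simp [hpq, mul_div_cancel₀ _ (hs a j)]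
  · intro r l l' hn hn'
    rcases h1 r l hn with h2 | h2 <;> rcases h1 r l' hn' with h3 | h3
    · rw [← h2.2, ← h3.2]
    · exact (hpq (h2.1.trans h3.1.symm)).elim
    · exact (hpq (h3.1.trans h2.1.symm)).elim
    · rw [← h2.2, ← h3.2]
  · intro r r' l hn hn'
    rcases h1 r l hn with h2 | h2 <;> rcases h1 r' l hn' with h3 | h3
    · rw [← h2.1, ← h3.1]
    · exact (hij (h2.2.trans h3.2.symm)).elim
    · exact (hij (h3.2.trans h2.2.symm)).elim
    · rw [← h2.1, ← h3.1]
  · exact (h1 r l hne).imp (fun h => h.1.symm) fun h => h.1.symm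
  · intro G hG H hH hsum hmG hmH
    have g1 := tiedPart_apply_of G h.tied
    have g2 := tiedPart_apply_of H h.tied
    rw [tiedPart_eq_zero hG hmG] at g1
    rw [tiedPart_eq_zero hH hmH] at g2
    have g3 := congrFun (congrFun hsum p) i
    rw [Matrix.add_apply, ← g1, ← g2, e] at g3
    have : s b p / s a i = 0 := by simpa [hpq.symm] using g3
    exact div_ne_zero (hs b p) (hs a i) this

/-- A rescaling compatible with an arrow is compatible with the corresponding links. -/
theorem Link.scale (hs : ∀ a i, s a i ≠ 0) {a b : J} {i p j q r t : Fin 3} {c : k}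
    (h : 𝓜.Link a b i p j q c) (hi : r ≠ i) (hj : r ≠ j) (hp : t ≠ p) (hq : t ≠ q)
    (hl : ∀ c, 𝓜.PairLink (a, r) (b, t) c →
      s b (Aggregate.hi t) / s b (lo t) = c * (s a (Aggregate.hi r) / s a (lo r))) :
    s b q / s a j = s b p / s a i * c := by
  have key : ∀ {i p j q : Fin 3} {c : k}, 𝓜.Link a b i p j q c → r ≠ i → r ≠ j → t ≠ p → t ≠ q →
      i < j → s b q / s a j = s b p / s a i * c := by
    intro i p j q c h hi hj hp hq hij
    obtain ⟨r', rfl, rfl⟩ := exists_lo_hi hij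
    obtain ⟨t', rfl, rfl⟩ := exists_lo_hi (h.lt_iff.1.1 hij)
    have e1 : r' = r := by
      by_contra hne
      exact (eq_lo_or_eq_hi (Ne.symm hne)).elim hi hj
    have e2 : t' = t := by
      by_contra hne
      exact (eq_lo_or_eq_hi (Ne.symm hne)).elim hp hq
    subst e1 e2
    have h1 := hl c h
    have := hs a (lo r')
    have := hs a (Aggregate.hi r')
    have := hs b (lo t')
    have := hs b (Aggregate.hi t')
    field_simp at h1 ⊢
    linear_combination h1
  rcases lt_or_gt_of_ne h.ne with hij | hij
  · exact key h hi hj hp hq hij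
  · have h1 := key h.symm hj hi hq hp hij
    rw [h1, mul_assoc, inv_mul_cancel₀ h.ne_zero, mul_one]

theorem exists_ne_ne (i j : Fin 3) : ∃ r : Fin 3, r ≠ i ∧ r ≠ j := by
  revert i j; decide

/-- After a suitable rescaling of the basis vectors the radical is spanned by normal matrices. -/
theorem exists_scale_span_isNormal [IsAlgClosed k] [Finite J] (𝓜 : RadicalModel k J) :
    ∃ s : J → Fin 3 → k, (∀ a i, s a i ≠ 0) ∧
      ∀ a b, 𝓜.R a b ≤ Submodule.span k {F | 𝓜.IsNormal s a b F} := by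
  obtain ⟨D, hD⟩ := exists_isDropping (𝓜 := 𝓜)
  obtain ⟨s, hs, hl⟩ := exists_scale hD
  refine ⟨s, hs, fun a b F hF => ?_⟩
  set N := Submodule.span k {F | 𝓜.IsNormal s a b F}
  have hN : ∀ {c : k} {G : Matrix (Fin 3) (Fin 3) k}, c ≠ 0 → 𝓜.IsNormal s a b (c • G) →
      G ∈ N := fun {c G} hc h => by
    have := N.smul_mem c⁻¹ (Submodule.subset_span h)
    rwa [smul_smul, inv_mul_cancel₀ hc, one_smul] at this
  have hlink : ∀ {i p j q r t : Fin 3} {c : k}, 𝓜.Link a b i p j q c → r ≠ i → r ≠ j → t ≠ p →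
      t ≠ q → 𝓜.IsFree D (b, t) →
      Matrix.single p i (1 : k) + c • Matrix.single q j (1 : k) ∈ N := by
    intro i p j q r t c h h1 h2 h3 h4 hf
    exact hN (div_ne_zero (hs b p) (hs a i))
      (h.isNormal hs (h.scale hs h1 h2 h3 h4 fun c hc => hl _ _ c hf hc))
  have h1 : F - tiedPart 𝓜 a b F ∈ N := sub_tiedPart_mem hF N fun p i h =>
    hN (div_ne_zero (hs b p) (hs a i)) (isNormal_single hs h)
  suffices h2 : tiedPart 𝓜 a b F ∈ N by
    have := N.add_mem h1 h2
    rwa [sub_add_cancel] at this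
  have hT := tiedPart_mem hF
  have htied : ∀ {p i}, tiedPart 𝓜 a b F p i ≠ 0 → 𝓜.IsTied a b i p :=
    isTied_of_tiedPart_ne_zero
  generalize tiedPart 𝓜 a b F = T at hT htied
  by_cases hg : 𝓜.IsGeneric a b
  -- With `l = D b`, the links joining `l` to `i` and `l` to `j` have missing indices `j` and `i`,
  -- so their target pairs are free. These two links already span the tied part; the dropped one,
  -- joining `i` and `j`, is superfluous.
  · obtain ⟨i, j, hi, hj, hij⟩ : ∃ i j, i ≠ D b ∧ j ≠ D b ∧ i ≠ j :=
      ⟨_, _, lo_ne _, hi_ne _, (lo_lt_hi (D b)).ne⟩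
    have hfree : ∀ {t}, t ≠ D b → 𝓜.IsFree D (b, t) := fun {t} ht =>
      ⟨⟨_, hg.arrow t⟩, fun _ _ => ht⟩
    generalize D b = l at hi hj hfree
    obtain ⟨x, hx⟩ := hg.link hi.symm
    obtain ⟨y, hy⟩ := hg.link hj.symm
    have m1 := hlink hx hj hij.symm hj hij.symm (hfree hj)
    have m2 := hlink hy hi hij hi hij (hfree hi)
    set U := (T i i / x) • (Matrix.single l l (1 : k) + x • Matrix.single i i (1 : k)) +
      (T j j / y) • (Matrix.single l l (1 : k) + y • Matrix.single j j (1 : k)) with hU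
    have hUN : U ∈ N := N.add_mem (N.smul_mem _ m1) (N.smul_mem _ m2)
    have hUR : U ∈ 𝓜.R a b := (𝓜.R a b).add_mem ((𝓜.R a b).smul_mem _ hx.mem)
      ((𝓜.R a b).smul_mem _ hy.mem)
    have h0 : T - U = 0 := by
      refine eq_zero_of_support_subset (hg l) ((𝓜.R a b).sub_mem hT hUR) fun r m hne => ?_
      by_contra h'
      apply hne
      rw [Matrix.sub_apply, sub_eq_zero, hU]
      simp only [Matrix.add_apply, Matrix.smul_apply, Matrix.single_apply, smul_eq_mul]
      by_cases hrm : r = m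
      · subst hrm
        have hrl : l ≠ r := fun h => h' (by rw [h])
        have hxx := hx.ne_zero
        have hyy := hy.ne_zero
        by_cases hri : r = i
        · subst hri
          simp [hrl, hij.symm, hxx]
        · have : r = j := by omega
          subst this
          simp [hrl, hij, hyy]
      · rw [if_neg (by rintro ⟨rfl, rfl⟩; exact hrm rfl),
          if_neg (by rintro ⟨rfl, rfl⟩; exact hrm rfl),
          if_neg (by rintro ⟨rfl, rfl⟩; exact hrm rfl)]
        simp only [mul_zero, add_zero]
        by_contra h3
        exact hrm (hg.eq (htied h3)).symm
    rw [sub_eq_zero.1 h0]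
    exact hUN
  · by_cases hT0 : T = 0
    · rw [hT0]
      exact N.zero_mem
    obtain ⟨p, i, hpi⟩ : ∃ p i, T p i ≠ 0 := by
      by_contra! h
      exact hT0 (Matrix.ext h)
    have t1 := htied hpi
    obtain ⟨j, q, c, hc⟩ := t1.exists_link
    have hpq := hc.lt_iff.2
    obtain ⟨r, hri, hrj⟩ := exists_ne_ne i j
    obtain ⟨t, htp, htq⟩ := exists_ne_ne p q
    have harr := hc.arrow hri hrj htp htq
    -- The only arrow into a dropped pair comes from its generic source, so a dropped target would
    -- make `R a b` generic.
    have hfree : 𝓜.IsFree D (b, t) := by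
      refine ⟨⟨_, harr⟩, fun a' ha' ht => ?_⟩
      simp only at ht ha'
      rw [ht] at harr
      have e := congrArg Prod.fst (hD.eq_of_arrow ha' harr)
      simp only at e
      rw [← e] at ha'
      exact hg ha'
    have hm := hlink hc hri hrj htp htq hfree
    have h0 : T - (T q j / c) • (Matrix.single p i (1 : k) + c • Matrix.single q j (1 : k)) = 0 := by
      refine eq_zero_of_support_subset t1 ((𝓜.R a b).sub_mem hT ((𝓜.R a b).smul_mem _ hc.mem))
        fun r m hne => ?_
      by_contra h'
      apply hne
      rw [Matrix.sub_apply, sub_eq_zero]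
      simp only [Matrix.add_apply, Matrix.smul_apply, Matrix.single_apply, smul_eq_mul]
      rw [if_neg (by rintro ⟨rfl, rfl⟩; exact h' rfl)]
      by_cases h3 : q = r ∧ j = m
      · obtain ⟨rfl, rfl⟩ := h3
        simp [hc.ne_zero]
      · rw [if_neg h3]
        simp only [mul_zero, add_zero]
        by_contra h4
        refine hg (isGeneric_of_three hc.tied hc.tied' (htied h4) ?_ (Ne.symm h') ?_)
        · exact fun e => hc.ne (congrArg Prod.fst e)
        · intro e
          rw [Prod.mk.injEq] at e
          exact h3 ⟨e.2, e.1⟩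
    rw [sub_eq_zero.1 h0]
    exact N.smul_mem _ hm

end RadicalModel

end Aggregate

theorem mainTheorem1 {k : Type u} [Field k] [IsAlgClosed k]
    {C : Type w} [Category.{v} C] [Preadditive C] [Linear k C]
    [∀ X Y : C, Module.Finite k (X ⟶ Y)] [HasFiniteBiproducts C] [IsIdempotentComplete C]
    (M : C ⥤ FGModuleCat.{u} k) [M.Additive] [M.Linear k] [M.Faithful]
    (hM : Aggregate.FinitelySpaced M)
    (J : Set C) (hJ : Aggregate.IsSpectroid J) :
    ∃ B : Aggregate.PairBasis M J, B.IsMultiplicative ∧ B.RankLE 2 := by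
  have := (Aggregate.finite_of_isSpectroid M hM hJ).to_subtype
  exact Aggregate.exists_pairBasis_of_normal M hM hJ fun 𝓜 => 𝓜.exists_scale_span_isNormal
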